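/- Let $\rho,\kappa>0$ with $\rho\kappa\le\pi/2$. Put $\mathcal H=L^2(\mathbb R,dr)$ and $\hat{\mathcal H}=L^2((0,\infty),dk)\otimes\mathbb C^2$, with elements $f=(f_+,f_-)$. For a function $\Psi(r,k)$, the associated transform is $$(\mathcal F f)(r)=\frac1{\sqrt{2\pi}}\int_0^\infty\big(\Psi(r,k)f_+(k)-\Psi(-r,k)f_-(k)\big)\,dk,\qquad f\in C_0^\infty((0,\infty))^2,$$ extended to a bounded operator $\hat{\mathcal H}\to\mathcal H$ when this is possible. Let $\mathcal F_0$ be the transform for $\Psi(r,k)=e^{irk}$ (the Fourier transform), and let $\mathcal F_0(\rho,\kappa)$ be the transform for $$\Psi(r,k)=\frac{w_0(r)^{1/2}}{\sinh\big(\frac{\pi}{\kappa}(k-\frac{i\pi}{\rho})\big)}\Big(e^{irk}\Big[e^{-\pi r/\rho}\sinh\Big(\frac{\pi}{\kappa}\Big(k-\frac{i\pi}{\rho}\Big)\Big)-e^{\pi r/\rho}\sinh\Big(\frac{\pi k}{\kappa}\Big)\Big]+e^{-irk}e^{-\pi r/\rho}\sinh\Big(\frac{i\pi^2}{\rho\kappa}\Big)\Big),$$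 $$w_0(r)=\frac{1}{4\sinh\big(\frac\pi\rho(r+\frac{i\pi}{2\kappa})\big)\sinh\big(\frac\pi\rho(r-\frac{i\pi}{2\kappa})\big)},$$ where $w_0(r)^{1/2}$ is the positive square root, except when $\rho\kappa=\pi/(2l)$ with $l\in\mathbb N^*$; then $w_0(r)=1/4\sinh^2(\pi r/\rho)$ and $w_0(r)^{1/2}$ denotes the meromorphic root $1/2\sinh(\pi r/\rho)$. For a vector $v$ of a Hilbert space, $v\otimes\overline v$ denotes the operator $x\mapsto (v,x)v$. Both $\mathcal F_0$ and $\mathcal F_0(\rho,\kappa)$ extend (uniquely) to bounded operators $\hat{\mathcal H}\to\mathcal H$, and the following holds. (1) Let $n\in\mathbb N^*$ and let $\rho\kappa$ belong to $I_n^-=\big(\frac{\pi}{2n+2},\frac{\pi}{2n+1}\big)$ or $I_n^+=\big(\frac{\pi}{2n+1},\frac{\pi}{2n}\big)$. For $j=1,\dots,n$ the functions $$\chi^{(e,j)}(k)=\frac{\sinh(j\rho k)}{\cosh\big(\frac{\pi k}{2\kappa}+\frac{i\pi^2}{2\rho\kappa}\big)}\begin{pmatrix}1\\-1\end{pmatrix},\qquad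 \chi^{(o,j)}(k)=\frac{\sinh(j\rho k)}{\sinh\big(\frac{\pi k}{2\kappa}+\frac{i\pi^2}{2\rho\kappa}\big)}\begin{pmatrix}1\\1\end{pmatrix},\qquad k>0,$$ belong to $\hat{\mathcal H}$, and $$\mathcal F_0(\rho,\kappa)^*\mathcal F_0(\rho,\kappa)=\mathbf 1_{\hat{\mathcal H}}+\frac{\rho\sin(\pi^2/\rho\kappa)}{2\pi}\sum_{j=1}^n\Big(\chi^{(e,j)}\otimes\overline{\chi^{(e,j)}}-\chi^{(o,j)}\otimes\overline{\chi^{(o,j)}}\Big);$$ the operator $\mathcal F_0(\rho,\kappa)^*\mathcal F_0(\rho,\kappa)-\mathbf 1_{\hat{\mathcal H}}$ has rank $2n$. (2) Let $m\in\mathbb N^*$ and let $\rho\kappa$ belong to $I_m=\big(\frac{\pi}{m+1},\frac{\pi}{m}\big)$. For $j=0,\dots,m-1$ the functions $\Psi^{(j)}(r)=h_j(r)w_0(r)^{1/2}$, with $h_j(r)=2\cosh((j+1)\kappa r)$ for $j$ even and $h_j(r)=2\sinh((j+1)\kappa r)$ for $j$ odd, belong to $\mathcal H$, and $$\mathcal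 F_0(\rho,\kappa)\mathcal F_0(\rho,\kappa)^*=\mathbf 1_{\mathcal H}+\frac{\kappa\sin(\pi^2/\rho\kappa)}{\pi}\sum_{j=0}^{m-1}(-1)^j\,\Psi^{(j)}\otimes\overline{\Psi^{(j)}};$$ the operator $\mathcal F_0(\rho,\kappa)\mathcal F_0(\rho,\kappa)^*-\mathbf 1_{\mathcal H}$ has rank $m$. (3) If $\rho\kappa=\pi/m$ with $m\in\{2,3,\dots\}$, then $\mathcal F_0(\rho,\kappa)=(-1)^{m-1}\mathcal F_0$. -/

import Mathlib

open MeasureTheory Set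
open scoped ContDiff ENNReal

noncomputable section

namespace IsometryBreakdown

/-- The position space `L²(ℝ, dr)`. -/
abbrev PosSpace : Type := Lp ℂ 2 (volume : Measure ℝ)

/-- The momentum space `L²((0,∞), dk) ⊗ ℂ²`, realised as `ℂ²`-valued `L²` functions on `(0,∞)`.
The component with index `0` is the one labelled `+`, the component with index `1` is the one
labelled `-`. -/
abbrev MomSpace : Type :=
  Lp (EuclideanSpace ℂ (Fin 2)) 2 ((volume : Measure ℝ).restrict (Ioi 0))

/-- The integral transform with kernels `F₊(r,k) = Ψ(r,k)` and `F₋(r,k) = -Ψ(-r,k)`. -/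
def transformIntegral (Psi : ℝ → ℝ → ℂ) (f : ℝ → EuclideanSpace ℂ (Fin 2)) (r : ℝ) : ℂ :=
  ((1 / Real.sqrt (2 * Real.pi) : ℝ) : ℂ) *
    ∫ k in Ioi (0 : ℝ), (Psi r k * f k 0 + (-Psi (-r) k) * f k 1)

/-- `F` is the bounded operator from the momentum space to the position space that is given by the
integral transform on the dense subspace `C₀^∞((0,∞))²`. -/
def IsTransform (Psi : ℝ → ℝ → ℂ) (F : MomSpace →L[ℂ] PosSpace) : Prop :=
  ∀ f : ℝ → EuclideanSpace ℂ (Fin 2),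
    ContDiff ℝ ∞ f → HasCompactSupport f → tsupport f ⊆ Ioi 0 →
    ∀ φ : MomSpace, φ =ᵐ[(volume : Measure ℝ).restrict (Ioi 0)] f →
      F φ =ᵐ[volume] transformIntegral Psi f

/-- The plane wave `exp(irk)`; its transform is the Fourier transform. -/
def planeWave (r k : ℝ) : ℂ := Complex.exp (Complex.I * r * k)

/-- The weight function
`w₀(r) = 1 / (4 sinh((π/ρ)(r + iπ/2κ)) sinh((π/ρ)(r - iπ/2κ)))`. For real `r` the two factors
are each other's conjugates, so the value is real and the real part is taken only to land in `ℝ`. -/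
def weight (ρ κ r : ℝ) : ℝ :=
  (1 / (4 * Complex.sinh (Real.pi / ρ * (r + Complex.I * Real.pi / (2 * κ))) *
      Complex.sinh (Real.pi / ρ * (r - Complex.I * Real.pi / (2 * κ)))) : ℂ).re

/-- The square root `w₀(r)^{1/2}`: the positive square root, unless `sin(π²/2ρκ) = 0`. In that
exceptional case `w₀(r) = 1 / (4 sinh(πr/ρ)²)` has a double pole at the origin, and `w₀(r)^{1/2}`
denotes its meromorphic square root `1 / (2 sinh(πr/ρ))`, which is negative for `r < 0`. -/
def weightRoot (ρ κ r : ℝ) : ℝ :=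
  open Classical in
  if Real.sin (Real.pi ^ 2 / (2 * (ρ * κ))) = 0 ∧ r < 0 then -Real.sqrt (weight ρ κ r)
  else Real.sqrt (weight ρ κ r)

/-- The wave function `Ψ(r,k)` that defines the transform. -/
def waveFunction (ρ κ r k : ℝ) : ℂ :=
  (weightRoot ρ κ r : ℂ) /
      Complex.sinh (Real.pi / κ * (k - Complex.I * Real.pi / ρ)) *
    (Complex.exp (Complex.I * r * k) *
        (Complex.exp (-(Real.pi * r / ρ)) *
            Complex.sinh (Real.pi / κ * (k - Complex.I * Real.pi / ρ)) -
          Complex.exp (Real.pi * r / ρ) * Complex.sinh (Real.pi / κ * k)) +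
      Complex.exp (-(Complex.I * r * k)) * Complex.exp (-(Real.pi * r / ρ)) *
        Complex.sinh (Complex.I * Real.pi ^ 2 / (ρ * κ)))

/-- The argument `πk/2κ + iπ²/2ρκ`. -/
def chiArg (ρ κ k : ℝ) : ℂ :=
  Real.pi * k / (2 * κ) + Complex.I * Real.pi ^ 2 / (2 * (ρ * κ))

/-- The even functions `χ^{(e,j)}`. -/
def chiEven (ρ κ : ℝ) (j : ℕ) (k : ℝ) : EuclideanSpace ℂ (Fin 2) :=
  ((Real.sinh (j * ρ * k) : ℂ) / Complex.cosh (chiArg ρ κ k)) • !₂[(1 : ℂ), -1]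

/-- The odd functions `χ^{(o,j)}`. -/
def chiOdd (ρ κ : ℝ) (j : ℕ) (k : ℝ) : EuclideanSpace ℂ (Fin 2) :=
  ((Real.sinh (j * ρ * k) : ℂ) / Complex.sinh (chiArg ρ κ k)) • !₂[(1 : ℂ), 1]

/-- The functions `h_j(r)`: `2 cosh((j+1)κr)` for `j` even and `2 sinh((j+1)κr)` for `j` odd. -/
def hFun (κ : ℝ) (j : ℕ) (r : ℝ) : ℝ :=
  if Even j then 2 * Real.cosh ((j + 1) * κ * r) else 2 * Real.sinh ((j + 1) * κ * r)

/-- The functions `Ψ^{(j)}(r) = h_j(r) w₀(r)^{1/2}`. -/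
def boundState (ρ κ : ℝ) (j : ℕ) (r : ℝ) : ℂ :=
  ((hFun κ j r * weightRoot ρ κ r : ℝ) : ℂ)

end IsometryBreakdown

end

open IsometryBreakdown

/-! Put a = π/ρ, c = π/(2κ) and θ = ac = π²/(2ρκ), so that w₀(r) = 1/(4|sinh(ar + iθ)|²). If sin 2θ
≠ 0, the theorem comes from computing ‖F f‖² and ‖F* φ‖² on test functions.

Split Ψ by parity in r. The numerators factor, and one half of sinh 2(ck − iθ) = 2 sinh cosh
cancels, leaving the denominator cosh(ck − iθ) in the even part and sinh(ck − iθ) in the odd part.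
So F f is a constant times w₀^{1/2} times a sum of an even and an odd amplitude Φ(c + ir) sinh(ar +
iθ) ± Φ(−c + ir) sinh(ar − iθ), where Φ is the entire Laplace transform of an odd extension built
from f. In the squared modulus divided by |sinh(ar + iθ)|², the terms with constant coefficients are
evaluated by Plancherel and give ‖f‖². What remains is sin 2θ times the integral of cot(as) G(s)
along Re s = c, with G(s) = Φ(s) times the conjugate of Φ at the conjugate of s. G is even, so the
integrals along Re s = ±c are opposite and each is half the sum of the residues between them
(`cotIntegral_eq_sum`). The poles jπ/a = jρ with 1 ≤ j ≤ n give |Φ(jρ)|², the squared inner products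
of f with the χ's. Isometry fails because of the poles between the origin and the line
(`integral_normSq_transformIntegral`).

The parity kernels keep their shape when (a, r) and (c, k) are exchanged, so the adjoint is treated
in the same way (`integral_normSq_adjointIntegral`). In the even channel cosh replaces sinh, that
is, θ becomes θ + π/2, and cot(x + π/2) = 2 cot 2x − cot x. The resulting poles combine to the
multiples of κ below π/ρ with alternating signs.

Quadratic forms determine operators (`adjoint_comp_self_eq`), the norm identity also gives
boundedness, and the ranks follow from independence of exponentials. If sin 2θ = 0, the reflected
wave drops out and Ψ is a plane wave up to sign (`waveFunction_eq_planeWave`). -/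

noncomputable section

namespace IsometryBreakdown

/-! ### Laplace transforms of test functions -/

section Laplace
open Filter Topology

/-- The two-sided Laplace transform `∫ u(k) exp(ks) dk`. -/
def laplace (u : ℝ → ℂ) (s : ℂ) : ℂ := ∫ k : ℝ, u k * Complex.exp (k * s)

/-- Test functions: smooth with compact support. -/
def IsTest (u : ℝ → ℂ) : Prop := ContDiff ℝ ∞ u ∧ HasCompactSupport u

lemma IsTest.continuous {u : ℝ → ℂ} (hu : IsTest u) : Continuous u := hu.1.continuous

lemma IsTest.integrable_mul {u g : ℝ → ℂ} (hu : IsTest u) (hg : Continuous g) :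
    Integrable (fun k => u k * g k) :=
  (hu.continuous.mul hg).integrable_of_hasCompactSupport hu.2.mul_right

lemma IsTest.mul_smooth {u g : ℝ → ℂ} (hu : IsTest u) (hg : ContDiff ℝ ∞ g) :
    IsTest (fun k => u k * g k) := ⟨hu.1.mul hg, hu.2.mul_right⟩

lemma IsTest.add {u v : ℝ → ℂ} (hu : IsTest u) (hv : IsTest v) : IsTest (fun k => u k + v k) :=
  ⟨hu.1.add hv.1, hu.2.add hv.2⟩

lemma IsTest.neg {u : ℝ → ℂ} (hu : IsTest u) : IsTest (fun k => -u k) :=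
  ⟨hu.1.neg, hu.2.neg⟩

lemma IsTest.sub {u v : ℝ → ℂ} (hu : IsTest u) (hv : IsTest v) : IsTest (fun k => u k - v k) := by
  simpa only [sub_eq_add_neg] using hu.add hv.neg

lemma IsTest.comp_neg {u : ℝ → ℂ} (hu : IsTest u) : IsTest (fun k => u (-k)) :=
  ⟨hu.1.comp contDiff_neg, hu.2.comp_homeomorph (Homeomorph.neg ℝ)⟩

lemma IsTest.conj {u : ℝ → ℂ} (hu : IsTest u) : IsTest (fun k => (starRingEnd ℂ) (u k)) :=
  ⟨Complex.conjCLE.contDiff.comp hu.1, hu.2.comp_left (map_zero _)⟩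

lemma IsTest.deriv {u : ℝ → ℂ} (hu : IsTest u) : IsTest (deriv u) :=
  ⟨((contDiff_infty_iff_deriv (𝕜 := ℝ)).1 hu.1).2, hu.2.deriv⟩

lemma continuous_exp_mul (s : ℂ) : Continuous fun k : ℝ => Complex.exp (k * s) := by fun_prop

/-- Compact support dominates the derivative of the integrand uniformly on balls, so the transform
is entire. This is what allows contours to be moved. -/
lemma laplace_differentiable {u : ℝ → ℂ} (hu : IsTest u) : Differentiable ℂ (laplace u) := by
  intro s₀
  have hc := hu.continuous
  refine (hasDerivAt_integral_of_dominated_loc_of_deriv_le (μ := volume)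
    (F := fun s (k : ℝ) => u k * Complex.exp (k * s))
    (F' := fun s (k : ℝ) => u k * (Complex.exp (k * s) * k))
    (bound := fun k : ℝ => ‖u k‖ * (Real.exp (|k| * (‖s₀‖ + 1)) * |k|))
    (Metric.ball_mem_nhds s₀ one_pos) ?_ ?_ ?_ ?_ ?_ ?_).2.differentiableAt
  · exact Eventually.of_forall fun s => by
      have : Continuous fun k : ℝ => u k * Complex.exp (k * s) := by fun_prop
      exact this.aestronglyMeasurable
  · exact hu.integrable_mul (continuous_exp_mul s₀)
  · have : Continuous fun k : ℝ => u k * (Complex.exp (k * s₀) * k) := by fun_prop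
    exact this.aestronglyMeasurable
  · refine Eventually.of_forall fun k s hs => ?_
    rw [norm_mul, norm_mul, Complex.norm_exp, Complex.norm_real, Real.norm_eq_abs]
    gcongr
    have h1 : ‖s‖ ≤ ‖s₀‖ + 1 := by
      have := norm_sub_norm_le s s₀
      rw [Metric.mem_ball, dist_eq_norm] at hs
      linarith
    calc (↑k * s).re ≤ ‖(k : ℂ) * s‖ := Complex.re_le_norm _
      _ = |k| * ‖s‖ := by simp
      _ ≤ _ := by gcongr
  · have : Continuous fun k : ℝ => ‖u k‖ * (Real.exp (|k| * (‖s₀‖ + 1)) * |k|) := by fun_prop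
    exact this.integrable_of_hasCompactSupport hu.2.norm.mul_right
  · refine Eventually.of_forall fun k s _ => ?_
    have h := ((hasDerivAt_id s).const_mul (k : ℂ)).cexp
    simp only [id, mul_one] at h
    exact h.const_mul (u k)

lemma laplace_norm_le {u : ℝ → ℂ} (hu : IsTest u) {B : ℝ} {s : ℂ} (hs : |s.re| ≤ B) :
    ‖laplace u s‖ ≤ ∫ k : ℝ, ‖u k‖ * Real.exp (|k| * B) := by
  have hc := hu.continuous
  refine norm_integral_le_of_norm_le ?_ (Eventually.of_forall fun k => ?_)
  · have : Continuous fun k : ℝ => ‖u k‖ * Real.exp (|k| * B) := by fun_prop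
    exact this.integrable_of_hasCompactSupport hu.2.norm.mul_right
  · rw [norm_mul, Complex.norm_exp]
    gcongr
    calc (↑k * s).re = k * s.re := by simp
      _ ≤ |k * s.re| := le_abs_self _
      _ = |k| * |s.re| := abs_mul _ _
      _ ≤ _ := by gcongr

lemma mul_laplace {u : ℝ → ℂ} (hu : IsTest u) (s : ℂ) :
    s * laplace u s = -laplace (deriv u) s := by
  have hd : ∀ k, HasDerivAt u (deriv u k) k := fun k =>
    (hu.1.differentiable (by simp) k).hasDerivAt
  have he : ∀ k : ℝ, HasDerivAt (fun k : ℝ => Complex.exp (k * s)) (Complex.exp (k * s) * s) k := by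
    intro k
    have h1 : HasDerivAt (fun k : ℝ => (k : ℂ) * s) (1 * s) k :=
      (Complex.ofRealCLM.hasDerivAt (x := k)).mul_const s
    simpa using h1.cexp
  have := integral_mul_deriv_eq_deriv_mul_of_integrable (u := u) (u' := deriv u)
    (v := fun k : ℝ => Complex.exp (k * s)) (v' := fun k : ℝ => Complex.exp (k * s) * s)
    (fun k _ => hd k) (fun k _ => he k) (hu.integrable_mul (by fun_prop)) (hu.deriv.integrable_mul (by fun_prop))
    (hu.integrable_mul (by fun_prop))
  rw [laplace, laplace, ← this, ← integral_const_mul]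
  congr 1; ext k; ring

/-- By `mul_laplace` a factor s costs one derivative of u. One power of decay per transform makes a
product of two integrable along vertical lines. -/
lemma laplace_decay {u : ℝ → ℂ} (hu : IsTest u) (B : ℝ) :
    ∃ M, 0 ≤ M ∧ ∀ s : ℂ, |s.re| ≤ B → ‖laplace u s‖ * (1 + ‖s‖) ≤ M := by
  refine ⟨(∫ k : ℝ, ‖u k‖ * Real.exp (|k| * B)) + ∫ k : ℝ, ‖deriv u k‖ * Real.exp (|k| * B),
    by positivity, fun s hs => ?_⟩
  rw [mul_add, mul_one]
  refine add_le_add (laplace_norm_le hu hs) ?_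
  rw [mul_comm, ← norm_mul, mul_laplace hu, norm_neg]
  exact laplace_norm_le hu.deriv hs

/-- Complex conjugation destroys holomorphy; reflecting the argument as well restores it. Squared
moduli can thus be continued off the real axis. -/
lemma laplace_conj (u : ℝ → ℂ) (s : ℂ) :
    laplace (fun k => (starRingEnd ℂ) (u k)) s
      = (starRingEnd ℂ) (laplace u ((starRingEnd ℂ) s)) := by
  rw [laplace, laplace, ← integral_conj]
  congr 1; ext k
  simp [← Complex.exp_conj]

lemma laplace_comp_neg (u : ℝ → ℂ) (s : ℂ) :
    laplace (fun k => u (-k)) s = laplace u (-s) := by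
  rw [laplace, laplace, ← integral_neg_eq_self]
  simp

lemma laplace_parity {u : ℝ → ℂ} {ε : ℂ} (h : ∀ k, u (-k) = ε * u k) (s : ℂ) :
    laplace u (-s) = ε * laplace u s := by
  rw [← laplace_comp_neg]
  simp only [h, laplace, mul_assoc]
  rw [integral_const_mul]

lemma laplace_add {u v : ℝ → ℂ} (hu : IsTest u) (hv : IsTest v) (s : ℂ) :
    laplace (fun k => u k + v k) s = laplace u s + laplace v s := by
  simp only [laplace, add_mul]
  exact integral_add (hu.integrable_mul (by fun_prop)) (hv.integrable_mul (by fun_prop))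

lemma laplace_neg (u : ℝ → ℂ) (s : ℂ) : laplace (fun k => -u k) s = -laplace u s := by
  simp only [laplace, neg_mul, integral_neg]

lemma laplace_sub {u v : ℝ → ℂ} (hu : IsTest u) (hv : IsTest v) (s : ℂ) :
    laplace (fun k => u k - v k) s = laplace u s - laplace v s := by
  simp only [sub_eq_add_neg, laplace_add hu hv.neg, laplace_neg]

/-- A bilinear Plancherel formula on a vertical line. -/
lemma integral_laplace_mul_laplace {u v : ℝ → ℂ} (hu : IsTest u) (hv : IsTest v) :
    ∫ r : ℝ, laplace u (r * Complex.I) * laplace v (r * Complex.I)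
      = 2 * Real.pi * ∫ k, u k * v (-k) := by
  open FourierTransform in
  set U := hu.2.toSchwartzMap hu.1
  set V := hv.2.toSchwartzMap hv.1
  -- The Fourier variable ξ corresponds to s = −2πiξ; the substitution in `h1` produces the factor
  -- 2π.
  have key : ∀ (w : ℝ → ℂ) (hw : IsTest w) (ξ : ℝ),
      𝓕 (hw.2.toSchwartzMap hw.1) ξ = laplace w ((-(2 * Real.pi) * ξ : ℝ) * Complex.I) := by
    intro w hw ξ
    rw [SchwartzMap.fourier_coe, Real.fourier_real_eq_integral_exp_smul, laplace]
    congr 1; ext k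
    rw [smul_eq_mul, mul_comm]
    congr 2
    push_cast; ring
  have h1 := SchwartzMap.integral_fourier_mul_eq U (𝓕 V)
  have h2 : ∀ x, 𝓕 (𝓕 V) x = V (-x) := by
    intro x
    have := congrFun (congrArg DFunLike.coe (FourierTransform.fourierInv_fourier_eq (F := SchwartzMap ℝ ℂ) V)) (-x)
    rw [← this, SchwartzMap.fourierInv_coe, SchwartzMap.fourier_coe, Real.fourierInv_eq_fourier_neg]
    simp
  simp only [h2] at h1
  have h3 : ∀ ξ, 𝓕 U ξ * 𝓕 V ξ = (fun r : ℝ => laplace u (r * Complex.I) *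
      laplace v (r * Complex.I)) (-(2 * Real.pi) * ξ) := fun ξ => by
    rw [key u hu, key v hv]
  rw [integral_congr_ae (Eventually.of_forall h3), Measure.integral_comp_mul_left
    (fun r : ℝ => laplace u (r * Complex.I) * laplace v (r * Complex.I))] at h1
  have h4 : ∫ k, u k * v (-k) = ∫ x, U x * V (-x) := rfl
  rw [h4, ← h1, abs_inv, abs_neg, abs_of_pos Real.two_pi_pos, Complex.real_smul]
  rw [Complex.ofReal_inv, ← mul_assoc]
  push_cast
  rw [mul_inv_cancel₀ (by simp [Real.pi_ne_zero]), one_mul]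

end Laplace

/-! ### Cotangent integrals along vertical lines -/

open Filter Topology Complex

/-- The antiderivative is arctan(y/t) − (i/2) log(t² + y²), whose logarithm is even in y and drops
out. As T → ∞ the value tends to ±π with the sign of t; this jump of 2π is the contribution of the
pole. -/
lemma integral_inv_add_mul_I {t : ℝ} (ht : t ≠ 0) (T : ℝ) :
    ∫ y in (-T)..T, ((t : ℂ) + y * I)⁻¹ = ((2 * Real.arctan (T / t) : ℝ) : ℂ) := by
  have hpos : ∀ y : ℝ, 0 < t ^ 2 + y ^ 2 := fun y => by positivity
  have hne : ∀ y : ℝ, (t : ℂ) + y * I ≠ 0 := fun y h => ht (by simpa using congrArg re h)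
  have hd : ∀ y : ℝ, HasDerivAt (fun y : ℝ => ((Real.arctan (y / t) : ℝ) : ℂ)
      - I / 2 * ((Real.log (t ^ 2 + y ^ 2) : ℝ) : ℂ)) (((t : ℂ) + y * I)⁻¹) y := by
    intro y
    have h1 : HasDerivAt (fun y : ℝ => Real.arctan (y / t)) (t / (t ^ 2 + y ^ 2)) y := by
      refine (((hasDerivAt_id y).div_const t).arctan).congr_deriv ?_
      have := hpos y
      simp only [id]
      field_simp
    have h2 : HasDerivAt (fun y : ℝ => Real.log (t ^ 2 + y ^ 2)) (2 * y / (t ^ 2 + y ^ 2)) y := by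
      have := ((hasDerivAt_pow 2 y).const_add (t ^ 2)).log (hpos y).ne'
      simpa using this
    refine (h1.ofReal_comp.sub (h2.ofReal_comp.const_mul (I / 2))).congr_deriv ?_
    have h3 : ((t ^ 2 + y ^ 2 : ℝ) : ℂ) = (t + y * I) * (t - y * I) := by
      push_cast; ring_nf; simp
    have h4 : (t : ℂ) - y * I ≠ 0 := fun h => ht (by simpa using congrArg re h)
    rw [ofReal_div, ofReal_div, h3]
    have := hne y
    field_simp
    push_cast
    ring
  rw [intervalIntegral.integral_eq_sub_of_hasDerivAt (fun y _ => hd y)]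
  · rw [neg_div, Real.arctan_neg, neg_sq]
    push_cast; ring
  · apply Continuous.intervalIntegrable
    exact Continuous.inv₀ (by fun_prop) hne

/-- Crossing a simple pole at the origin changes the integral along a vertical line by `2π` times
the residue. -/
lemma integral_div_sub_integral_div {Q : ℂ → ℂ} {P t₁ t₂ M : ℝ}
    (hQ : DifferentiableOn ℂ Q {s | |s.re| < P})
    (h₁ : 0 < t₁) (h₁P : t₁ < P) (h₂ : 0 < t₂) (h₂P : t₂ < P)
    (hM : ∀ s : ℂ, |s.re| < P → 1 ≤ |s.im| → ‖Q s / s‖ * (1 + s.im ^ 2) ≤ M)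
    (hi₁ : Integrable fun y : ℝ => Q ((-t₁ : ℝ) + y * I) / ((-t₁ : ℝ) + y * I))
    (hi₂ : Integrable fun y : ℝ => Q (t₂ + y * I) / (t₂ + y * I)) :
    (∫ y : ℝ, Q (t₂ + y * I) / (t₂ + y * I))
      - ∫ y : ℝ, Q ((-t₁ : ℝ) + y * I) / ((-t₁ : ℝ) + y * I) = 2 * Real.pi * Q 0 := by
  have hopen : IsOpen {s : ℂ | |s.re| < P} := isOpen_lt (by fun_prop) continuous_const
  -- (Q(s) − Q(0))/s is holomorphic across the origin, so Cauchy's theorem applies to it, while the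
  -- polar part Q(0)/s is integrated explicitly.
  have hd : DifferentiableOn ℂ (dslope Q 0) {s | |s.re| < P} :=
    (differentiableOn_dslope (hopen.mem_nhds (by simpa using h₁.trans h₁P))).2 hQ
  have hsl : ∀ s : ℂ, s ≠ 0 → dslope Q 0 s = Q s / s - Q 0 * s⁻¹ := fun s hs => by
    rw [dslope_of_ne _ hs, slope_def_field, sub_zero, sub_div, div_eq_mul_inv (Q 0)]
  have hre : ∀ x ∈ uIcc (-t₁) t₂, |x| < P := by
    intro x hx
    rw [uIcc_of_le (by linarith)] at hx
    exact abs_lt.2 ⟨by linarith [hx.1], by linarith [hx.2]⟩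
  -- the rectangle identity
  have hrect : ∀ T : ℝ, 0 < T →
      (∫ x : ℝ in (-t₁)..t₂, dslope Q 0 (x + (-T : ℝ) * I))
        - (∫ x : ℝ in (-t₁)..t₂, dslope Q 0 (x + (T : ℝ) * I))
        + I * ((∫ y in (-T)..T, Q (t₂ + y * I) / (t₂ + y * I))
          - Q 0 * (2 * Real.arctan (T / t₂) : ℝ))
        - I * ((∫ y in (-T)..T, Q ((-t₁ : ℝ) + y * I) / ((-t₁ : ℝ) + y * I))
          - Q 0 * (2 * Real.arctan (T / (-t₁)) : ℝ)) = 0 := by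
    intro T hT
    have := integral_boundary_rect_eq_zero_of_differentiableOn (dslope Q 0)
      (⟨-t₁, -T⟩ : ℂ) (⟨t₂, T⟩ : ℂ) (hd.mono fun s hs => by
        rw [mem_reProdIm] at hs
        exact hre _ hs.1)
    simp only [smul_eq_mul] at this
    have hside : ∀ t : ℝ, t ≠ 0 →
        IntervalIntegrable (fun y : ℝ => Q (t + y * I) / (t + y * I)) volume (-T) T →
        ∫ y in (-T)..T, dslope Q 0 (t + y * I)
          = (∫ y in (-T)..T, Q (t + y * I) / (t + y * I))
            - Q 0 * (2 * Real.arctan (T / t) : ℝ) := by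
      intro t ht hint
      have hne : ∀ y : ℝ, (t : ℂ) + y * I ≠ 0 := fun y h => ht (by simpa using congrArg re h)
      rw [← integral_inv_add_mul_I ht, ← intervalIntegral.integral_const_mul,
        ← intervalIntegral.integral_sub hint]
      · exact intervalIntegral.integral_congr fun y _ => hsl _ (hne y)
      · apply Continuous.intervalIntegrable
        exact (Continuous.inv₀ (by fun_prop) hne).const_mul _
    rw [hside t₂ h₂.ne' hi₂.intervalIntegrable, hside (-t₁) (by linarith) hi₁.intervalIntegrable] at this
    exact this
  -- the horizontal sides vanish in the limit
  have hbound : ∀ T : ℝ, 1 ≤ |T| → ∀ x ∈ uIcc (-t₁) t₂,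
      ‖dslope Q 0 (x + T * I)‖ ≤ (M + ‖Q 0‖) * |T|⁻¹ := by
    intro T hT x hx
    have hT0 : 0 < |T| := by linarith
    have hne : (x : ℂ) + T * I ≠ 0 := fun h => by
      have : T = 0 := by simpa using congrArg im h
      simp [this] at hT0
    rw [hsl _ hne, add_mul]
    refine (norm_sub_le _ _).trans (add_le_add ?_ ?_)
    · have := hM (x + T * I) (by simpa using hre x hx) (by simpa using hT)
      simp only [add_im, ofReal_im, mul_im, ofReal_re, I_im, mul_one, I_re, mul_zero, add_zero,
        zero_add] at this
      rw [← div_eq_mul_inv, le_div_iff₀ hT0]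
      refine le_trans (mul_le_mul_of_nonneg_left ?_ (norm_nonneg _)) this
      nlinarith [sq_abs T]
    · rw [norm_mul, norm_inv]
      gcongr
      simpa using abs_im_le_norm ((x : ℂ) + T * I)
  -- The horizontal sides have fixed length and an integrand of size O(1/T); σ = ±1 covers both.
  have hhor : ∀ σ : ℝ, |σ| = 1 → Tendsto (fun T : ℝ =>
      ∫ x : ℝ in (-t₁)..t₂, dslope Q 0 (x + (σ * T : ℝ) * I)) atTop (𝓝 0) := by
    intro σ hσ
    have hlim : Tendsto (fun T : ℝ => (M + ‖Q 0‖) * |T|⁻¹ * |t₂ - -t₁|) atTop (𝓝 0) := by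
      have := ((tendsto_inv_atTop_zero.comp tendsto_abs_atTop_atTop).const_mul
        (M + ‖Q 0‖)).mul_const |t₂ - -t₁|
      simpa using this
    refine squeeze_zero_norm' ?_ hlim
    filter_upwards [eventually_ge_atTop 1] with T hT
    refine intervalIntegral.norm_integral_le_of_norm_le_const fun x hx => ?_
    have := hbound (σ * T) (by rw [abs_mul, hσ, one_mul]; exact hT.trans (le_abs_self T)) x
      (uIoc_subset_uIcc hx)
    rwa [abs_mul, hσ, one_mul] at this
  have hA : ∀ t : ℝ, 0 < t → Tendsto (fun T : ℝ => Real.arctan (T / t)) atTop (𝓝 (Real.pi / 2)) :=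
    fun t ht => (Real.tendsto_arctan_atTop.mono_right nhdsWithin_le_nhds).comp
      (tendsto_id.atTop_div_const ht)
  have hA₂ := hA t₂ h₂
  have hA₁ : Tendsto (fun T : ℝ => Real.arctan (T / (-t₁))) atTop (𝓝 (-(Real.pi / 2))) := by
    simpa only [div_neg, Real.arctan_neg] using (hA t₁ h₁).neg
  have hI₁ := intervalIntegral_tendsto_integral hi₁ tendsto_neg_atTop_atBot tendsto_id
  have hI₂ := intervalIntegral_tendsto_integral hi₂ tendsto_neg_atTop_atBot tendsto_id
  have hc : ∀ {φ : ℝ → ℝ} {l : ℝ}, Tendsto φ atTop (𝓝 l) →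
      Tendsto (fun T => Q 0 * (2 * φ T : ℝ)) atTop (𝓝 (Q 0 * (2 * l : ℝ))) := fun h =>
    ((continuous_ofReal.tendsto _).comp (h.const_mul 2)).const_mul _
  have hlim := (((hhor (-1) (by simp)).sub (hhor 1 (by simp))).add
    ((hI₂.sub (hc hA₂)).const_mul I)).sub ((hI₁.sub (hc hA₁)).const_mul I)
  have hz := tendsto_nhds_unique (hlim.congr' (f₂ := fun _ => (0 : ℂ)) (by
    filter_upwards [eventually_gt_atTop 0] with T hT
    have := hrect T hT
    simpa using this)) tendsto_const_nhds
  have hII : I * I = -1 := I_mul_I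
  push_cast at hz ⊢
  linear_combination (-I) * hz + ((∫ y : ℝ, Q (t₂ + y * I) / (t₂ + y * I))
      - (∫ y : ℝ, Q (-(t₁ : ℂ) + y * I) / (-(t₁ : ℂ) + y * I)) - 2 * Real.pi * Q 0) * hII

lemma normSq_sin_add_mul_I (x y : ℝ) :
    normSq (sin (x + y * I)) = Real.sin x ^ 2 + Real.sinh y ^ 2 := by
  rw [sin_add_mul_I, ← ofReal_sin, ← ofReal_cos, ← ofReal_sinh, ← ofReal_cosh, ← ofReal_mul,
    ← ofReal_mul, normSq_add_mul_I]
  nlinarith [Real.sin_sq_add_cos_sq x, Real.cosh_sq y]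

lemma normSq_cos_add_mul_I (x y : ℝ) :
    normSq (cos (x + y * I)) = Real.cos x ^ 2 + Real.sinh y ^ 2 := by
  rw [cos_add_mul_I, ← ofReal_sin, ← ofReal_cos, ← ofReal_sinh, ← ofReal_cosh, ← ofReal_mul,
    ← ofReal_mul, sub_eq_add_neg, ← neg_mul, ← ofReal_neg, normSq_add_mul_I]
  nlinarith [Real.sin_sq_add_cos_sq x, Real.cosh_sq y]

/-- Rests on |sin(x + iy)|² = sin² x + sinh² y and |cos(x + iy)|² ≤ 1 + sinh² y. On a line free of
poles η = |sin x| serves; away from the real axis η = tanh b does. -/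
lemma norm_cos_div_sin_le {x y η : ℝ} (hη : 0 < η)
    (h : (1 + Real.sinh y ^ 2) * η ^ 2 ≤ Real.sin x ^ 2 + Real.sinh y ^ 2) :
    ‖cos (x + y * I) / sin (x + y * I)‖ ≤ η⁻¹ := by
  have hs : normSq (sin (x + y * I)) = ‖sin (x + y * I)‖ ^ 2 := normSq_eq_norm_sq _
  have hc : normSq (cos (x + y * I)) = ‖cos (x + y * I)‖ ^ 2 := normSq_eq_norm_sq _
  rw [normSq_sin_add_mul_I] at hs
  rw [normSq_cos_add_mul_I] at hc
  have hpos : 0 < ‖sin (x + y * I)‖ := by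
    refine lt_of_le_of_ne (norm_nonneg _) fun h0 => ?_
    rw [← h0] at hs
    have : 0 < (1 + Real.sinh y ^ 2) * η ^ 2 := by positivity
    nlinarith
  rw [norm_div, div_le_iff₀ hpos, ← div_eq_inv_mul, le_div_iff₀ hη]
  refine le_of_sq_le_sq ?_ hpos.le
  rw [mul_pow, ← hs, ← hc]
  nlinarith [Real.cos_sq_le_one x, sq_nonneg η]

lemma norm_cos_div_sin_le_of_sin {x : ℝ} (hx : Real.sin x ≠ 0) (y : ℝ) :
    ‖cos (x + y * I) / sin (x + y * I)‖ ≤ |Real.sin x|⁻¹ := by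
  refine norm_cos_div_sin_le (abs_pos.2 hx) ?_
  rw [sq_abs]
  nlinarith [Real.sin_sq_le_one x, sq_nonneg (Real.sinh y)]

lemma norm_cos_div_sin_le_of_im {b : ℝ} (hb : 0 < b) (x : ℝ) {y : ℝ} (hy : b ≤ |y|) :
    ‖cos (x + y * I) / sin (x + y * I)‖ ≤ (Real.tanh b)⁻¹ := by
  have hsb : 0 < Real.sinh b := Real.sinh_pos_iff.2 hb
  have hcb : 0 < Real.cosh b := Real.cosh_pos b
  refine norm_cos_div_sin_le (by rw [Real.tanh_eq_sinh_div_cosh]; positivity) ?_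
  have h1 : Real.sinh b ≤ |Real.sinh y| := by
    rw [Real.abs_sinh]; exact Real.sinh_le_sinh.2 hy
  have h2 : Real.sinh b ^ 2 ≤ Real.sinh y ^ 2 := by
    rw [← sq_abs (Real.sinh y)]; gcongr
  rw [Real.tanh_eq_sinh_div_cosh, div_pow, Real.cosh_sq, ← mul_div_assoc,
    div_le_iff₀ (by positivity)]
  nlinarith [sq_nonneg (Real.sin x), sq_nonneg (Real.sinh b)]

/-- Entire functions that decay quadratically along vertical strips. -/
structure StripDecay (g : ℂ → ℂ) : Prop where
  differentiable : Differentiable ℂ g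
  bound : ∀ B : ℝ, ∃ M, 0 ≤ M ∧ ∀ s : ℂ, |s.re| ≤ B → ‖g s‖ * (1 + s.im ^ 2) ≤ M

lemma StripDecay.laplace_mul {u v : ℝ → ℂ} (hu : IsTest u) (hv : IsTest v) :
    StripDecay fun s => laplace u s * laplace v s where
  differentiable := (laplace_differentiable hu).mul (laplace_differentiable hv)
  bound B := by
    obtain ⟨M, hM, h⟩ := laplace_decay hu B
    obtain ⟨M', hM', h'⟩ := laplace_decay hv B
    refine ⟨M * M', by positivity, fun s hs => ?_⟩
    calc ‖laplace u s * laplace v s‖ * (1 + s.im ^ 2)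
        ≤ ‖laplace u s * laplace v s‖ * ((1 + ‖s‖) * (1 + ‖s‖)) := by
          gcongr
          have := abs_im_le_norm s
          nlinarith [sq_abs s.im, abs_nonneg s.im, norm_nonneg s]
      _ = (‖laplace u s‖ * (1 + ‖s‖)) * (‖laplace v s‖ * (1 + ‖s‖)) := by rw [norm_mul]; ring
      _ ≤ M * M' := mul_le_mul (h s hs) (h' s hs) (by positivity) hM

lemma integrable_of_mul_one_add_sq_le {h : ℝ → ℂ} (hc : Continuous h) {M : ℝ}
    (hM : ∀ y, ‖h y‖ * (1 + y ^ 2) ≤ M) : Integrable h := by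
  refine (integrable_inv_one_add_sq.const_mul M).mono' hc.aestronglyMeasurable
    (Eventually.of_forall fun y => ?_)
  rw [← div_eq_mul_inv, le_div_iff₀ (by positivity)]
  exact hM y

lemma StripDecay.integrable_line {g : ℂ → ℂ} (hg : StripDecay g) (x : ℝ) :
    Integrable fun y : ℝ => g (x + y * I) := by
  obtain ⟨M, -, hM⟩ := hg.bound |x|
  refine integrable_of_mul_one_add_sq_le (M := M) ?_ fun y => ?_
  · exact hg.differentiable.continuous.comp (by fun_prop)
  · simpa using hM (x + y * I) (by simp)

/-- The integral of `cot (a s) g(s)` along the vertical line through `x`. -/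
def cotIntegral (a : ℝ) (g : ℂ → ℂ) (x : ℝ) : ℂ :=
  ∫ y : ℝ, cos (a * (x + y * I)) / sin (a * (x + y * I)) * g (x + y * I)

lemma sin_mul_add_ne_zero {a x : ℝ} (h : Real.sin (a * x) ≠ 0) (y : ℝ) :
    sin (a * (x + y * I)) ≠ 0 := by
  intro h0
  have := normSq_sin_add_mul_I (a * x) (a * y)
  push_cast at this
  rw [mul_assoc (a : ℂ) y I, ← mul_add, h0, map_zero] at this
  have : 0 < Real.sin (a * x) ^ 2 := by positivity
  nlinarith [sq_nonneg (Real.sinh (a * y))]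

lemma integrable_cot_mul {a x : ℝ} (h : Real.sin (a * x) ≠ 0) {g : ℂ → ℂ} (hg : StripDecay g) :
    Integrable fun y : ℝ => cos (a * (x + y * I)) / sin (a * (x + y * I)) * g (x + y * I) := by
  obtain ⟨M, hM0, hM⟩ := hg.bound |x|
  refine integrable_of_mul_one_add_sq_le (M := |Real.sin (a * x)|⁻¹ * M) ?_ fun y => ?_
  · have h1 := hg.differentiable.continuous
    exact (Continuous.div (by fun_prop) (by fun_prop) (sin_mul_add_ne_zero h)).mul
      (h1.comp (by fun_prop))
  · rw [norm_mul, mul_assoc]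
    refine mul_le_mul ?_ (by simpa using hM (x + y * I) (by simp)) (by positivity) (by positivity)
    have := norm_cos_div_sin_le_of_sin h (a * y)
    push_cast at this
    rwa [mul_assoc (a : ℂ) y I, ← mul_add] at this

lemma cotIntegral_neg {a : ℝ} {g : ℂ → ℂ} (heven : ∀ s, g (-s) = g s) (x : ℝ) :
    cotIntegral a g (-x) = -cotIntegral a g x := by
  rw [cotIntegral, cotIntegral, ← integral_neg_eq_self, ← integral_neg]
  congr 1; ext y
  have : ((-x : ℝ) : ℂ) + (-y : ℝ) * I = -(x + y * I) := by push_cast; ring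
  rw [this, heven, mul_neg, cos_neg, sin_neg]
  ring

lemma cos_div_sin_sub_nat_mul_pi (w : ℂ) (j : ℕ) :
    cos (w + j * Real.pi) / sin (w + j * Real.pi) = cos w / sin w := by
  rw [cos_antiperiodic.add_nat_mul_eq, sin_antiperiodic.add_nat_mul_eq, mul_div_mul_left _ _ (by simp)]

/-- Periodicity of the cotangent moves the pole at jπ/a to the origin. There
`integral_div_sub_integral_div` applies to Q(s) = s cot(as) g(s + jπ/a), which has the value
g(jπ/a)/a at 0. -/
lemma cotIntegral_crossing {a : ℝ} (ha : 0 < a) {g : ℂ → ℂ} (hg : StripDecay g) (j : ℕ)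
    {t₁ t₂ : ℝ} (h₁ : 0 < t₁) (h₁P : t₁ < Real.pi / a) (h₂ : 0 < t₂) (h₂P : t₂ < Real.pi / a) :
    cotIntegral a g (j * (Real.pi / a) + t₂) - cotIntegral a g (j * (Real.pi / a) - t₁)
      = 2 * Real.pi / a * g ((j * (Real.pi / a) : ℝ) : ℂ) := by
  set P := Real.pi / a with hP
  have haP : (a : ℂ) * P = Real.pi := by
    rw [hP, ← ofReal_mul, mul_div_cancel₀ _ ha.ne']
  have hsin : ∀ t : ℝ, t ≠ 0 → |t| < P → Real.sin (a * t) ≠ 0 := by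
    intro t ht htP h0
    rw [Real.sin_eq_zero_iff_of_lt_of_lt] at h0
    · simp [ha.ne', ht] at h0
    · have := (abs_lt.1 htP).1
      rw [hP, neg_lt, lt_div_iff₀ ha] at this
      linarith
    · have := (abs_lt.1 htP).2
      rw [hP, lt_div_iff₀ ha] at this
      linarith
  set S : ℂ → ℂ := fun s => sin (a * s) with hS
  have hSd : Differentiable ℂ S := by fun_prop
  -- sin(as) = s D(s) with D free of zeros on |Re s| < π/a, so Q below is holomorphic there.
  set D := dslope S 0 with hD
  have hDd : Differentiable ℂ D := fun s =>
    ((differentiableOn_dslope Filter.univ_mem).2 hSd.differentiableOn s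
      (mem_univ s)).differentiableAt Filter.univ_mem
  have hD0 : D 0 = a := by
    rw [hD, dslope_same, hS]
    have := ((hasDerivAt_id (0 : ℂ)).const_mul (a : ℂ)).csin
    simpa using this.deriv
  have hDs : ∀ s, s ≠ 0 → D s = sin (a * s) / s := fun s hs => by
    rw [hD, dslope_of_ne _ hs, slope_def_field, hS]; simp
  have hDne : ∀ s : ℂ, |s.re| < P → D s ≠ 0 := by
    intro s hs
    rcases eq_or_ne s 0 with rfl | h0
    · rw [hD0]; exact_mod_cast ha.ne'
    · rw [hDs s h0]
      refine div_ne_zero ?_ h0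
      rcases eq_or_ne s.re 0 with hr | hr
      · have hi : s.im ≠ 0 := fun hi => h0 (Complex.ext hr hi)
        intro hz
        have := normSq_sin_add_mul_I 0 (a * s.im)
        rw [show ((0 : ℝ) : ℂ) + (a * s.im : ℝ) * I = a * s by
          apply Complex.ext <;> simp [hr], hz] at this
        have h3 : Real.sinh (a * s.im) ≠ 0 := by
          rw [Ne, Real.sinh_eq_zero]; simp [ha.ne', hi]
        have : 0 < Real.sinh (a * s.im) ^ 2 := by positivity
        simp_all
      · have := sin_mul_add_ne_zero (hsin s.re hr hs) s.im
        rwa [re_add_im] at this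
  set Q : ℂ → ℂ := fun s => cos (a * s) * g (s + j * P) / D s with hQ
  have hQs : ∀ s : ℂ, s ≠ 0 → Q s / s
      = cos (a * (s + j * P)) / sin (a * (s + j * P)) * g (s + j * P) := by
    intro s hs
    rw [hQ]
    simp only
    rw [hDs s hs, mul_add, mul_left_comm, haP, cos_div_sin_sub_nat_mul_pi]
    by_cases h : sin (a * s) = 0
    · simp [h]
    · field_simp
  have hQd : DifferentiableOn ℂ Q {s | |s.re| < P} := by
    intro s hs
    have h1 : DifferentiableAt ℂ (fun s => cos (a * s) * g (s + j * P)) s := by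
      have := hg.differentiable
      fun_prop
    exact (h1.div (hDd s) (hDne s hs)).differentiableWithinAt
  obtain ⟨M, hM0, hM⟩ := hg.bound (P + j * P)
  have hP0 : 0 < P := by positivity
  have hMQ : ∀ s : ℂ, |s.re| < P → 1 ≤ |s.im| →
      ‖Q s / s‖ * (1 + s.im ^ 2) ≤ (Real.tanh a)⁻¹ * M := by
    intro s hs hi
    have h0 : s ≠ 0 := fun h => by simp [h] at hi; linarith
    rw [hQs s h0, norm_mul, mul_assoc]
    have hta : 0 < Real.tanh a := by
      rw [Real.tanh_eq_sinh_div_cosh]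
      exact div_pos (Real.sinh_pos_iff.2 ha) (Real.cosh_pos a)
    refine mul_le_mul ?_ ?_ (by positivity) (by positivity)
    · rw [mul_add, mul_left_comm, haP, cos_div_sin_sub_nat_mul_pi]
      have := norm_cos_div_sin_le_of_im ha (a * s.re) (y := a * s.im) (by
        rw [abs_mul, abs_of_pos ha]; nlinarith)
      rwa [show ((a * s.re : ℝ) : ℂ) + (a * s.im : ℝ) * I = a * s by
          apply Complex.ext <;> simp] at this
    · have := hM (s + j * P) (by
        have h2 : (s + (j : ℂ) * P).re = s.re + j * P := by simp
        rw [h2]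
        refine (abs_add_le _ _).trans (add_le_add hs.le ?_)
        rw [abs_of_nonneg (by positivity)])
      simpa using this
  have hline : ∀ t : ℝ, t ≠ 0 → ∀ y : ℝ, Q (t + y * I) / (t + y * I)
      = cos (a * ((j * P + t : ℝ) + y * I)) / sin (a * ((j * P + t : ℝ) + y * I))
        * g ((j * P + t : ℝ) + y * I) := by
    intro t ht y
    rw [hQs _ (fun h => ht (by simpa using congrArg re h))]
    rw [show (t : ℂ) + y * I + j * P = (j * P + t : ℝ) + y * I by push_cast; ring]
  have hint : ∀ t : ℝ, t ≠ 0 → |t| < P →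
      Integrable fun y : ℝ => Q (t + y * I) / (t + y * I) := by
    intro t ht htP
    simp only [hline t ht]
    refine integrable_cot_mul ?_ hg
    rw [mul_add, mul_left_comm, show a * P = Real.pi by rw [hP]; field_simp, add_comm,
      Real.sin_add_nat_mul_pi]
    exact mul_ne_zero (by simp) (hsin t ht htP)
  have ht₁ : -t₁ ≠ 0 := by linarith
  have key := integral_div_sub_integral_div hQd h₁ h₁P h₂ h₂P hMQ
    (hint (-t₁) ht₁ (by rw [abs_neg, abs_of_pos h₁]; exact h₁P))
    (hint t₂ h₂.ne' (by rw [abs_of_pos h₂]; exact h₂P))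
  simp only [hline _ ht₁, hline _ h₂.ne'] at key
  rw [cotIntegral, cotIntegral, sub_eq_add_neg ((j : ℝ) * P) t₁, key, hQ]
  simp only [hD0, mul_zero, cos_zero, zero_add, one_mul, ofReal_mul, ofReal_natCast]
  ring

/-- The integral of `cot (a s) g(s)` along a vertical line, for even `g`, as a sum of residues. -/
lemma cotIntegral_eq_sum {a : ℝ} (ha : 0 < a) {g : ℂ → ℂ} (hg : StripDecay g)
    (heven : ∀ s, g (-s) = g s) (n : ℕ) {c : ℝ} (h₁ : n * Real.pi < a * c)
    (h₂ : a * c < (n + 1) * Real.pi) :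
    cotIntegral a g c = 2 * Real.pi / a *
      (g 0 / 2 + ∑ j ∈ Finset.Icc 1 n, g ((j * (Real.pi / a) : ℝ) : ℂ)) := by
  set P := Real.pi / a with hP
  have hP0 : 0 < P := by positivity
  obtain ⟨t, ht⟩ : ∃ t, c = n * P + t := ⟨c - n * P, by ring⟩
  have haP : a * P = Real.pi := by rw [hP]; field_simp
  have ht0 : 0 < t := by
    rw [ht, mul_add, mul_left_comm, haP] at h₁
    by_contra! h
    nlinarith
  have htP : t < P := by
    rw [ht, mul_add, mul_left_comm, haP] at h₂
    rw [hP, lt_div_iff₀ ha]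
    linarith
  -- The lines through t and −t enclose only the pole at 0 and carry opposite integrals; hence the
  -- residue at 0 counts half.
  have hbase : cotIntegral a g t = 2 * Real.pi / a * (g 0 / 2) := by
    have := cotIntegral_crossing ha hg 0 ht0 htP ht0 htP
    simp only [Nat.cast_zero, zero_mul, zero_add, zero_sub, cotIntegral_neg heven] at this
    linear_combination this / 2
  rw [ht]
  clear ht h₁ h₂
  induction n with
  | zero => simpa using hbase
  | succ n ih =>
    -- Advance by one period from nP + t to (n + 1)P + t. The only pole passed, (n + 1)P, lies P − t
    -- beyond the first line.
    have := cotIntegral_crossing ha hg (n + 1) (t₁ := P - t) (t₂ := t) (by linarith)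
      (by linarith) ht0 htP
    rw [← hP, show ((n + 1 : ℕ) : ℝ) * P - (P - t) = n * P + t by push_cast; ring, ih] at this
    rw [Finset.sum_Icc_succ_top (by omega)]
    linear_combination this

/-! ### Shifted Plancherel formula and amplitudes -/

lemma isTest_mul_exp {u : ℝ → ℂ} (hu : IsTest u) (b : ℝ) :
    IsTest fun k => u k * exp (k * b) :=
  hu.mul_smooth (Complex.contDiff_exp.comp
    ((ofRealCLM.contDiff).mul contDiff_const))

lemma laplace_add_arg (u : ℝ → ℂ) (b s : ℂ) :
    laplace u (b + s) = laplace (fun k => u k * exp (k * b)) s := by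
  simp only [laplace, mul_add, exp_add, mul_assoc]

lemma integrable_laplace_mul_laplace {u v : ℝ → ℂ} (hu : IsTest u) (hv : IsTest v) (b b' : ℝ) :
    Integrable fun r : ℝ => laplace u (b + r * I) * laplace v (b' + r * I) := by
  simp only [laplace_add_arg]
  simpa using (StripDecay.laplace_mul (isTest_mul_exp hu b)
    (isTest_mul_exp hv b')).integrable_line 0

/-- Moving the line by b multiplies the test function by exp(bk), which reduces the claim to the
imaginary axis. -/
lemma integral_laplace_mul_laplace_shift {u v : ℝ → ℂ} (hu : IsTest u) (hv : IsTest v)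
    (b b' : ℝ) :
    ∫ r : ℝ, laplace u (b + r * I) * laplace v (b' + r * I)
      = 2 * Real.pi * ∫ k : ℝ, u k * v (-k) * exp (k * (b - b')) := by
  simp only [laplace_add_arg]
  rw [integral_laplace_mul_laplace (isTest_mul_exp hu b) (isTest_mul_exp hv b')]
  congr 2; ext k
  rw [mul_sub, sub_eq_add_neg, exp_add]
  push_cast
  rw [neg_mul]
  ring

/-- The amplitude `Φ(c + ir) sinh(ar + iθ) + δ Φ(-c + ir) sinh(ar - iθ)`, where `Φ` is the Laplace
transform of `u`. -/
def amplitude (a c θ δ : ℝ) (u : ℝ → ℂ) (r : ℝ) : ℂ :=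
  laplace u (c + r * I) * sinh (a * r + θ * I)
    + δ * (laplace u ((-c : ℝ) + r * I) * sinh (a * r - θ * I))

/-- The function `sinh²(ar) + sin²θ = |sinh(ar + iθ)|²`. -/
def sinhSq (a θ r : ℝ) : ℝ := Real.sinh (a * r) ^ 2 + Real.sin θ ^ 2

lemma sinhSq_pos {θ : ℝ} (hθ : Real.sin θ ≠ 0) (a r : ℝ) : 0 < sinhSq a θ r := by
  unfold sinhSq; positivity

lemma continuous_sinhSq (a θ : ℝ) : Continuous (sinhSq a θ) := by
  unfold sinhSq; fun_prop

lemma sinhSq_neg (a θ r : ℝ) : sinhSq a θ (-r) = sinhSq a θ r := by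
  simp [sinhSq]

lemma sinhSq_eq (a θ r : ℝ) :
    (sinhSq a θ r : ℂ) = sinh (a * r + θ * I) * sinh (a * r - θ * I) := by
  rw [sinh_add, sinh_sub, cosh_mul_I, sinh_mul_I, sinhSq]
  push_cast
  linear_combination -(sin (θ : ℂ)) ^ 2 * (cosh_sq (a * r : ℂ))
    - (sinh (a * r : ℂ)) ^ 2 * (sin_sq_add_cos_sq (θ : ℂ))
    + (cosh (a * r : ℂ)) ^ 2 * (sin (θ : ℂ)) ^ 2 * I_sq

lemma sinh_sub_mul_I_ne_zero {θ : ℝ} (hθ : Real.sin θ ≠ 0) (a r : ℝ) :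
    sinh (a * r - θ * I) ≠ 0 := fun h => by
  have := sinhSq_eq a θ r
  rw [h, mul_zero] at this
  exact (sinhSq_pos hθ a r).ne' (by exact_mod_cast this)

lemma sinh_add_mul_I_ne_zero {θ : ℝ} (hθ : Real.sin θ ≠ 0) (a r : ℝ) :
    sinh (a * r + θ * I) ≠ 0 := fun h => by
  have := sinhSq_eq a θ r
  rw [h, zero_mul] at this
  exact (sinhSq_pos hθ a r).ne' (by exact_mod_cast this)

lemma continuous_laplace_line {u : ℝ → ℂ} (hu : IsTest u) (b : ℝ) :
    Continuous fun r : ℝ => laplace u (b + r * I) :=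
  (laplace_differentiable hu).continuous.comp (by fun_prop)

lemma continuous_amplitude (a c θ δ : ℝ) {u : ℝ → ℂ} (hu : IsTest u) :
    Continuous (amplitude a c θ δ u) := by
  unfold amplitude
  have h1 := continuous_laplace_line hu c
  have h2 := continuous_laplace_line hu (-c)
  fun_prop

/-- For odd u (ε = −1) the amplitude is even when δ = 1 and odd when δ = −1; for even u it is the
reverse. -/
lemma amplitude_neg {ε : ℝ} {u : ℝ → ℂ} (hε : ∀ k, u (-k) = ε * u k)
    {δ : ℝ} (hδ : δ ^ 2 = 1) (a c θ r : ℝ) :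
    amplitude a c θ δ u (-r) = -(ε * δ) * amplitude a c θ δ u r := by
  have hδ' : (δ : ℂ) ^ 2 = 1 := by exact_mod_cast hδ
  unfold amplitude
  have h1 : laplace u (c + (-r : ℝ) * I) = ε * laplace u ((-c : ℝ) + r * I) := by
    rw [← laplace_parity hε]; congr 1; push_cast; ring
  have h2 : laplace u ((-c : ℝ) + (-r : ℝ) * I) = ε * laplace u (c + r * I) := by
    rw [← laplace_parity hε]; congr 1; push_cast; ring
  rw [h1, h2, show (a : ℂ) * (-r : ℝ) + θ * I = -(a * r - θ * I) by push_cast; ring,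
    show (a : ℂ) * (-r : ℝ) - θ * I = -(a * r + θ * I) by push_cast; ring, sinh_neg, sinh_neg]
  linear_combination (ε * laplace u ((-c : ℝ) + r * I) * sinh (a * r - θ * I)) * hδ'

/-- Conjugation takes c + ir to c − ir, and parity of u returns this to −c + ir. The squared modulus
therefore becomes a product of values of entire functions. -/
lemma conj_amplitude {ε : ℝ} {u : ℝ → ℂ} (hε : ∀ k, u (-k) = ε * u k)
    {δ : ℝ} (hδ : δ ^ 2 = 1) (a c θ r : ℝ) :
    (starRingEnd ℂ) (amplitude a c θ δ u r)
      = (ε * δ) * amplitude a c θ δ (fun k => (starRingEnd ℂ) (u k)) r := by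
  have hε' : ∀ k, (starRingEnd ℂ) (u (-k)) = ε * (starRingEnd ℂ) (u k) := fun k => by
    rw [hε, map_mul, conj_ofReal]
  have hδ' : (δ : ℂ) ^ 2 = 1 := by exact_mod_cast hδ
  have hp := laplace_parity (u := fun k => (starRingEnd ℂ) (u k)) hε'
  have h1 : (starRingEnd ℂ) (laplace u (c + r * I))
      = ε * laplace (fun k => (starRingEnd ℂ) (u k)) ((-c : ℝ) + r * I) := by
    rw [← hp, laplace_conj]
    congr 2
    simp [conj_ofReal]
    ring
  have h2 : (starRingEnd ℂ) (laplace u ((-c : ℝ) + r * I))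
      = ε * laplace (fun k => (starRingEnd ℂ) (u k)) (c + r * I) := by
    rw [← hp, laplace_conj]
    congr 2
    simp [conj_ofReal]
    ring
  have h3 : (starRingEnd ℂ) (sinh (a * r + θ * I)) = sinh (a * r - θ * I) := by
    rw [← sinh_conj]; simp [conj_ofReal, sub_eq_add_neg]
  have h4 : (starRingEnd ℂ) (sinh (a * r - θ * I)) = sinh (a * r + θ * I) := by
    rw [← sinh_conj]; simp [conj_ofReal]
  simp only [amplitude, map_add, map_mul, h1, h2, h3, h4, conj_ofReal]
  linear_combination -(ε * laplace (fun k => (starRingEnd ℂ) (u k)) ((-c : ℝ) + r * I)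
    * sinh (a * r - θ * I)) * hδ'

/-- Pointwise decomposition of the squared amplitude. -/
lemma normSq_amplitude_div {ε : ℝ} {u : ℝ → ℂ} (hε : ∀ k, u (-k) = ε * u k) (hε2 : ε ^ 2 = 1)
    {δ : ℝ} (hδ : δ ^ 2 = 1) {θ : ℝ} (hθ : Real.sin θ ≠ 0) (a c r : ℝ) {v : ℝ → ℂ}
    (hv : v = fun k => (starRingEnd ℂ) (u k)) :
    ((‖amplitude a c θ δ u r‖ ^ 2 / sinhSq a θ r : ℝ) : ℂ) = (ε * δ) *
      (cos (2 * θ) * (laplace u (c + r * I) * laplace v (c + r * I)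
          + laplace u ((-c : ℝ) + r * I) * laplace v ((-c : ℝ) + r * I))
        + δ * (laplace u (c + r * I) * laplace v ((-c : ℝ) + r * I)
          + laplace u ((-c : ℝ) + r * I) * laplace v (c + r * I))
        - sin (2 * θ) * (cos (θ + (a * r : ℝ) * I) / sin (θ + (a * r : ℝ) * I)
              * (laplace v (c + r * I) * laplace u (c + r * I))
            + cos (θ + (a * (-r) : ℝ) * I) / sin (θ + (a * (-r) : ℝ) * I)
              * (laplace v (c + (-r : ℝ) * I) * laplace u (c + (-r : ℝ) * I)))) := by
  have hε' : ∀ k, v (-k) = ε * v k := fun k => by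
    simp only [hv]; rw [hε, map_mul, conj_ofReal]
  have hδ' : (δ : ℂ) ^ 2 = 1 := by exact_mod_cast hδ
  have hε2' : (ε : ℂ) ^ 2 = 1 := by exact_mod_cast hε2
  have h1 : ∀ {w : ℝ → ℂ}, (∀ k, w (-k) = ε * w k) →
      laplace w (c + (-r : ℝ) * I) = ε * laplace w ((-c : ℝ) + r * I) := fun hw => by
    rw [← laplace_parity hw]; congr 1; push_cast; ring
  have hI : I * I = -1 := I_mul_I
  have hc1 : cos (θ + (a * r : ℝ) * I) = cosh (a * r - θ * I) := by
    rw [cos, cosh]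
    rw [show ((θ : ℂ) + (a * r : ℝ) * I) * I = -(a * r - θ * I) by
      push_cast; linear_combination (a * r : ℂ) * hI,
      show -((θ : ℂ) + (a * r : ℝ) * I) * I = (a * r - θ * I) by
      push_cast; linear_combination -(a * r : ℂ) * hI]
    ring
  have hs1 : sin (θ + (a * r : ℝ) * I) = I * sinh (a * r - θ * I) := by
    rw [sin, sinh]
    rw [show ((θ : ℂ) + (a * r : ℝ) * I) * I = -(a * r - θ * I) by
      push_cast; linear_combination (a * r : ℂ) * hI,
      show -((θ : ℂ) + (a * r : ℝ) * I) * I = (a * r - θ * I) by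
      push_cast; linear_combination -(a * r : ℂ) * hI]
    ring
  have hc2 : cos (θ + (a * (-r) : ℝ) * I) = cosh (a * r + θ * I) := by
    rw [cos, cosh]
    rw [show ((θ : ℂ) + (a * (-r) : ℝ) * I) * I = (a * r + θ * I) by
      push_cast; linear_combination -(a * r : ℂ) * hI,
      show -((θ : ℂ) + (a * (-r) : ℝ) * I) * I = -(a * r + θ * I) by
      push_cast; linear_combination (a * r : ℂ) * hI]
  have hs2 : sin (θ + (a * (-r) : ℝ) * I) = -I * sinh (a * r + θ * I) := by
    rw [sin, sinh]
    rw [show ((θ : ℂ) + (a * (-r) : ℝ) * I) * I = (a * r + θ * I) by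
      push_cast; linear_combination -(a * r : ℂ) * hI,
      show -((θ : ℂ) + (a * (-r) : ℝ) * I) * I = -(a * r + θ * I) by
      push_cast; linear_combination (a * r : ℂ) * hI]
    ring
  rw [ofReal_div, ← normSq_eq_norm_sq, ← mul_conj, conj_amplitude hε hδ, ← hv, sinhSq_eq,
    h1 hε, h1 hε', hc1, hc2, hs1, hs2]
  have hm := sinh_sub_mul_I_ne_zero hθ a r
  have hp := sinh_add_mul_I_ne_zero hθ a r
  -- Writing ar + iθ = (ar − iθ) + 2iθ shows that the quotient of the two conjugate factors is cos
  -- 2θ plus sin 2θ times a cotangent; `f1` and `f2` record both quotients.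
  have e1 : sinh (a * r + θ * I) = sinh (a * r - θ * I) * cos (2 * θ)
      + I * sin (2 * θ) * cosh (a * r - θ * I) := by
    rw [show (a * r + θ * I : ℂ) = (a * r - θ * I) + (2 * θ) * I by ring, sinh_add, cosh_mul_I,
      sinh_mul_I]; ring
  have e2 : sinh (a * r - θ * I) = sinh (a * r + θ * I) * cos (2 * θ)
      - I * sin (2 * θ) * cosh (a * r + θ * I) := by
    rw [show (a * r - θ * I : ℂ) = (a * r + θ * I) - (2 * θ) * I by ring, sinh_sub, cosh_mul_I,
      sinh_mul_I]; ring
  unfold amplitude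
  generalize laplace u (c + r * I) = α at *
  generalize laplace u ((-c : ℝ) + r * I) = β at *
  generalize laplace v (c + r * I) = α' at *
  generalize laplace v ((-c : ℝ) + r * I) = β' at *
  generalize cosh (a * r + θ * I) = Cp at *
  generalize cosh (a * r - θ * I) = Cm at *
  generalize hSp : sinh (a * r + θ * I) = Sp at *
  generalize hSm : sinh (a * r - θ * I) = Sm at *
  have hdiv1 : Cm / (I * Sm) = -(I * Cm / Sm) := by
    field_simp; linear_combination Cm * I_sq
  have hdiv2 : Cp / (-I * Sp) = I * Cp / Sp := by
    field_simp; linear_combination -Cp * I_sq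
  rw [hdiv1, hdiv2]
  have f1 : Sp / Sm = cos (2 * θ) + I * sin (2 * θ) * Cm / Sm := by
    rw [div_eq_iff hm, add_mul, div_mul_cancel₀ _ hm]; linear_combination e1
  have f2 : Sm / Sp = cos (2 * θ) - I * sin (2 * θ) * Cp / Sp := by
    rw [div_eq_iff hp, sub_mul, div_mul_cancel₀ _ hp]; linear_combination e2
  have expand : (α * Sp + δ * (β * Sm)) * (ε * δ * (α' * Sp + δ * (β' * Sm))) / (Sp * Sm)
      = ε * δ * (α * α' * (Sp / Sm) + δ ^ 2 * (β * β' * (Sm / Sp)) + δ * (α * β' + β * α')) := by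
    field_simp; ring
  rw [expand, f1, f2, hδ']
  linear_combination (ε * δ * sin (2 * θ) * I * Cp / Sp * (β * β')) * hε2'

lemma norm_conj_mul_self_laplace (u : ℝ → ℂ) (x : ℝ) :
    laplace (fun k => (starRingEnd ℂ) (u k)) x * laplace u x = ((‖laplace u x‖ ^ 2 : ℝ) : ℂ) := by
  rw [laplace_conj, conj_ofReal, conj_mul']
  push_cast; rfl

/-- The function `cot(θ + iar) |Φ|²(c + ir)`. -/
def cotDensity (a c θ : ℝ) (u : ℝ → ℂ) (r : ℝ) : ℂ :=
  cos (θ + (a * r : ℝ) * I) / sin (θ + (a * r : ℝ) * I)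
    * (laplace (fun k => (starRingEnd ℂ) (u k)) (c + r * I) * laplace u (c + r * I))

lemma integrable_cotDensity {θ : ℝ} (hθ : Real.sin θ ≠ 0) (a c : ℝ) {u : ℝ → ℂ} (hu : IsTest u) :
    Integrable (cotDensity a c θ u) := by
  have hne : ∀ r : ℝ, sin (θ + (a * r : ℝ) * I) ≠ 0 := fun r h => by
    have := normSq_sin_add_mul_I θ (a * r)
    rw [h, map_zero] at this
    have : 0 < Real.sin θ ^ 2 := by positivity
    nlinarith [sq_nonneg (Real.sinh (a * r))]
  refine (integrable_laplace_mul_laplace hu.conj hu c c).bdd_mul (c := |Real.sin θ|⁻¹) ?_ ?_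
  · exact (Continuous.div (by fun_prop) (by fun_prop) hne).aestronglyMeasurable
  · exact Eventually.of_forall fun r => norm_cos_div_sin_le_of_sin hθ (a * r)

/-- Shaped after `normSq_amplitude_div`: the slots hold the four products of transforms, the
cotangent density and its reflection. -/
lemma integral_linear_comb {f₁ f₂ f₃ f₄ f₅ f₆ : ℝ → ℂ} (h₁ : Integrable f₁) (h₂ : Integrable f₂)
    (h₃ : Integrable f₃) (h₄ : Integrable f₄) (h₅ : Integrable f₅) (h₆ : Integrable f₆)
    (A B C D : ℂ) :
    Integrable (fun r => D * (A * (f₁ r + f₂ r) + B * (f₃ r + f₄ r) - C * (f₅ r + f₆ r))) ∧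
    ∫ r, D * (A * (f₁ r + f₂ r) + B * (f₃ r + f₄ r) - C * (f₅ r + f₆ r))
      = D * (A * ((∫ r, f₁ r) + ∫ r, f₂ r) + B * ((∫ r, f₃ r) + ∫ r, f₄ r)
        - C * ((∫ r, f₅ r) + ∫ r, f₆ r)) := by
  have j₁ : Integrable fun r => A * (f₁ r + f₂ r) := (h₁.add h₂).const_mul A
  have j₂ : Integrable fun r => B * (f₃ r + f₄ r) := (h₃.add h₄).const_mul B
  have j₃ : Integrable fun r => C * (f₅ r + f₆ r) := (h₅.add h₆).const_mul C
  have j : Integrable fun r => A * (f₁ r + f₂ r) + B * (f₃ r + f₄ r) := j₁.add j₂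
  refine ⟨(j.sub j₃).const_mul D, ?_⟩
  rw [integral_const_mul, integral_sub j j₃, integral_add j₁ j₂, integral_const_mul,
    integral_const_mul, integral_const_mul, integral_add h₁ h₂, integral_add h₃ h₄,
    integral_add h₅ h₆]

/-- The squared norm of the amplitude in terms of `u` and a cotangent integral. -/
lemma integral_normSq_amplitude {ε : ℝ} {u : ℝ → ℂ} (hu : IsTest u)
    (hε : ∀ k, u (-k) = ε * u k) (hε2 : ε ^ 2 = 1)
    {δ : ℝ} (hδ : δ ^ 2 = 1) {θ : ℝ} (hθ : Real.sin θ ≠ 0) (a c : ℝ) :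
    Integrable (fun r => ‖amplitude a c θ δ u r‖ ^ 2 / sinhSq a θ r) ∧
    ((∫ r : ℝ, ‖amplitude a c θ δ u r‖ ^ 2 / sinhSq a θ r : ℝ) : ℂ)
      = ((4 * Real.pi * ∫ k, ‖u k‖ ^ 2 * (Real.cosh (2 * c * k) + δ * Real.cos (2 * θ)) : ℝ) : ℂ)
        - 2 * (ε * δ) * sin (2 * θ) * ∫ r, cotDensity a c θ u r := by
  set v : ℝ → ℂ := fun k => (starRingEnd ℂ) (u k) with hv
  have hvt : IsTest v := hu.conj
  have hp := fun r => normSq_amplitude_div hε hε2 hδ hθ a c r hv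
  have hZ : Integrable fun r => cotDensity a c θ u r := integrable_cotDensity hθ a c hu
  have hZ' : Integrable fun r => cotDensity a c θ u (-r) := hZ.comp_neg
  have i1 := integrable_laplace_mul_laplace hu hvt c c
  have i2 := integrable_laplace_mul_laplace hu hvt (-c) (-c)
  have i3 := integrable_laplace_mul_laplace hu hvt c (-c)
  have i4 := integrable_laplace_mul_laplace hu hvt (-c) c
  have hcomb := integral_linear_comb i1 i2 i3 i4 hZ hZ' (cos (2 * θ)) δ (sin (2 * θ)) (ε * δ)
  have hcongr : (fun r : ℝ => ((‖amplitude a c θ δ u r‖ ^ 2 / sinhSq a θ r : ℝ) : ℂ)) =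
    fun r : ℝ => (ε : ℂ) * δ * (cos (2 * θ) * (laplace u (c + r * I) * laplace v (c + r * I)
          + laplace u ((-c : ℝ) + r * I) * laplace v ((-c : ℝ) + r * I))
        + δ * (laplace u (c + r * I) * laplace v ((-c : ℝ) + r * I)
          + laplace u ((-c : ℝ) + r * I) * laplace v (c + r * I))
        - sin (2 * θ) * (cotDensity a c θ u r + cotDensity a c θ u (-r))) := by
    funext r
    exact hp r
  constructor
  · have : Integrable fun r => ((‖amplitude a c θ δ u r‖ ^ 2 / sinhSq a θ r : ℝ) : ℂ) := by
      rw [hcongr]; exact hcomb.1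
    simpa only [RCLike.re_to_complex, ofReal_re] using this.re
  -- Equal shifts give ∫|u|²; opposite shifts give the weights exp(±2ck), which combine to
  -- cosh(2ck). The two cotangent terms are reflections of each other and have the same integral.
  · rw [← integral_complex_ofReal, hcongr, hcomb.2,
      integral_neg_eq_self (cotDensity a c θ u),
      integral_laplace_mul_laplace_shift hu hvt, integral_laplace_mul_laplace_shift hu hvt,
      integral_laplace_mul_laplace_shift hu hvt, integral_laplace_mul_laplace_shift hu hvt]
    have huv : ∀ k : ℝ, u k * v (-k) = ε * ((‖u k‖ ^ 2 : ℝ) : ℂ) := fun k => by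
      simp only [hv]; rw [hε, map_mul, conj_ofReal, mul_left_comm, mul_conj']
      push_cast; rfl
    have hI0 : Integrable fun k : ℝ => ((‖u k‖ ^ 2 : ℝ) : ℂ) := by
      have h := hu.continuous
      refine Continuous.integrable_of_hasCompactSupport (by fun_prop) ?_
      exact (hu.2.comp_left (g := fun z : ℂ => ((‖z‖ ^ 2 : ℝ) : ℂ)) (by simp))
    have hIe : ∀ b : ℝ, Integrable fun k : ℝ => ((‖u k‖ ^ 2 : ℝ) : ℂ) * exp (k * b) := by
      intro b
      have h := hu.continuous
      refine Continuous.integrable_of_hasCompactSupport (by fun_prop) (HasCompactSupport.mul_right ?_)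
      exact (hu.2.comp_left (g := fun z : ℂ => ((‖z‖ ^ 2 : ℝ) : ℂ)) (by simp))
    have hmain : ((∫ k, ‖u k‖ ^ 2 * (Real.cosh (2 * c * k) + δ * Real.cos (2 * θ)) : ℝ) : ℂ)
        = (∫ k : ℝ, ((‖u k‖ ^ 2 : ℝ) : ℂ) * exp (k * (2 * c : ℝ))) / 2
          + (∫ k : ℝ, ((‖u k‖ ^ 2 : ℝ) : ℂ) * exp (k * (-(2 * c) : ℝ))) / 2
          + δ * cos (2 * θ) * ∫ k : ℝ, ((‖u k‖ ^ 2 : ℝ) : ℂ) := by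
      have h := (integral_linear_comb (hIe (2 * c)) (hIe (-(2 * c))) hI0 hI0 hI0 hI0 (1 / 2)
        (δ * cos (2 * θ) / 2) 0 1).2
      rw [← integral_complex_ofReal]
      refine Eq.trans ?_ (h.trans (by ring))
      congr 1; ext k
      simp only [ofReal_mul, ofReal_add, ofReal_cosh, ofReal_cos, cosh]
      push_cast
      rw [show (k : ℂ) * -(2 * c) = -(2 * c * k) by ring, show (k : ℂ) * (2 * c) = 2 * c * k by ring]
      ring
    rw [ofReal_mul, hmain]
    simp only [huv, mul_assoc, integral_const_mul, sub_self, mul_zero, exp_zero, mul_one]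
    rw [show (c : ℂ) - ((-c : ℝ) : ℂ) = ((2 * c : ℝ) : ℂ) by push_cast; ring,
      show ((-c : ℝ) : ℂ) - (c : ℂ) = ((-(2 * c) : ℝ) : ℂ) by push_cast; ring]
    have hδ' : (δ : ℂ) ^ 2 = 1 := by exact_mod_cast hδ
    have hε2' : (ε : ℂ) ^ 2 = 1 := by exact_mod_cast hε2
    generalize (∫ k : ℝ, ((‖u k‖ ^ 2 : ℝ) : ℂ) * exp (k * (2 * c : ℝ))) = A
    generalize (∫ k : ℝ, ((‖u k‖ ^ 2 : ℝ) : ℂ) * exp (k * (-(2 * c) : ℝ))) = B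
    generalize (∫ k : ℝ, ((‖u k‖ ^ 2 : ℝ) : ℂ)) = E
    push_cast
    linear_combination (4 * Real.pi * cos (2 * θ) * δ * E + 2 * Real.pi * (A + B)) * hε2'
      + (ε ^ 2 * 2 * Real.pi * (A + B)) * hδ'

/-- The choice θ = ac makes θ + iar equal to as on the line s = c + ir. -/
lemma integral_cotDensity (a c : ℝ) (u : ℝ → ℂ) :
    ∫ r, cotDensity a c (a * c) u r
      = cotIntegral a (fun s => laplace (fun k => (starRingEnd ℂ) (u k)) s * laplace u s) c := by
  rw [cotIntegral]
  congr 1; ext r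
  rw [cotDensity, show (((a * c : ℝ) : ℂ) + (a * r : ℝ) * I) = a * (c + r * I) by push_cast; ring]

lemma even_normSq_laplace {ε : ℝ} {u : ℝ → ℂ} (hε : ∀ k, u (-k) = ε * u k) (hε2 : ε ^ 2 = 1)
    (s : ℂ) : laplace (fun k => (starRingEnd ℂ) (u k)) (-s) * laplace u (-s)
      = laplace (fun k => (starRingEnd ℂ) (u k)) s * laplace u s := by
  have hε' : ∀ k, (starRingEnd ℂ) (u (-k)) = ε * (starRingEnd ℂ) (u k) := fun k => by
    rw [hε, map_mul, conj_ofReal]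
  have hε2' : (ε : ℂ) ^ 2 = 1 := by exact_mod_cast hε2
  rw [laplace_parity hε, laplace_parity (u := fun k => (starRingEnd ℂ) (u k)) hε']
  linear_combination (laplace (fun k => (starRingEnd ℂ) (u k)) s * laplace u s) * hε2'

lemma sin_ne_zero_of_mem {n : ℕ} {θ : ℝ} (h₁ : n * Real.pi < θ) (h₂ : θ < (n + 1) * Real.pi) :
    Real.sin θ ≠ 0 := by
  have h : Real.sin (θ - n * Real.pi) ≠ 0 :=
    (Real.sin_pos_of_pos_of_lt_pi (by linarith) (by linarith)).ne'
  rw [Real.sin_sub_nat_mul_pi] at h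
  exact right_ne_zero_of_mul h

/-- The squared norm of the amplitude at `θ = ac`. -/
lemma integral_normSq_amplitude_sinh {ε : ℝ} {u : ℝ → ℂ} (hu : IsTest u)
    (hε : ∀ k, u (-k) = ε * u k) (hε2 : ε ^ 2 = 1)
    {δ : ℝ} (hδ : δ ^ 2 = 1) {a c : ℝ} (ha : 0 < a) {n : ℕ} (h₁ : n * Real.pi < a * c)
    (h₂ : a * c < (n + 1) * Real.pi) :
    ∫ r, ‖amplitude a c (a * c) δ u r‖ ^ 2 / sinhSq a (a * c) r
      = 4 * Real.pi * (∫ k, ‖u k‖ ^ 2 * (Real.cosh (2 * c * k) + δ * Real.cos (2 * (a * c))))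
        - ε * δ * (4 * Real.pi * Real.sin (2 * (a * c)) / a) *
          (‖laplace u 0‖ ^ 2 / 2
            + ∑ j ∈ Finset.Icc 1 n, ‖laplace u ((j * (Real.pi / a) : ℝ) : ℂ)‖ ^ 2) := by
  have h := (integral_normSq_amplitude hu hε hε2 hδ (sin_ne_zero_of_mem h₁ h₂) a c).2
  rw [integral_cotDensity, cotIntegral_eq_sum ha (StripDecay.laplace_mul hu.conj hu)
    (even_normSq_laplace hε hε2) n h₁ h₂] at h
  have h0 := norm_conj_mul_self_laplace u 0
  rw [ofReal_zero] at h0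
  simp only [norm_conj_mul_self_laplace, h0] at h
  rw [← ofReal_inj, h]
  push_cast
  ring

/-- The squared norm of the amplitude at `θ = ac + π/2`. -/
lemma integral_normSq_amplitude_cosh {u : ℝ → ℂ} (hu : IsTest u)
    (hε : ∀ k, u (-k) = u k) {a c : ℝ} (ha : 0 < a) {m : ℕ} (h₁ : m * Real.pi < 2 * (a * c))
    (h₂ : 2 * (a * c) < (m + 1) * Real.pi) :
    ∫ r, ‖amplitude a c (a * c + Real.pi / 2) 1 u r‖ ^ 2 / sinhSq a (a * c + Real.pi / 2) r
      = 4 * Real.pi * (∫ k, ‖u k‖ ^ 2 * (Real.cosh (2 * c * k) - Real.cos (2 * (a * c))))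
        + (4 * Real.pi * Real.sin (2 * (a * c)) / a) *
          (∑ j ∈ Finset.Icc 1 m, ‖laplace u ((j * (Real.pi / (2 * a)) : ℝ) : ℂ)‖ ^ 2
            - ∑ j ∈ Finset.Icc 1 (m / 2), ‖laplace u ((j * (Real.pi / a) : ℝ) : ℂ)‖ ^ 2) := by
  have hε' : ∀ k, u (-k) = (1 : ℝ) * u k := by simpa using hε
  have hs2 : Real.sin (2 * a * c) ≠ 0 := by
    rw [mul_assoc]; exact sin_ne_zero_of_mem h₁ h₂
  have hsc : Real.sin (a * c) ≠ 0 ∧ Real.cos (a * c) ≠ 0 := by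
    rw [mul_assoc, Real.sin_two_mul] at hs2
    exact ⟨right_ne_zero_of_mul (left_ne_zero_of_mul hs2), right_ne_zero_of_mul hs2⟩
  have hθ : Real.sin (a * c + Real.pi / 2) ≠ 0 := by
    rw [Real.sin_add_pi_div_two]; exact hsc.2
  have h := (integral_normSq_amplitude hu hε' (one_pow 2) (one_pow 2) hθ a c).2
  set g : ℂ → ℂ := fun s => laplace (fun k => (starRingEnd ℂ) (u k)) s * laplace u s with hg
  have hgd : StripDecay g := StripDecay.laplace_mul hu.conj hu
  have hge : ∀ s, g (-s) = g s := even_normSq_laplace hε' (one_pow 2)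
  -- Below c there are m poles of cot(2as) on the positive axis, and every second one is a pole of
  -- cot(as); hence the floor m / 2.
  have hn₁ : ((m / 2 : ℕ) : ℝ) * Real.pi < a * c := by
    have : ((m / 2 : ℕ) : ℝ) ≤ m / 2 := Nat.cast_div_le
    nlinarith [Real.pi_pos]
  have hn₂ : a * c < (((m / 2 : ℕ) : ℝ) + 1) * Real.pi := by
    have : (m : ℝ) + 1 ≤ 2 * (((m / 2 : ℕ) : ℝ) + 1) := by
      have : m + 1 ≤ 2 * (m / 2 + 1) := by omega
      exact_mod_cast this
    nlinarith [Real.pi_pos]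
  -- This is cot(x + π/2) = −tan x = 2 cot 2x − cot x at x = as. The half residues of the two
  -- cotangents at s = 0 cancel.
  have hcot : ∫ r, cotDensity a c (a * c + Real.pi / 2) u r
      = 2 * cotIntegral (2 * a) g c - cotIntegral a g c := by
    rw [cotIntegral, cotIntegral, ← integral_const_mul,
      ← integral_sub ((integrable_cot_mul hs2 hgd).const_mul 2) (integrable_cot_mul hsc.1 hgd)]
    congr 1; ext r
    rw [cotDensity, show (((a * c + Real.pi / 2 : ℝ) : ℂ) + (a * r : ℝ) * I)
      = a * (c + r * I) + Real.pi / 2 by push_cast; ring, cos_add_pi_div_two, sin_add_pi_div_two,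
      show ((2 * a : ℝ) : ℂ) * (c + r * I) = 2 * (a * (c + r * I)) by push_cast; ring,
      cos_two_mul, sin_two_mul]
    have hS := sin_mul_add_ne_zero hsc.1 r
    have hC : cos (a * (c + r * I)) ≠ 0 := by
      intro h0
      have := sin_mul_add_ne_zero hs2 r
      rw [show ((2 * a : ℝ) : ℂ) * (c + r * I) = 2 * (a * (c + r * I)) by push_cast; ring,
        sin_two_mul, h0, mul_zero] at this
      exact this rfl
    have hsq := sin_sq_add_cos_sq (a * (c + r * I))
    simp only [hg]
    generalize laplace (fun k => (starRingEnd ℂ) (u k)) (c + r * I) * laplace u (c + r * I) = G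
    generalize sin (a * (c + r * I)) = S at *
    generalize cos (a * (c + r * I)) = C at *
    field_simp
    linear_combination -G * hsq
  rw [hcot, cotIntegral_eq_sum ha hgd hge (m / 2) hn₁ hn₂,
    cotIntegral_eq_sum (by positivity) hgd hge m (by rw [mul_assoc]; exact h₁)
      (by rw [mul_assoc]; exact h₂)] at h
  simp only [hg, norm_conj_mul_self_laplace] at h
  rw [← ofReal_inj, h]
  have e1 : Real.cos (2 * (a * c + Real.pi / 2)) = -Real.cos (2 * (a * c)) := by
    rw [mul_add, mul_div_cancel₀ _ two_ne_zero, Real.cos_add_pi]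
  have e2 : sin (2 * ((a * c + Real.pi / 2 : ℝ) : ℂ)) = -sin (2 * (a * c)) := by
    push_cast
    rw [mul_add, mul_div_cancel₀ _ two_ne_zero, sin_add_pi]
  rw [e1, e2]
  push_cast
  have ha' : (a : ℂ) ≠ 0 := by exact_mod_cast ha.ne'
  simp only [one_mul, ← sub_eq_add_neg]
  field_simp
  ring

/-! ### Parity decomposition of the wave function -/

/-- The positive square root of the weight, `1 / (2 |sinh(ar + iθ)|)`. -/
def rootWeight (a θ r : ℝ) : ℝ := (2 * Real.sqrt (sinhSq a θ r))⁻¹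

/-- The wave function in terms of `a = π/ρ`, `c = π/(2κ)` and `θ = ac`. -/
def waveKernel (a c θ r k : ℝ) : ℂ :=
  (rootWeight a θ r : ℂ) / sinh (2 * (c * k - θ * I)) *
    (exp (I * r * k) * (exp (-(a * r)) * sinh (2 * (c * k - θ * I))
        - exp (a * r) * sinh (2 * (c * k)))
      + exp (-(I * r * k)) * exp (-(a * r)) * sinh (2 * (θ * I)))

/-- The function `2 sinh(k(c + ir)) sinh(ar + iθ) - 2δ sinh(k(c - ir)) sinh(ar - iθ)`. -/
def parityKernel (a c θ δ r k : ℝ) : ℂ :=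
  2 * sinh (k * (c + r * I)) * sinh (a * r + θ * I)
    - δ * (2 * sinh (k * (c - r * I)) * sinh (a * r - θ * I))

lemma rootWeight_neg (a θ r : ℝ) : rootWeight a θ (-r) = rootWeight a θ r := by
  rw [rootWeight, sinhSq_neg, rootWeight]

lemma rootWeight_sq {θ : ℝ} (a r : ℝ) :
    rootWeight a θ r ^ 2 = (4 * sinhSq a θ r)⁻¹ := by
  rw [rootWeight, inv_pow, mul_pow, Real.sq_sqrt (by unfold sinhSq; positivity)]
  norm_num

lemma continuous_rootWeight {θ : ℝ} (hθ : Real.sin θ ≠ 0) (a : ℝ) :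
    Continuous (rootWeight a θ) := by
  have := continuous_sinhSq a θ
  refine Continuous.inv₀ (by fun_prop) fun r => ?_
  have := Real.sqrt_pos.2 (sinhSq_pos hθ a r)
  positivity

/-- With x = ar, y = ck, t = iθ, K = irk the left side is the numerator of Ψ(r,k) + Ψ(−r,k). The
factor sinh(y − t) cancels against sinh 2(y − t), leaving cosh(y − t) in the denominator. Both sides
are Laurent polynomials in exponentials. -/
lemma exp_identity_add {x y t K : ℂ} :
    exp K * (exp (-x) * sinh (2 * (y - t)) - exp x * sinh (2 * y))
      + exp (-K) * exp (-x) * sinh (2 * t)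
      + (exp (-K) * (exp x * sinh (2 * (y - t)) - exp (-x) * sinh (2 * y))
      + exp K * exp x * sinh (2 * t))
    = -(2 * sinh (y - t)) * (2 * sinh (y + K) * sinh (x + t)
        - 2 * sinh (y - K) * sinh (x - t)) := by
  simp only [sinh, two_mul, neg_add, sub_eq_add_neg, exp_add, neg_neg, exp_neg]
  have := exp_ne_zero x
  have := exp_ne_zero y
  have := exp_ne_zero t
  have := exp_ne_zero K
  field_simp
  ring

/-- The counterpart for Ψ(r,k) − Ψ(−r,k): here cosh(y − t) cancels and sinh(y − t) stays. -/
lemma exp_identity_sub {x y t K : ℂ} :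
    exp K * (exp (-x) * sinh (2 * (y - t)) - exp x * sinh (2 * y))
      + exp (-K) * exp (-x) * sinh (2 * t)
      - (exp (-K) * (exp x * sinh (2 * (y - t)) - exp (-x) * sinh (2 * y))
      + exp K * exp x * sinh (2 * t))
    = -(2 * cosh (y - t)) * (2 * sinh (y + K) * sinh (x + t)
        + 2 * sinh (y - K) * sinh (x - t)) := by
  simp only [sinh, cosh, two_mul, neg_add, sub_eq_add_neg, exp_add, neg_neg, exp_neg]
  have := exp_ne_zero x
  have := exp_ne_zero y
  have := exp_ne_zero t
  have := exp_ne_zero K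
  field_simp
  ring

/-- Together with `normSq_cosh_sub` this matches the Plancherel weights cosh(2ck) ∓ cos 2θ with the
denominators of the two parity parts. -/
lemma normSq_sinh_sub (y θ : ℝ) :
    ‖sinh (y - θ * I)‖ ^ 2 = (Real.cosh (2 * y) - Real.cos (2 * θ)) / 2 := by
  have h := sinhSq_eq 1 θ y
  have hc : (starRingEnd ℂ) (sinh (y - θ * I)) = sinh (y + θ * I) := by
    rw [← sinh_conj]; simp [conj_ofReal]
  rw [ofReal_one, one_mul, ← hc, conj_mul'] at h
  have h' : ‖sinh (y - θ * I)‖ ^ 2 = sinhSq 1 θ y := by exact_mod_cast h.symm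
  rw [h', sinhSq, one_mul, Real.cosh_two_mul, Real.cos_two_mul, Real.cosh_sq, Real.sin_sq]
  ring

lemma normSq_cosh_sub (y θ : ℝ) :
    ‖cosh (y - θ * I)‖ ^ 2 = (Real.cosh (2 * y) + Real.cos (2 * θ)) / 2 := by
  have h := normSq_cos_add_mul_I θ y
  have e : cos (θ + y * I) = cosh (y - θ * I) := by
    rw [← cosh_mul_I, ← cosh_neg]
    congr 1
    linear_combination -(y : ℂ) * I_sq
  rw [e, normSq_eq_norm_sq] at h
  rw [h, Real.cosh_two_mul, Real.cos_two_mul, Real.cosh_sq]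
  ring

lemma sinh_sub_ne_zero {θ : ℝ} (hθ : Real.sin θ ≠ 0) (y : ℝ) : sinh ((y : ℂ) - θ * I) ≠ 0 := by
  simpa using sinh_sub_mul_I_ne_zero hθ 1 y

lemma cosh_sub_ne_zero {θ : ℝ} (hθ : Real.cos θ ≠ 0) (y : ℝ) : cosh ((y : ℂ) - θ * I) ≠ 0 := by
  intro h
  have := normSq_cosh_sub y θ
  rw [h, norm_zero, Real.cosh_two_mul, Real.cos_two_mul, Real.cosh_sq] at this
  have : 0 < Real.cos θ ^ 2 := by positivity
  nlinarith [sq_nonneg (Real.sinh y)]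

lemma sinh_two_sub_ne_zero {θ : ℝ} (hs : Real.sin θ ≠ 0) (hc : Real.cos θ ≠ 0) (y : ℝ) :
    sinh (2 * ((y : ℂ) - θ * I)) ≠ 0 := by
  rw [sinh_two_mul]
  exact mul_ne_zero (mul_ne_zero two_ne_zero (sinh_sub_ne_zero hs y)) (cosh_sub_ne_zero hc y)

lemma waveKernel_add_neg {θ : ℝ} (hs : Real.sin θ ≠ 0) (hc : Real.cos θ ≠ 0) (a c r k : ℝ) :
    cosh (c * k - θ * I) * (waveKernel a c θ r k + waveKernel a c θ (-r) k)
      = -(rootWeight a θ r * parityKernel a c θ 1 r k) := by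
  have h1 := sinh_sub_ne_zero hs (c * k)
  have h2 := cosh_sub_ne_zero hc (c * k)
  push_cast at h1 h2
  have key := @exp_identity_add (a * r) (c * k) (θ * I) (I * r * k)
  rw [show (c * k + I * r * k : ℂ) = k * (c + r * I) by ring,
    show (c * k - I * r * k : ℂ) = k * (c - r * I) by ring] at key
  simp only [waveKernel, parityKernel, rootWeight_neg]
  rw [← mul_add]
  push_cast
  simp only [mul_neg, neg_mul, neg_neg]
  rw [key, sinh_two_mul (c * k - θ * I)]
  field_simp

lemma waveKernel_sub_neg {θ : ℝ} (hs : Real.sin θ ≠ 0) (hc : Real.cos θ ≠ 0) (a c r k : ℝ) :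
    sinh (c * k - θ * I) * (waveKernel a c θ r k - waveKernel a c θ (-r) k)
      = -(rootWeight a θ r * parityKernel a c θ (-1) r k) := by
  have h1 := sinh_sub_ne_zero hs (c * k)
  have h2 := cosh_sub_ne_zero hc (c * k)
  push_cast at h1 h2
  have key := @exp_identity_sub (a * r) (c * k) (θ * I) (I * r * k)
  rw [show (c * k + I * r * k : ℂ) = k * (c + r * I) by ring,
    show (c * k - I * r * k : ℂ) = k * (c - r * I) by ring] at key
  simp only [waveKernel, parityKernel, rootWeight_neg]
  rw [← mul_sub]
  push_cast
  simp only [mul_neg, neg_mul, neg_neg, one_mul, sub_neg_eq_add]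
  rw [key, sinh_two_mul (c * k - θ * I)]
  field_simp

lemma continuous_waveKernel {θ : ℝ} (hs : Real.sin θ ≠ 0) (hc : Real.cos θ ≠ 0) (a c : ℝ) :
    Continuous fun p : ℝ × ℝ => waveKernel a c θ p.1 p.2 := by
  have h := continuous_rootWeight hs a
  unfold waveKernel
  refine Continuous.mul (Continuous.div (by fun_prop) (by fun_prop) fun p => ?_) (by fun_prop)
  have := sinh_two_sub_ne_zero hs hc (c * p.2)
  push_cast at this
  exact this

/-- The odd extension of a function supported on the positive half-line. -/
def oddExt (q : ℝ → ℂ) (k : ℝ) : ℂ := q k - q (-k)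

lemma IsTest.oddExt {q : ℝ → ℂ} (hq : IsTest q) : IsTest (oddExt q) := hq.sub hq.comp_neg

lemma oddExt_neg (q : ℝ → ℂ) (k : ℝ) : oddExt q (-k) = ((-1 : ℝ) : ℂ) * oddExt q k := by
  simp [IsometryBreakdown.oddExt]

lemma laplace_oddExt {q : ℝ → ℂ} (hq : IsTest q) (s : ℂ) :
    laplace (oddExt q) s = ∫ k : ℝ, q k * (2 * sinh (k * s)) := by
  have h := laplace_sub hq hq.comp_neg s
  rw [laplace_comp_neg] at h
  refine Eq.trans h ?_
  rw [laplace, laplace,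
    ← integral_sub (hq.integrable_mul (by fun_prop)) (hq.integrable_mul (by fun_prop))]
  congr 1; ext k
  rw [sinh, mul_neg]
  ring

/-- Removes the residue at s = 0, so that only the terms with j ≥ 1 survive. -/
lemma laplace_oddExt_zero {q : ℝ → ℂ} (hq : IsTest q) : laplace (oddExt q) 0 = 0 := by
  rw [laplace_oddExt hq]; simp

lemma amplitude_oddExt {q : ℝ → ℂ} (hq : IsTest q) (a c θ δ r : ℝ) :
    amplitude a c θ δ (oddExt q) r = ∫ k : ℝ, q k * parityKernel a c θ δ r k := by
  rw [amplitude, laplace_oddExt hq, laplace_oddExt hq, ← integral_mul_const, ← integral_mul_const,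
    ← integral_const_mul, ← integral_add]
  · congr 1; ext k
    rw [parityKernel, show (k : ℂ) * ((-c : ℝ) + r * I) = -(k * (c - r * I)) by push_cast; ring,
      sinh_neg]
    ring
  · exact (hq.integrable_mul (by fun_prop)).mul_const _
  · exact ((hq.integrable_mul (by fun_prop)).mul_const _).const_mul _

lemma integral_normSq_oddExt {q : ℝ → ℂ} (hq : IsTest q) (h0 : ∀ k ≤ 0, q k = 0) {W : ℝ → ℝ}
    (hW : Continuous W) (heven : ∀ k, W (-k) = W k) :
    ∫ k, ‖oddExt q k‖ ^ 2 * W k = 2 * ∫ k, ‖q k‖ ^ 2 * W k := by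
  have hi : ∀ {p : ℝ → ℂ}, IsTest p → Integrable fun k => ‖p k‖ ^ 2 * W k := fun {p} hp => by
    have := hp.continuous
    refine Continuous.integrable_of_hasCompactSupport (by fun_prop) (HasCompactSupport.mul_right ?_)
    exact hp.2.comp_left (g := fun z : ℂ => ‖z‖ ^ 2) (by simp)
  have h1 : ∫ k, ‖q (-k)‖ ^ 2 * W k = ∫ k, ‖q k‖ ^ 2 * W k := by
    rw [← integral_neg_eq_self]
    simp [heven]
  have h2 : ∀ k, ‖oddExt q k‖ ^ 2 * W k = ‖q k‖ ^ 2 * W k + ‖q (-k)‖ ^ 2 * W k := by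
    intro k
    rw [oddExt]
    rcases le_total k 0 with hk | hk
    · simp [h0 k hk]
    · simp [h0 (-k) (by linarith)]
  simp only [h2]
  rw [integral_add (hi hq) (hi hq.comp_neg), h1, two_mul]

/-- Smooth `ℂ²`-valued functions with compact support in `(0,∞)`. -/
def IsTestVec (f : ℝ → EuclideanSpace ℂ (Fin 2)) : Prop :=
  ContDiff ℝ ∞ f ∧ HasCompactSupport f ∧ tsupport f ⊆ Ioi 0

lemma IsTestVec.apply {f : ℝ → EuclideanSpace ℂ (Fin 2)} (hf : IsTestVec f) (i : Fin 2) :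
    IsTest fun k => f k i :=
  ⟨((EuclideanSpace.proj i : EuclideanSpace ℂ (Fin 2) →L[ℂ] ℂ).restrictScalars ℝ).contDiff.comp hf.1,
    hf.2.1.comp_left (g := fun v : EuclideanSpace ℂ (Fin 2) => v i) rfl⟩

lemma IsTestVec.eq_zero {f : ℝ → EuclideanSpace ℂ (Fin 2)} (hf : IsTestVec f) {k : ℝ}
    (hk : k ≤ 0) : f k = 0 :=
  image_eq_zero_of_notMem_tsupport fun h => absurd (hf.2.2 h) (not_lt.2 hk)

lemma setIntegral_Ioi_eq_integral {E : Type*} [NormedAddCommGroup E] [NormedSpace ℝ E]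
    {g : ℝ → E} (h0 : ∀ k ≤ 0, g k = 0) : ∫ k in Ioi (0 : ℝ), g k = ∫ k, g k :=
  setIntegral_eq_integral_of_forall_compl_eq_zero fun k hk => h0 k (not_lt.1 hk)

/-- Squared norms of sums of even and odd functions. -/
lemma integral_normSq_add_of_even_odd {A B : ℝ → ℂ} {D : ℝ → ℝ} (hA : Continuous A)
    (hB : Continuous B) (hD : Continuous D) (hD0 : ∀ r, 0 < D r) (hDe : ∀ r, D (-r) = D r)
    (hAe : ∀ r, A (-r) = A r) (hBo : ∀ r, B (-r) = -B r)
    (hiA : Integrable fun r => ‖A r‖ ^ 2 / D r) (hiB : Integrable fun r => ‖B r‖ ^ 2 / D r) :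
    Integrable (fun r => ‖A r + B r‖ ^ 2 / D r) ∧
    ∫ r, ‖A r + B r‖ ^ 2 / D r = (∫ r, ‖A r‖ ^ 2 / D r) + ∫ r, ‖B r‖ ^ 2 / D r := by
  have hpar : ∀ r, ‖A r + B r‖ ^ 2 + ‖A r - B r‖ ^ 2 = 2 * (‖A r‖ ^ 2 + ‖B r‖ ^ 2) := fun r => by
    have := parallelogram_law_with_norm ℂ (A r) (B r)
    nlinarith
  have hi : Integrable fun r => ‖A r + B r‖ ^ 2 / D r := by
    refine ((hiA.add hiB).const_mul 2).mono' ?_ (Eventually.of_forall fun r => ?_)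
    · exact (Continuous.div (by fun_prop) hD fun r => (hD0 r).ne').aestronglyMeasurable
    · rw [Real.norm_of_nonneg (div_nonneg (sq_nonneg _) (hD0 r).le), Pi.add_apply, ← add_div,
        ← mul_div_assoc, ← hpar]
      gcongr
      · exact (hD0 r).le
      · nlinarith [sq_nonneg ‖A r - B r‖]
  refine ⟨hi, ?_⟩
  -- Reflection turns A + B into A − B; averaging and the parallelogram law remove the cross term.
  have h1 := integral_neg_eq_self (fun r => ‖A r + B r‖ ^ 2 / D r) volume
  have h2 : (∫ r, ‖A r + B r‖ ^ 2 / D r) + ∫ r, ‖A (-r) + B (-r)‖ ^ 2 / D (-r)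
      = 2 * ((∫ r, ‖A r‖ ^ 2 / D r) + ∫ r, ‖B r‖ ^ 2 / D r) := by
    rw [← integral_add hi hi.comp_neg, ← integral_add hiA hiB, ← integral_const_mul]
    congr 1; ext r
    rw [hAe, hBo, hDe, ← sub_eq_add_neg, ← add_div, hpar, ← add_div, mul_div_assoc]
  linarith

/-! ### The norm of the transform of a test function -/

/-- The part of `f` entering the even component of the transform, divided by the denominator. -/
def evenPart (c θ : ℝ) (f : ℝ → EuclideanSpace ℂ (Fin 2)) (k : ℝ) : ℂ :=
  (f k 0 - f k 1) * (2 * cosh (c * k - θ * I))⁻¹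

/-- The part of `f` entering the odd component of the transform, divided by the denominator. -/
def oddPart (c θ : ℝ) (f : ℝ → EuclideanSpace ℂ (Fin 2)) (k : ℝ) : ℂ :=
  (f k 0 + f k 1) * (2 * sinh (c * k - θ * I))⁻¹

section
variable {f : ℝ → EuclideanSpace ℂ (Fin 2)} {a c θ : ℝ}

lemma contDiff_ofReal_mul_sub (c : ℝ) (z : ℂ) : ContDiff ℝ ∞ fun k : ℝ => (c : ℂ) * k - z :=
  (contDiff_const.mul ofRealCLM.contDiff).sub contDiff_const

lemma isTest_evenPart (hc : Real.cos θ ≠ 0) (c : ℝ) (hf : IsTestVec f) :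
    IsTest (evenPart c θ f) := by
  refine ((hf.apply 0).sub (hf.apply 1)).mul_smooth (ContDiff.inv ?_ fun k => ?_)
  · exact contDiff_const.mul ((Complex.contDiff_cosh.restrict_scalars ℝ).comp (contDiff_ofReal_mul_sub c _))
  · have := cosh_sub_ne_zero hc (c * k)
    push_cast at this
    exact mul_ne_zero two_ne_zero this

lemma isTest_oddPart (hs : Real.sin θ ≠ 0) (c : ℝ) (hf : IsTestVec f) :
    IsTest (oddPart c θ f) := by
  refine ((hf.apply 0).add (hf.apply 1)).mul_smooth (ContDiff.inv ?_ fun k => ?_)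
  · exact contDiff_const.mul ((Complex.contDiff_sinh.restrict_scalars ℝ).comp (contDiff_ofReal_mul_sub c _))
  · have := sinh_sub_ne_zero hs (c * k)
    push_cast at this
    exact mul_ne_zero two_ne_zero this

lemma evenPart_eq_zero (hf : IsTestVec f) {k : ℝ} (hk : k ≤ 0) : evenPart c θ f k = 0 := by
  simp [evenPart, hf.eq_zero hk]

lemma oddPart_eq_zero (hf : IsTestVec f) {k : ℝ} (hk : k ≤ 0) : oddPart c θ f k = 0 := by
  simp [oddPart, hf.eq_zero hk]

lemma continuous_parityKernel (a c θ δ r : ℝ) : Continuous (parityKernel a c θ δ r) := by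
  unfold parityKernel; fun_prop

/-- Ψ(r)f₀ − Ψ(−r)f₁ = ½(Ψ(r) + Ψ(−r))(f₀ − f₁) + ½(Ψ(r) − Ψ(−r))(f₀ + f₁), and each half is a
parity kernel over its denominator. -/
lemma transformIntegral_waveKernel (hs : Real.sin θ ≠ 0) (hc : Real.cos θ ≠ 0) (a c : ℝ)
    (hf : IsTestVec f) (r : ℝ) :
    transformIntegral (waveKernel a c θ) f r = -(((1 / Real.sqrt (2 * Real.pi) : ℝ) : ℂ) *
      rootWeight a θ r) * (amplitude a c θ 1 (oddExt (evenPart c θ f)) r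
        + amplitude a c θ (-1) (oddExt (oddPart c θ f)) r) := by
  have he := isTest_evenPart hc c hf
  have ho := isTest_oddPart hs c hf
  rw [transformIntegral, setIntegral_Ioi_eq_integral (fun k hk => by simp [hf.eq_zero hk]),
    amplitude_oddExt he, amplitude_oddExt ho,
    ← integral_add (he.integrable_mul (continuous_parityKernel ..))
      (ho.integrable_mul (continuous_parityKernel ..)),
    show ∀ x y z : ℂ, -(x * y) * z = x * (-y * z) from fun x y z => by ring]
  congr 1
  rw [← integral_const_mul]
  congr 1; ext k
  have h1 := sinh_sub_ne_zero hs (c * k)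
  have h2 := cosh_sub_ne_zero hc (c * k)
  push_cast at h1 h2
  have k1 := waveKernel_add_neg hs hc a c r k
  have k2 := waveKernel_sub_neg hs hc a c r k
  rw [evenPart, oddPart]
  field_simp
  linear_combination sinh (c * k - θ * I) * (f k 0 - f k 1) * k1
    + cosh (c * k - θ * I) * (f k 0 + f k 1) * k2

/-- The weights are 2|cosh(ck − iθ)|² and 2|sinh(ck − iθ)|². They cancel the denominators, and the
parallelogram law for f₀, f₁ remains. -/
lemma integral_evenPart_add_oddPart (hs : Real.sin θ ≠ 0) (hc : Real.cos θ ≠ 0) (c : ℝ)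
    (hf : IsTestVec f) :
    (∫ k, ‖oddExt (evenPart c θ f) k‖ ^ 2 * (Real.cosh (2 * c * k) + 1 * Real.cos (2 * θ)))
      + (∫ k, ‖oddExt (oddPart c θ f) k‖ ^ 2 * (Real.cosh (2 * c * k) + (-1) * Real.cos (2 * θ)))
      = 2 * ∫ k in Ioi (0 : ℝ), ‖f k‖ ^ 2 := by
  have he := isTest_evenPart hc c hf
  have ho := isTest_oddPart hs c hf
  rw [integral_normSq_oddExt he (fun k hk => evenPart_eq_zero hf hk) (by fun_prop) (by simp),
    integral_normSq_oddExt ho (fun k hk => oddPart_eq_zero hf hk) (by fun_prop) (by simp),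
    setIntegral_Ioi_eq_integral (fun k hk => by simp [hf.eq_zero hk]), ← mul_add]
  have hi : ∀ {p : ℝ → ℂ} (W : ℝ → ℝ), IsTest p → Continuous W →
      Integrable fun k => ‖p k‖ ^ 2 * W k := fun {p} W hp hW => by
    have := hp.continuous
    refine Continuous.integrable_of_hasCompactSupport (by fun_prop) (HasCompactSupport.mul_right ?_)
    exact hp.2.comp_left (g := fun z : ℂ => ‖z‖ ^ 2) (by simp)
  rw [← integral_add (hi _ he (by fun_prop)) (hi _ ho (by fun_prop))]
  congr 2; ext k
  have n1 := normSq_sinh_sub (c * k) θ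
  have n2 := normSq_cosh_sub (c * k) θ
  have h1 := norm_ne_zero_iff.2 (sinh_sub_ne_zero hs (c * k))
  have h2 := norm_ne_zero_iff.2 (cosh_sub_ne_zero hc (c * k))
  rw [show 2 * c * k = 2 * (c * k) by ring, one_mul, neg_one_mul, ← sub_eq_add_neg]
  rw [← mul_right_inj' (two_ne_zero (α := ℝ)), mul_div_cancel₀ _ two_ne_zero] at n1 n2
  rw [← n1, ← n2, evenPart, oddPart, norm_mul, norm_mul, norm_inv, norm_inv, norm_mul, norm_mul,
    Complex.norm_two]
  push_cast at h1 h2 ⊢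
  have hpar := parallelogram_law_with_norm ℂ (f k 0) (f k 1)
  rw [EuclideanSpace.norm_sq_eq, Fin.sum_univ_two]
  field_simp
  nlinarith

/-- The squared norm of the transform of a test function. -/
lemma integral_normSq_transformIntegral (hf : IsTestVec f) {n : ℕ} (ha : 0 < a)
    (h₁ : n * Real.pi < a * c) (h₂ : a * c < (n + 1) * Real.pi) (hc : Real.cos (a * c) ≠ 0) :
    Continuous (transformIntegral (waveKernel a c (a * c)) f) ∧
    Integrable (fun r => ‖transformIntegral (waveKernel a c (a * c)) f r‖ ^ 2) ∧
    ∫ r, ‖transformIntegral (waveKernel a c (a * c)) f r‖ ^ 2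
      = (∫ k in Ioi (0 : ℝ), ‖f k‖ ^ 2) + Real.sin (2 * (a * c)) / (2 * a) *
        ∑ j ∈ Finset.Icc 1 n,
          (‖laplace (oddExt (evenPart c (a * c) f)) ((j * (Real.pi / a) : ℝ) : ℂ)‖ ^ 2
            - ‖laplace (oddExt (oddPart c (a * c) f)) ((j * (Real.pi / a) : ℝ) : ℂ)‖ ^ 2) := by
  have hs := sin_ne_zero_of_mem h₁ h₂
  have he := isTest_evenPart hc c hf
  have ho := isTest_oddPart hs c hf
  have heq := transformIntegral_waveKernel hs hc a c hf
  have cA := continuous_amplitude a c (a * c) 1 he.oddExt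
  have cB := continuous_amplitude a c (a * c) (-1) ho.oddExt
  have one2 : (1 : ℝ) ^ 2 = 1 := one_pow 2
  have neg2 : (-1 : ℝ) ^ 2 = 1 := by norm_num
  have iA := (integral_normSq_amplitude he.oddExt (oddExt_neg _) neg2 one2 hs a c).1
  have iB := (integral_normSq_amplitude ho.oddExt (oddExt_neg _) neg2 neg2 hs a c).1
  have vA := integral_normSq_amplitude_sinh he.oddExt (oddExt_neg _) neg2 one2 ha h₁ h₂
  have vB := integral_normSq_amplitude_sinh ho.oddExt (oddExt_neg _) neg2 neg2 ha h₁ h₂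
  -- Both inputs are odd extensions (ε = −1), so δ = 1 gives the even and δ = −1 the odd component.
  have hsum := integral_normSq_add_of_even_odd cA cB (continuous_sinhSq a (a * c))
    (sinhSq_pos hs a) (sinhSq_neg a (a * c))
    (fun r => by simpa using amplitude_neg (oddExt_neg (evenPart c (a * c) f)) one2 a c (a * c) r)
    (fun r => by simpa using amplitude_neg (oddExt_neg (oddPart c (a * c) f)) neg2 a c (a * c) r)
    iA iB
  -- The constant is 1/(2π) from the transform times 1/4 from w₀.
  have hsq : ∀ r, ‖transformIntegral (waveKernel a c (a * c)) f r‖ ^ 2 = (8 * Real.pi)⁻¹ *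
      (‖amplitude a c (a * c) 1 (oddExt (evenPart c (a * c) f)) r
        + amplitude a c (a * c) (-1) (oddExt (oddPart c (a * c) f)) r‖ ^ 2
          / sinhSq a (a * c) r) := fun r => by
    rw [heq, norm_mul, mul_pow, norm_neg, norm_mul, mul_pow, norm_real, norm_real,
      Real.norm_eq_abs, Real.norm_eq_abs, sq_abs, sq_abs, rootWeight_sq, div_pow,
      Real.sq_sqrt (by positivity)]
    have := (sinhSq_pos hs a r).ne'
    field_simp
    norm_num
    ring
  refine ⟨?_, ?_, ?_⟩
  · have := continuous_rootWeight hs a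
    rw [show transformIntegral (waveKernel a c (a * c)) f = _ from funext heq]
    fun_prop
  · simp only [hsq]
    exact hsum.1.const_mul _
  · simp only [hsq]
    rw [integral_const_mul, hsum.2, vA, vB, laplace_oddExt_zero he, laplace_oddExt_zero ho,
      Finset.sum_sub_distrib]
    have hmain := integral_evenPart_add_oddPart hs hc c hf
    generalize ∫ k, ‖oddExt (evenPart c (a * c) f) k‖ ^ 2 * (Real.cosh (2 * c * k)
      + 1 * Real.cos (2 * (a * c))) = X at *
    generalize ∫ k, ‖oddExt (oddPart c (a * c) f) k‖ ^ 2 * (Real.cosh (2 * c * k)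
      + (-1) * Real.cos (2 * (a * c))) = Y at *
    rw [norm_zero, show ∫ k in Ioi (0 : ℝ), ‖f k‖ ^ 2 = (X + Y) / 2 by rw [hmain]; ring]
    have ha' := ha.ne'
    field_simp
    ring
end

/-! ### Identity plus rank one operators -/

section abstract
variable {H K : Type*} [NormedAddCommGroup H] [InnerProductSpace ℂ H]
  [NormedAddCommGroup K] [InnerProductSpace ℂ K] {ι : Type*}

/-- Both sides of the hypothesis are continuous in x, so it extends from the dense set; over ℂ the
quadratic form determines the operator. -/
lemma adjoint_comp_self_eq [CompleteSpace H] [CompleteSpace K] (F : H →L[ℂ] K) (s : Finset ι) (v : ι → H) (c : ι → ℝ) {S : Set H}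
    (hS : Dense S)
    (h : ∀ x ∈ S, ‖F x‖ ^ 2 = ‖x‖ ^ 2 + ∑ i ∈ s, c i * ‖inner ℂ (v i) x‖ ^ 2) :
    F.adjoint ∘L F = ContinuousLinearMap.id ℂ H
      + ∑ i ∈ s, (c i : ℂ) • InnerProductSpace.rankOne ℂ (v i) (v i) := by
  have h' : ∀ x, ‖F x‖ ^ 2 = ‖x‖ ^ 2 + ∑ i ∈ s, c i * ‖inner ℂ (v i) x‖ ^ 2 := by
    have hcl : IsClosed {x | ‖F x‖ ^ 2 = ‖x‖ ^ 2 + ∑ i ∈ s, c i * ‖inner ℂ (v i) x‖ ^ 2} :=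
      isClosed_eq (by fun_prop) (by fun_prop)
    intro x
    exact (hcl.closure_subset_iff.2 h) (hS x)
  apply ContinuousLinearMap.coe_injective
  rw [← ext_inner_map]
  intro x
  have hx := h' x
  simp only [ContinuousLinearMap.coe_coe, ContinuousLinearMap.comp_apply,
    add_apply, ContinuousLinearMap.id_apply, sum_apply,
    smul_apply, InnerProductSpace.rankOne_apply, inner_add_left, sum_inner,
    ContinuousLinearMap.adjoint_inner_left, inner_smul_left, conj_ofReal]
  rw [inner_self_eq_norm_sq_to_K, inner_self_eq_norm_sq_to_K]
  have hx' := congrArg (fun t : ℝ => (t : ℂ)) hx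
  push_cast at hx'
  refine hx'.trans ?_
  congr 1
  refine Finset.sum_congr rfl fun i _ => ?_
  rw [conj_mul']

/-- A combination of rank one projections onto independent vectors with nonzero coefficients has
full rank. -/
lemma finrank_range_sum_rankOne (s : Finset ι) (v : ι → H) (c : ι → ℂ)
    (hc : ∀ i ∈ s, c i ≠ 0) (hv : LinearIndependent ℂ fun i : s => v i) :
    Module.finrank ℂ (LinearMap.range
      (∑ i ∈ s, c i • InnerProductSpace.rankOne ℂ (v i) (v i) : H →L[ℂ] H).toLinearMap)
      = s.card := by
  set T : H →L[ℂ] H := ∑ i ∈ s, c i • InnerProductSpace.rankOne ℂ (v i) (v i) with hT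
  have hTx : ∀ x, T x = ∑ i : s, (c i * inner ℂ (v i) x) • v i := fun x => by
    rw [hT, sum_apply, ← Finset.sum_coe_sort s]
    simp [smul_smul]
  set V := Submodule.span ℂ (Set.range fun i : s => v i) with hV
  have hVdim : Module.finrank ℂ V = s.card := by
    rw [hV, finrank_span_eq_card hv, Fintype.card_coe]
  have hle : LinearMap.range T.toLinearMap ≤ V := by
    rintro _ ⟨x, rfl⟩
    rw [ContinuousLinearMap.coe_coe, hTx]
    exact Submodule.sum_mem _ fun i _ => Submodule.smul_mem _ _ (Submodule.subset_span ⟨i, rfl⟩)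
  have hfin : FiniteDimensional ℂ V := FiniteDimensional.span_of_finite ℂ (Set.finite_range _)
  have hfin' : FiniteDimensional ℂ (LinearMap.range T.toLinearMap) :=
    Submodule.finiteDimensional_of_le hle
  refine le_antisymm (hVdim ▸ Submodule.finrank_mono hle) ?_
  rw [← hVdim]
  -- It suffices that T is injective on the span V. If T x = 0, independence forces every inner
  -- product of x with the v i to vanish, so x lies in V and in its orthogonal complement. The signs
  -- of the coefficients play no role.
  let T' : V →ₗ[ℂ] LinearMap.range T.toLinearMap :=
    (T.toLinearMap.rangeRestrict).comp V.subtype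
  refine LinearMap.finrank_le_finrank_of_injective (f := T') ?_
  rw [injective_iff_map_eq_zero]
  rintro ⟨x, hx⟩ h0
  have h1 : T x = 0 := congrArg Subtype.val h0
  rw [hTx] at h1
  have h2 := Fintype.linearIndependent_iff.1 hv _ h1
  have h3 : ∀ i : s, inner ℂ (v i) x = 0 := fun i =>
    (mul_eq_zero.1 (h2 i)).resolve_left (hc i i.2)
  have h4 : ∀ y ∈ V, inner ℂ y x = 0 := fun y hy => by
    induction hy using Submodule.span_induction with
    | mem y hy => obtain ⟨i, rfl⟩ := hy; exact h3 i
    | zero => simp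
    | add a b _ _ ha hb => rw [inner_add_left, ha, hb, add_zero]
    | smul a b _ hb => rw [inner_smul_left, hb, mul_zero]
  have h5 := h4 x hx
  rw [inner_self_eq_zero] at h5
  exact Subtype.ext h5

end abstract

/-! ### Test functions in momentum space and bounded extension -/

/-- The measure on the half-line. -/
abbrev halfLine : Measure ℝ := (volume : Measure ℝ).restrict (Ioi 0)

lemma IsTestVec.memLp {f : ℝ → EuclideanSpace ℂ (Fin 2)} (hf : IsTestVec f) :
    MemLp f 2 halfLine :=
  (hf.1.continuous.memLp_of_hasCompactSupport hf.2.1).restrict _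

/-- The space of test functions. -/
def testSpace : Submodule ℂ (ℝ → EuclideanSpace ℂ (Fin 2)) where
  carrier := {f | IsTestVec f}
  zero_mem' := ⟨contDiff_const, HasCompactSupport.zero, by
    rw [show tsupport (0 : ℝ → EuclideanSpace ℂ (Fin 2)) = ∅ by simp [tsupport]]
    exact empty_subset _⟩
  add_mem' := fun hf hg => ⟨hf.1.add hg.1, hf.2.1.add hg.2.1,
    (tsupport_add _ _).trans (union_subset hf.2.2 hg.2.2)⟩
  smul_mem' := fun c _ hf => ⟨hf.1.const_smul c, hf.2.1.smul_left (f := fun _ => c),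
    (closure_mono (Function.support_const_smul_subset c _)).trans hf.2.2⟩

/-- The class of a test function in momentum space. -/
def testToMom : testSpace →ₗ[ℂ] MomSpace where
  toFun f := f.2.memLp.toLp f.1
  map_add' _ _ := MemLp.toLp_add _ _
  map_smul' c _ := MemLp.toLp_const_smul c _

lemma coeFn_testToMom (f : testSpace) : testToMom f =ᵐ[halfLine] f.1 := f.2.memLp.coeFn_toLp

/-- The square of the norm of the class of a function in `L²`. -/
lemma norm_sq_of_ae_eq {α E : Type*} [MeasurableSpace α] {μ : Measure α} [NormedAddCommGroup E]
    [InnerProductSpace ℂ E] (φ : Lp E 2 μ) {f : α → E} (h : φ =ᵐ[μ] f) :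
    ‖φ‖ ^ 2 = ∫ x, ‖f x‖ ^ 2 ∂μ := by
  have h1 := L2.inner_def (𝕜 := ℂ) φ φ
  rw [inner_self_eq_norm_sq_to_K] at h1
  have h2 : (∫ x, inner ℂ (φ x) (φ x) ∂μ) = ((∫ x, ‖f x‖ ^ 2 ∂μ : ℝ) : ℂ) := by
    rw [← integral_complex_ofReal]
    refine integral_congr_ae ?_
    filter_upwards [h] with x hx
    rw [hx, inner_self_eq_norm_sq_to_K]
    push_cast; rfl
  rw [h2] at h1
  refine ofReal_injective (Eq.trans ?_ h1)
  push_cast; rfl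

/-- A vector orthogonal to all test functions has components that are locally integrable on (0,∞)
and annihilate every smooth compactly supported function there; hence it vanishes. -/
lemma denseRange_testToMom : DenseRange testToMom := by
  have h : (LinearMap.range testToMom).topologicalClosure = ⊤ := by
    rw [Submodule.topologicalClosure_eq_top_iff, Submodule.eq_bot_iff]
    intro φ hφ
    have hz : ∀ i : Fin 2, ∀ᵐ k, k ∈ Ioi (0 : ℝ) → φ k i = 0 := by
      intro i
      refine isOpen_Ioi.ae_eq_zero_of_integral_contDiff_smul_eq_zero ?_ fun g hg hgc hgs => ?_
      · have h1 : LocallyIntegrable (φ : ℝ → EuclideanSpace ℂ (Fin 2)) halfLine :=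
          (Lp.memLp φ).locallyIntegrable (by norm_num)
        have h2 : LocallyIntegrableOn (φ : ℝ → EuclideanSpace ℂ (Fin 2)) (Ioi 0) volume :=
          locallyIntegrableOn_of_locallyIntegrable_restrict h1
        intro x hx
        obtain ⟨s, hs, hi⟩ := h2 x hx
        exact ⟨s, hs, (EuclideanSpace.proj i : EuclideanSpace ℂ (Fin 2) →L[ℂ] ℂ).integrable_comp hi⟩
      · have hf : IsTestVec fun k => (g k : ℂ) • EuclideanSpace.single i (1 : ℂ) := by
          have hsupp : Function.support (fun k => (g k : ℂ) • EuclideanSpace.single i (1 : ℂ))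
              ⊆ Function.support g := fun k hk hgk => hk (by simp [hgk])
          refine ⟨?_, hgc.mono hsupp, (closure_mono hsupp).trans hgs⟩
          exact (ofRealCLM.contDiff.comp hg).smul contDiff_const
        have h1 := (Submodule.mem_orthogonal _ _).1 hφ (testToMom ⟨_, hf⟩) ⟨_, rfl⟩
        rw [L2.inner_def] at h1
        rw [← setIntegral_Ioi_eq_integral (fun k hk => by
          rw [image_eq_zero_of_notMem_tsupport fun h => absurd (hgs h) (not_lt.2 hk), zero_smul]),
          ← h1]
        refine integral_congr_ae ?_
        filter_upwards [coeFn_testToMom ⟨_, hf⟩] with k hk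
        rw [hk]
        rw [inner_smul_left, EuclideanSpace.inner_single_left, conj_ofReal, map_one, one_mul,
          real_smul]
    rw [Lp.eq_zero_iff_ae_eq_zero]
    have := (ae_restrict_iff' measurableSet_Ioi).2 ((hz 0).and (hz 1) |>.mono
      fun k hk hk' => And.intro (hk.1 hk') (hk.2 hk'))
    filter_upwards [this] with k hk
    ext i
    fin_cases i
    · exact hk.1
    · exact hk.2
  have := (Submodule.dense_iff_topologicalClosure_eq_top).2 h
  rwa [LinearMap.coe_range] at this

lemma isTransform_iff {Psi : ℝ → ℝ → ℂ} {F : MomSpace →L[ℂ] PosSpace} :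
    IsTransform Psi F ↔ ∀ f : testSpace, F (testToMom f) =ᵐ[volume] transformIntegral Psi f.1 := by
  constructor
  · intro h f
    exact h f.1 f.2.1 f.2.2.1 f.2.2.2 _ (coeFn_testToMom f)
  · intro h f h1 h2 h3 φ hφ
    have : φ = testToMom ⟨f, h1, h2, h3⟩ := Lp.ext (hφ.trans (coeFn_testToMom ⟨f, h1, h2, h3⟩).symm)
    rw [this]
    exact h _

lemma IsTransform.unique {Psi : ℝ → ℝ → ℂ} {F G : MomSpace →L[ℂ] PosSpace}
    (hF : IsTransform Psi F) (hG : IsTransform Psi G) : F = G := by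
  rw [isTransform_iff] at hF hG
  refine ContinuousLinearMap.coeFn_injective (denseRange_testToMom.equalizer F.continuous
    G.continuous (funext fun f => ?_))
  exact Lp.ext ((hF f).trans (hG f).symm)

lemma IsTransform.norm_sq {Psi : ℝ → ℝ → ℂ} {F : MomSpace →L[ℂ] PosSpace}
    (hF : IsTransform Psi F) (f : testSpace) :
    ‖F (testToMom f)‖ ^ 2 = ∫ r, ‖transformIntegral Psi f.1 r‖ ^ 2 :=
  norm_sq_of_ae_eq _ (isTransform_iff.1 hF f)

lemma norm_sq_testToMom (f : testSpace) :
    ‖testToMom f‖ ^ 2 = ∫ k in Ioi (0 : ℝ), ‖f.1 k‖ ^ 2 :=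
  norm_sq_of_ae_eq _ (coeFn_testToMom f)

lemma integrable_transformIntegrand {Psi : ℝ → ℝ → ℂ} (hPsi : ∀ r, Continuous (Psi r))
    {f : ℝ → EuclideanSpace ℂ (Fin 2)} (hf : IsTestVec f) (r : ℝ) :
    Integrable (fun k => Psi r k * f k 0 + (-Psi (-r) k) * f k 1) halfLine := by
  have h0 := ((hf.apply 0).integrable_mul (hPsi r)).integrableOn (s := Ioi 0)
  have h1 := ((hf.apply 1).integrable_mul (hPsi (-r)).neg).integrableOn (s := Ioi 0)
  refine (h0.add h1).congr (Eventually.of_forall fun k => ?_)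
  simp [mul_comm]

/-- A transform that is bounded on test functions extends to a bounded operator. -/
lemma exists_isTransform {Psi : ℝ → ℝ → ℂ} (hPsi : ∀ r, Continuous (Psi r)) {C : ℝ}
    (hmem : ∀ f : testSpace, MemLp (transformIntegral Psi f.1) 2 volume)
    (hC : ∀ f : testSpace, ∫ r, ‖transformIntegral Psi f.1 r‖ ^ 2
      ≤ C ^ 2 * ∫ k in Ioi (0 : ℝ), ‖f.1 k‖ ^ 2) :
    ∃! F : MomSpace →L[ℂ] PosSpace, IsTransform Psi F := by
  let T : testSpace →ₗ[ℂ] PosSpace :=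
    { toFun := fun f => (hmem f).toLp _
      map_add' := fun f g => by
        rw [← MemLp.toLp_add]
        congr 1
        ext r
        rw [Pi.add_apply, transformIntegral, transformIntegral, transformIntegral, ← mul_add,
          ← integral_add (integrable_transformIntegrand hPsi f.2 r)
            (integrable_transformIntegrand hPsi g.2 r)]
        congr 2; ext k
        simp
        ring
      map_smul' := fun c f => by
        rw [RingHom.id_apply, ← MemLp.toLp_const_smul]
        congr 1
        ext r
        rw [Pi.smul_apply, transformIntegral, transformIntegral, smul_eq_mul, mul_left_comm]
        congr 1
        rw [← integral_const_mul]
        congr 1; ext k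
        simp
        ring }
  have hT : ∀ f, ‖T f‖ ≤ |C| * ‖testToMom f‖ := fun f => by
    refine le_of_sq_le_sq ?_ (by positivity)
    rw [mul_pow, sq_abs, norm_sq_testToMom, norm_sq_of_ae_eq (T f) (hmem f).coeFn_toLp]
    exact hC f
  refine ⟨T.extendOfNorm testToMom, ?_, fun G hG => ?_⟩
  · refine isTransform_iff.2 fun f => ?_
    rw [LinearMap.extendOfNorm_eq denseRange_testToMom ⟨_, hT⟩]
    exact (hmem f).coeFn_toLp
  · refine IsTransform.unique hG (isTransform_iff.2 fun f => ?_)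
    rw [LinearMap.extendOfNorm_eq denseRange_testToMom ⟨_, hT⟩]
    exact (hmem f).coeFn_toLp

/-- Since e^y ≥ 1 + y + y²/2 for y ≥ 0, the squared bound is at most a multiple of 1/(1 + x²); the
maximum in the constant serves the coefficients of 1 and x² at once. -/
lemma memLp_two_of_norm_le_exp {E : Type*} [NormedAddCommGroup E] {f : ℝ → E} {b C : ℝ}
    (hf : Continuous f) (hb : 0 < b) (h : ∀ x, ‖f x‖ ≤ C * Real.exp (-(b * |x|))) :
    MemLp f 2 (volume : Measure ℝ) := by
  rw [memLp_two_iff_integrable_sq_norm hf.aestronglyMeasurable]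
  refine (integrable_inv_one_add_sq.const_mul (C ^ 2 * max 1 (1 / (2 * b ^ 2)))).mono'
    (by fun_prop) (Eventually.of_forall fun x => ?_)
  rw [Real.norm_of_nonneg (sq_nonneg _)]
  have h1 : ‖f x‖ ^ 2 ≤ C ^ 2 * Real.exp (-(2 * (b * |x|))) := by
    calc ‖f x‖ ^ 2 ≤ (C * Real.exp (-(b * |x|))) ^ 2 := by
          gcongr; exact h x
      _ = _ := by rw [mul_pow, ← Real.exp_nat_mul]; congr 2; push_cast; ring
  refine h1.trans ?_
  rw [mul_assoc]
  gcongr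
  rw [Real.exp_neg, ← div_eq_mul_inv, inv_eq_one_div, div_le_div_iff₀ (Real.exp_pos _) (by positivity),
    one_mul]
  have h2 := Real.quadratic_le_exp_of_nonneg (show 0 ≤ 2 * (b * |x|) by positivity)
  have h3 : (2 * (b * |x|)) ^ 2 / 2 = 2 * b ^ 2 * x ^ 2 := by
    rw [mul_pow, mul_pow, sq_abs]; ring
  have m1 : 1 ≤ max 1 (1 / (2 * b ^ 2)) := le_max_left _ _
  have m2 : 1 ≤ max 1 (1 / (2 * b ^ 2)) * (2 * b ^ 2) := by
    rw [← div_le_iff₀ (by positivity)]; exact le_max_right _ _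
  calc 1 + x ^ 2 ≤ max 1 (1 / (2 * b ^ 2)) * 1 + max 1 (1 / (2 * b ^ 2)) * (2 * b ^ 2) * x ^ 2 := by
        nlinarith [sq_nonneg x]
    _ = max 1 (1 / (2 * b ^ 2)) * (1 + 2 * b ^ 2 * x ^ 2) := by ring
    _ ≤ _ := by
        gcongr
        have : 0 ≤ 2 * (b * |x|) := by positivity
        linarith

/-! ### Wave function and χ vectors in terms of ρ and κ -/

section
variable {ρ κ : ℝ}

lemma angle_eq (hρ : 0 < ρ) (hκ : 0 < κ) :
    Real.pi ^ 2 / (2 * (ρ * κ)) = Real.pi / ρ * (Real.pi / (2 * κ)) := by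
  field_simp

lemma chiArg_eq (hρ : 0 < ρ) (hκ : 0 < κ) (k : ℝ) :
    chiArg ρ κ k = (Real.pi / (2 * κ) : ℝ) * k
      + (Real.pi / ρ * (Real.pi / (2 * κ)) : ℝ) * I := by
  have h1 : (ρ : ℂ) ≠ 0 := by exact_mod_cast hρ.ne'
  have h2 : (κ : ℂ) ≠ 0 := by exact_mod_cast hκ.ne'
  rw [chiArg]; push_cast; field_simp

lemma weight_eq (hρ : 0 < ρ) (hκ : 0 < κ) (r : ℝ) :
    weight ρ κ r = (4 * sinhSq (Real.pi / ρ) (Real.pi / ρ * (Real.pi / (2 * κ))) r)⁻¹ := by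
  have h1 : (ρ : ℂ) ≠ 0 := by exact_mod_cast hρ.ne'
  have h2 : (κ : ℂ) ≠ 0 := by exact_mod_cast hκ.ne'
  have h := sinhSq_eq (Real.pi / ρ) (Real.pi / ρ * (Real.pi / (2 * κ))) r
  have e1 : (Real.pi : ℂ) / ρ * (r + I * Real.pi / (2 * κ))
      = (Real.pi / ρ : ℝ) * r + (Real.pi / ρ * (Real.pi / (2 * κ)) : ℝ) * I := by
    push_cast; field_simp
  have e2 : (Real.pi : ℂ) / ρ * (r - I * Real.pi / (2 * κ))
      = (Real.pi / ρ : ℝ) * r - (Real.pi / ρ * (Real.pi / (2 * κ)) : ℝ) * I := by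
    push_cast; field_simp
  rw [weight, e1, e2, mul_assoc, ← h, one_div]
  rw [show (4 * (sinhSq (Real.pi / ρ) (Real.pi / ρ * (Real.pi / (2 * κ))) r : ℂ))⁻¹
    = ((4 * sinhSq (Real.pi / ρ) (Real.pi / ρ * (Real.pi / (2 * κ))) r)⁻¹ : ℝ) by push_cast; rfl]
  exact ofReal_re _

lemma sqrt_weight_eq (hρ : 0 < ρ) (hκ : 0 < κ) (r : ℝ) :
    Real.sqrt (weight ρ κ r)
      = rootWeight (Real.pi / ρ) (Real.pi / ρ * (Real.pi / (2 * κ))) r := by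
  rw [weight_eq hρ hκ, rootWeight, Real.sqrt_inv, Real.sqrt_mul (by norm_num),
    show (4 : ℝ) = 2 ^ 2 by norm_num, Real.sqrt_sq (by norm_num)]

lemma weightRoot_eq (hρ : 0 < ρ) (hκ : 0 < κ)
    (hs : Real.sin (Real.pi / ρ * (Real.pi / (2 * κ))) ≠ 0) (r : ℝ) :
    weightRoot ρ κ r = rootWeight (Real.pi / ρ) (Real.pi / ρ * (Real.pi / (2 * κ))) r := by
  rw [weightRoot, angle_eq hρ hκ, if_neg fun h => hs h.1, sqrt_weight_eq hρ hκ]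

lemma waveFunction_arg (hρ : 0 < ρ) (hκ : 0 < κ) (k : ℝ) :
    (Real.pi : ℂ) / κ * (k - I * Real.pi / ρ) = 2 * ((Real.pi / (2 * κ) : ℝ) * k
      - (Real.pi / ρ * (Real.pi / (2 * κ)) : ℝ) * I) := by
  have h1 : (ρ : ℂ) ≠ 0 := by exact_mod_cast hρ.ne'
  have h2 : (κ : ℂ) ≠ 0 := by exact_mod_cast hκ.ne'
  push_cast; field_simp

lemma waveFunction_eq (hρ : 0 < ρ) (hκ : 0 < κ)
    (hs : Real.sin (Real.pi / ρ * (Real.pi / (2 * κ))) ≠ 0) :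
    waveFunction ρ κ = waveKernel (Real.pi / ρ) (Real.pi / (2 * κ))
      (Real.pi / ρ * (Real.pi / (2 * κ))) := by
  have h1 : (ρ : ℂ) ≠ 0 := by exact_mod_cast hρ.ne'
  have h2 : (κ : ℂ) ≠ 0 := by exact_mod_cast hκ.ne'
  ext r k
  rw [waveFunction, waveKernel, weightRoot_eq hρ hκ hs, waveFunction_arg hρ hκ,
    show (Real.pi : ℂ) / κ * k = 2 * ((Real.pi / (2 * κ) : ℝ) * k) by push_cast; field_simp,
    show I * (Real.pi : ℂ) ^ 2 / (ρ * κ) = 2 * ((Real.pi / ρ * (Real.pi / (2 * κ)) : ℝ) * I) by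
      push_cast; field_simp,
    show (Real.pi : ℂ) * r / ρ = (Real.pi / ρ : ℝ) * r by push_cast; field_simp]

lemma exp_abs_le_two_cosh (y : ℝ) : Real.exp |y| ≤ 2 * Real.cosh y := by
  rw [Real.cosh_eq]
  have h1 := Real.exp_pos y
  have h2 := Real.exp_pos (-y)
  rcases abs_cases y with h | h <;> rw [h.1] <;> linarith

lemma abs_sinh_le_exp_abs (y : ℝ) : |Real.sinh y| ≤ Real.exp |y| := by
  rw [Real.abs_sinh, Real.sinh_eq]
  have h1 := Real.exp_pos (|y|)
  have h2 := Real.exp_pos (-|y|)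
  linarith

lemma cosh_le_exp_abs (y : ℝ) : Real.cosh y ≤ Real.exp |y| := by
  rw [← Real.cosh_abs, Real.cosh_eq]
  have h1 : Real.exp (-|y|) ≤ Real.exp |y| := Real.exp_le_exp.2 (by linarith [abs_nonneg y])
  linarith

lemma norm_sq_conj_arg (y θ : ℝ) :
    ‖sinh (y + θ * I)‖ = ‖sinh (y - θ * I)‖ ∧ ‖cosh (y + θ * I)‖ = ‖cosh (y - θ * I)‖ := by
  constructor
  · rw [← Complex.norm_conj, ← sinh_conj]; simp [conj_ofReal, sub_eq_add_neg]
  · rw [← Complex.norm_conj, ← cosh_conj]; simp [conj_ofReal, sub_eq_add_neg]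

lemma cos_mul_cosh_le_norm_cosh (y θ : ℝ) :
    |Real.cos θ| * Real.cosh y ≤ ‖cosh (y + θ * I)‖ := by
  rw [(norm_sq_conj_arg y θ).2]
  refine le_of_sq_le_sq ?_ (norm_nonneg _)
  rw [normSq_cosh_sub, mul_pow, sq_abs, Real.cosh_two_mul, Real.cos_two_mul, Real.cosh_sq]
  nlinarith [Real.cos_sq_le_one θ, sq_nonneg (Real.sinh y)]

lemma sin_mul_cosh_le_norm_sinh (y θ : ℝ) :
    |Real.sin θ| * Real.cosh y ≤ ‖sinh (y + θ * I)‖ := by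
  rw [(norm_sq_conj_arg y θ).1]
  refine le_of_sq_le_sq ?_ (norm_nonneg _)
  rw [normSq_sinh_sub, mul_pow, sq_abs, Real.cosh_two_mul, Real.cos_two_mul, Real.cosh_sq,
    ← Real.sin_sq_add_cos_sq θ]
  nlinarith [Real.sin_sq_le_one θ, sq_nonneg (Real.sinh y), Real.sin_sq_add_cos_sq θ]

lemma sin_mul_cosh_le_sqrt_sinhSq (a θ r : ℝ) :
    |Real.sin θ| * Real.cosh (a * r) ≤ Real.sqrt (sinhSq a θ r) := by
  refine Real.le_sqrt_of_sq_le ?_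
  rw [mul_pow, sq_abs, Real.cosh_sq, sinhSq]
  nlinarith [Real.sin_sq_le_one θ, sq_nonneg (Real.sinh (a * r))]

/-- The numerator grows at rate j and the denominator at least at rate b, so j < b means exponential
decay. It is used with rates jρ and π/(2κ). -/
lemma norm_sinh_div_le {j b η : ℝ} {k : ℝ} {z : ℂ} (hη : 0 < η) (hj : 0 ≤ j) (hb : 0 ≤ b)
    (h : η * Real.cosh (b * k) ≤ ‖z‖) :
    ‖(Real.sinh (j * k) : ℂ) / z‖ ≤ 2 / η * Real.exp (-((b - j) * |k|)) := by
  have h1 := exp_abs_le_two_cosh (b * k)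
  have h2 := abs_sinh_le_exp_abs (j * k)
  rw [abs_mul, abs_of_nonneg hb] at h1
  rw [abs_mul, abs_of_nonneg hj] at h2
  have hpos : 0 < ‖z‖ := lt_of_lt_of_le (mul_pos hη (Real.cosh_pos _)) h
  rw [norm_div, norm_real, Real.norm_eq_abs, div_le_iff₀ hpos]
  calc |Real.sinh (j * k)| ≤ Real.exp (j * |k|) := h2
    _ = Real.exp (-((b - j) * |k|)) * Real.exp (b * |k|) := by rw [← Real.exp_add]; congr 1; ring
    _ ≤ Real.exp (-((b - j) * |k|)) * (2 * (‖z‖ / η)) := by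
        gcongr
        refine h1.trans ?_
        gcongr
        rw [le_div_iff₀ hη]; linarith
    _ = _ := by ring

lemma norm_pair (x y : ℂ) (hx : ‖x‖ = 1) (hy : ‖y‖ = 1) : ‖!₂[x, y]‖ = Real.sqrt 2 := by
  rw [EuclideanSpace.norm_eq]
  simp [Fin.sum_univ_two, hx, hy]
  norm_num

lemma cosh_chiArg_ne_zero (hρ : 0 < ρ) (hκ : 0 < κ)
    (hc : Real.cos (Real.pi / ρ * (Real.pi / (2 * κ))) ≠ 0) (k : ℝ) :
    cosh (chiArg ρ κ k) ≠ 0 := by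
  rw [chiArg_eq hρ hκ, ← ofReal_mul, ← norm_pos_iff, (norm_sq_conj_arg _ _).2, norm_pos_iff]
  exact cosh_sub_ne_zero hc _

lemma sinh_chiArg_ne_zero (hρ : 0 < ρ) (hκ : 0 < κ)
    (hs : Real.sin (Real.pi / ρ * (Real.pi / (2 * κ))) ≠ 0) (k : ℝ) :
    sinh (chiArg ρ κ k) ≠ 0 := by
  rw [chiArg_eq hρ hκ, ← ofReal_mul, ← norm_pos_iff, (norm_sq_conj_arg _ _).1, norm_pos_iff]
  exact sinh_sub_ne_zero hs _

lemma continuous_chiArg (ρ κ : ℝ) : Continuous (chiArg ρ κ) := by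
  unfold chiArg; fun_prop

lemma continuous_chiEven (hρ : 0 < ρ) (hκ : 0 < κ)
    (hc : Real.cos (Real.pi / ρ * (Real.pi / (2 * κ))) ≠ 0) (j : ℕ) :
    Continuous (chiEven ρ κ j) := by
  have := continuous_chiArg ρ κ
  exact (Continuous.div (by fun_prop) (by fun_prop) (cosh_chiArg_ne_zero hρ hκ hc)).smul
    continuous_const

lemma continuous_chiOdd (hρ : 0 < ρ) (hκ : 0 < κ)
    (hs : Real.sin (Real.pi / ρ * (Real.pi / (2 * κ))) ≠ 0) (j : ℕ) :
    Continuous (chiOdd ρ κ j) := by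
  have := continuous_chiArg ρ κ
  exact (Continuous.div (by fun_prop) (by fun_prop) (sinh_chiArg_ne_zero hρ hκ hs)).smul
    continuous_const

lemma memLp_chiEven (hρ : 0 < ρ) (hκ : 0 < κ)
    (hc : Real.cos (Real.pi / ρ * (Real.pi / (2 * κ))) ≠ 0) {j : ℕ}
    (hj : j * ρ < Real.pi / (2 * κ)) : MemLp (chiEven ρ κ j) 2 halfLine := by
  suffices hb : ∀ k, ‖chiEven ρ κ j k‖ ≤ 2 / |Real.cos (Real.pi / ρ * (Real.pi / (2 * κ)))|
      * Real.sqrt 2 * Real.exp (-((Real.pi / (2 * κ) - j * ρ) * |k|)) from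
    (memLp_two_of_norm_le_exp (continuous_chiEven hρ hκ hc j) (sub_pos.2 hj) hb).restrict _
  intro k
  rw [chiEven, norm_smul, norm_pair _ _ (by simp) (by simp)]
  have h : |Real.cos (Real.pi / ρ * (Real.pi / (2 * κ)))| * Real.cosh (Real.pi / (2 * κ) * k)
      ≤ ‖cosh (chiArg ρ κ k)‖ := by
    rw [chiArg_eq hρ hκ, ← ofReal_mul]
    exact cos_mul_cosh_le_norm_cosh _ _
  exact (mul_le_mul_of_nonneg_right (norm_sinh_div_le (j := j * ρ) (abs_pos.2 hc) (by positivity)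
    (by positivity) h) (Real.sqrt_nonneg _)).trans_eq (mul_right_comm _ _ _)

lemma memLp_chiOdd (hρ : 0 < ρ) (hκ : 0 < κ)
    (hs : Real.sin (Real.pi / ρ * (Real.pi / (2 * κ))) ≠ 0) {j : ℕ}
    (hj : j * ρ < Real.pi / (2 * κ)) : MemLp (chiOdd ρ κ j) 2 halfLine := by
  suffices hb : ∀ k, ‖chiOdd ρ κ j k‖ ≤ 2 / |Real.sin (Real.pi / ρ * (Real.pi / (2 * κ)))|
      * Real.sqrt 2 * Real.exp (-((Real.pi / (2 * κ) - j * ρ) * |k|)) from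
    (memLp_two_of_norm_le_exp (continuous_chiOdd hρ hκ hs j) (sub_pos.2 hj) hb).restrict _
  intro k
  rw [chiOdd, norm_smul, norm_pair _ _ (by simp) (by simp)]
  have h : |Real.sin (Real.pi / ρ * (Real.pi / (2 * κ)))| * Real.cosh (Real.pi / (2 * κ) * k)
      ≤ ‖sinh (chiArg ρ κ k)‖ := by
    rw [chiArg_eq hρ hκ, ← ofReal_mul]
    exact sin_mul_cosh_le_norm_sinh _ _
  exact (mul_le_mul_of_nonneg_right (norm_sinh_div_le (j := j * ρ) (abs_pos.2 hs) (by positivity)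
    (by positivity) h) (Real.sqrt_nonneg _)).trans_eq (mul_right_comm _ _ _)

lemma conj_chiArg (hρ : 0 < ρ) (hκ : 0 < κ) (k : ℝ) :
    (starRingEnd ℂ) (chiArg ρ κ k) = (Real.pi / (2 * κ) : ℝ) * k
      - (Real.pi / ρ * (Real.pi / (2 * κ)) : ℝ) * I := by
  rw [chiArg_eq hρ hκ, map_add, map_mul, map_mul, conj_ofReal, conj_ofReal, conj_ofReal, conj_I]
  ring

lemma inner_pair (z x y : ℂ) (v : EuclideanSpace ℂ (Fin 2)) :
    inner ℂ (z • !₂[x, y]) v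
      = (starRingEnd ℂ) z * ((starRingEnd ℂ) x * v 0 + (starRingEnd ℂ) y * v 1) := by
  rw [inner_smul_left, PiLp.inner_apply, Fin.sum_univ_two]
  simp [mul_comm]

/-- Conjugating χ turns cosh(ck + iθ) into the denominator cosh(ck − iθ) of `evenPart`. The factor 2
sinh(jρk) is the Laplace kernel of an odd extension at s = jρ, so the residues are inner products
with χ. -/
lemma inner_chiEven (hρ : 0 < ρ) (hκ : 0 < κ)
    (hc : Real.cos (Real.pi / ρ * (Real.pi / (2 * κ))) ≠ 0) (j : ℕ) (f : testSpace)
    {χ : MomSpace} (hχ : χ =ᵐ[halfLine] chiEven ρ κ j) :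
    inner ℂ χ (testToMom f) = laplace (oddExt (evenPart (Real.pi / (2 * κ))
      (Real.pi / ρ * (Real.pi / (2 * κ))) f.1)) ((j * (Real.pi / (Real.pi / ρ)) : ℝ) : ℂ) := by
  rw [laplace_oddExt (isTest_evenPart hc _ f.2), L2.inner_def,
    ← setIntegral_Ioi_eq_integral (fun k hk => by rw [evenPart_eq_zero f.2 hk, zero_mul])]
  refine integral_congr_ae ?_
  filter_upwards [hχ, coeFn_testToMom f] with k h1 h2
  have hne := cosh_chiArg_ne_zero hρ hκ hc k
  rw [h1, h2, chiEven, inner_pair, map_div₀, conj_ofReal, ← cosh_conj, conj_chiArg hρ hκ, evenPart,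
    div_div_cancel₀ Real.pi_ne_zero, show (k : ℂ) * ((j * ρ : ℝ) : ℂ) = ((j * ρ * k : ℝ) : ℂ) by
      push_cast; ring, ← ofReal_sinh, map_one, map_neg, map_one]
  field_simp
  ring

lemma inner_chiOdd (hρ : 0 < ρ) (hκ : 0 < κ)
    (hs : Real.sin (Real.pi / ρ * (Real.pi / (2 * κ))) ≠ 0) (j : ℕ) (f : testSpace)
    {χ : MomSpace} (hχ : χ =ᵐ[halfLine] chiOdd ρ κ j) :
    inner ℂ χ (testToMom f) = laplace (oddExt (oddPart (Real.pi / (2 * κ))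
      (Real.pi / ρ * (Real.pi / (2 * κ))) f.1)) ((j * (Real.pi / (Real.pi / ρ)) : ℝ) : ℂ) := by
  rw [laplace_oddExt (isTest_oddPart hs _ f.2), L2.inner_def,
    ← setIntegral_Ioi_eq_integral (fun k hk => by rw [oddPart_eq_zero f.2 hk, zero_mul])]
  refine integral_congr_ae ?_
  filter_upwards [hχ, coeFn_testToMom f] with k h1 h2
  rw [h1, h2, chiOdd, inner_pair, map_div₀, conj_ofReal, ← sinh_conj, conj_chiArg hρ hκ, oddPart,
    div_div_cancel₀ Real.pi_ne_zero, show (k : ℂ) * ((j * ρ : ℝ) : ℂ) = ((j * ρ * k : ℝ) : ℂ) by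
      push_cast; ring, ← ofReal_sinh, map_one, mul_inv]
  ring

/-- The norm identity for the transform on test functions. -/
lemma integral_normSq_wave (hρ : 0 < ρ) (hκ : 0 < κ) {n : ℕ}
    (h₁ : n * Real.pi < Real.pi / ρ * (Real.pi / (2 * κ)))
    (h₂ : Real.pi / ρ * (Real.pi / (2 * κ)) < (n + 1) * Real.pi)
    (hc : Real.cos (Real.pi / ρ * (Real.pi / (2 * κ))) ≠ 0) {χe χo : ℕ → MomSpace}
    (hχ : ∀ j ∈ Finset.Icc 1 n, χe j =ᵐ[halfLine] chiEven ρ κ j ∧ χo j =ᵐ[halfLine] chiOdd ρ κ j)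
    (f : testSpace) :
    MemLp (transformIntegral (waveFunction ρ κ) f.1) 2 volume ∧
    ∫ r, ‖transformIntegral (waveFunction ρ κ) f.1 r‖ ^ 2 = ‖testToMom f‖ ^ 2
      + ρ * Real.sin (Real.pi ^ 2 / (ρ * κ)) / (2 * Real.pi) * ∑ j ∈ Finset.Icc 1 n,
        (‖inner ℂ (χe j) (testToMom f)‖ ^ 2 - ‖inner ℂ (χo j) (testToMom f)‖ ^ 2) := by
  have hs := sin_ne_zero_of_mem h₁ h₂
  obtain ⟨h3, h4, h5⟩ := integral_normSq_transformIntegral f.2 (by positivity) h₁ h₂ hc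
  rw [waveFunction_eq hρ hκ hs]
  refine ⟨(memLp_two_iff_integrable_sq_norm h3.aestronglyMeasurable).2 h4, ?_⟩
  rw [h5, norm_sq_testToMom]
  congr 2
  · rw [show 2 * (Real.pi / ρ * (Real.pi / (2 * κ))) = Real.pi ^ 2 / (ρ * κ) by field_simp]
    field_simp
  · refine Finset.sum_congr rfl fun j hj => ?_
    rw [inner_chiEven hρ hκ hc j f (hχ j hj).1, inner_chiOdd hρ hκ hs j f (hχ j hj).2]

/-- nπ < θ means nρ < π/(2κ), so the χ's with j ≤ n decay exponentially. The value 0 for j > n is a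
placeholder. -/
lemma exists_chi (hρ : 0 < ρ) (hκ : 0 < κ) {n : ℕ}
    (h₁ : n * Real.pi < Real.pi / ρ * (Real.pi / (2 * κ)))
    (h₂ : Real.pi / ρ * (Real.pi / (2 * κ)) < (n + 1) * Real.pi)
    (hc : Real.cos (Real.pi / ρ * (Real.pi / (2 * κ))) ≠ 0) :
    ∃ χe χo : ℕ → MomSpace, ∀ j ∈ Finset.Icc 1 n,
      χe j =ᵐ[halfLine] chiEven ρ κ j ∧ χo j =ᵐ[halfLine] chiOdd ρ κ j := by
  have hs := sin_ne_zero_of_mem h₁ h₂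
  have hj : ∀ j : ℕ, j ≤ n → j * ρ < Real.pi / (2 * κ) := fun j hj => by
    have : (j : ℝ) ≤ n := by exact_mod_cast hj
    calc j * ρ ≤ n * ρ := by gcongr
      _ < _ := by
        rw [div_mul_eq_mul_div, lt_div_iff₀ hρ] at h₁
        have := Real.pi_pos
        nlinarith
  classical
  refine ⟨fun j => if h : j ≤ n then (memLp_chiEven hρ hκ hc (hj j h)).toLp _ else 0,
    fun j => if h : j ≤ n then (memLp_chiOdd hρ hκ hs (hj j h)).toLp _ else 0, fun j hjn => ?_⟩
  have h := (Finset.mem_Icc.1 hjn).2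
  simp only [h, dif_pos]
  exact ⟨MemLp.coeFn_toLp _, MemLp.coeFn_toLp _⟩

lemma exists_nat_mul_pi_lt {θ : ℝ} (h0 : 0 ≤ θ) (hs : Real.sin θ ≠ 0) :
    ∃ n : ℕ, n * Real.pi < θ ∧ θ < (n + 1) * Real.pi := by
  refine ⟨⌊θ / Real.pi⌋₊, lt_of_le_of_ne ?_ fun h => ?_, ?_⟩
  · rw [← le_div_iff₀ Real.pi_pos]; exact Nat.floor_le (by positivity)
  · rw [← h, Real.sin_nat_mul_pi] at hs; exact hs rfl
  · rw [← div_lt_iff₀ Real.pi_pos]; exact Nat.lt_floor_add_one _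

lemma continuous_waveFunction (hρ : 0 < ρ) (hκ : 0 < κ)
    (hs : Real.sin (Real.pi / ρ * (Real.pi / (2 * κ))) ≠ 0)
    (hc : Real.cos (Real.pi / ρ * (Real.pi / (2 * κ))) ≠ 0) :
    Continuous fun p : ℝ × ℝ => waveFunction ρ κ p.1 p.2 := by
  rw [waveFunction_eq hρ hκ hs]
  exact continuous_waveKernel hs hc _ _

/-- Cauchy–Schwarz applied to the finitely many inner products in the norm identity gives
boundedness on test functions. Here n is ⌊θ/π⌋ and may be 0. -/
lemma exists_unique_wave (hρ : 0 < ρ) (hκ : 0 < κ)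
    (hs : Real.sin (Real.pi / ρ * (Real.pi / (2 * κ))) ≠ 0)
    (hc : Real.cos (Real.pi / ρ * (Real.pi / (2 * κ))) ≠ 0) :
    ∃! F : MomSpace →L[ℂ] PosSpace, IsTransform (waveFunction ρ κ) F := by
  obtain ⟨n, h₁, h₂⟩ := exists_nat_mul_pi_lt (by positivity) hs
  obtain ⟨χe, χo, hχ⟩ := exists_chi hρ hκ h₁ h₂ hc
  have hid := integral_normSq_wave hρ hκ h₁ h₂ hc hχ
  set A := ρ * Real.sin (Real.pi ^ 2 / (ρ * κ)) / (2 * Real.pi)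
  set B := 1 + |A| * ∑ j ∈ Finset.Icc 1 n, (‖χe j‖ ^ 2 + ‖χo j‖ ^ 2) with hB
  have hB0 : 0 ≤ B := by positivity
  refine exists_isTransform (C := Real.sqrt B) ?_ (fun f => (hid f).1) fun f => ?_
  · intro r
    exact (continuous_waveFunction hρ hκ hs hc).comp (Continuous.prodMk_right r)
  · rw [(hid f).2, ← norm_sq_testToMom, Real.sq_sqrt hB0, hB, add_mul, one_mul]
    refine add_le_add le_rfl ((le_abs_self _).trans ?_)
    have hcs : ∀ v : MomSpace, ‖inner ℂ v (testToMom f)‖ ^ 2 ≤ ‖v‖ ^ 2 * ‖testToMom f‖ ^ 2 :=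
      fun v => by
        rw [← mul_pow]
        exact pow_le_pow_left₀ (norm_nonneg _) (norm_inner_le_norm _ _) 2
    rw [abs_mul, mul_assoc]
    refine mul_le_mul_of_nonneg_left ?_ (abs_nonneg _)
    refine (Finset.abs_sum_le_sum_abs _ _).trans ?_
    rw [Finset.sum_mul]
    refine Finset.sum_le_sum fun j _ => ?_
    have h1 := hcs (χe j)
    have h2 := hcs (χo j)
    rw [abs_le]
    constructor <;> nlinarith [sq_nonneg ‖inner ℂ (χe j) (testToMom f)‖,
      sq_nonneg ‖inner ℂ (χo j) (testToMom f)‖]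

end

/-! ### The Fourier transform -/

/-- The two components of a test function glued to a function on the line. -/
def glue (f : ℝ → EuclideanSpace ℂ (Fin 2)) (k : ℝ) : ℂ := f k 0 - f (-k) 1

lemma IsTestVec.glue {f : ℝ → EuclideanSpace ℂ (Fin 2)} (hf : IsTestVec f) : IsTest (glue f) :=
  (hf.apply 0).sub (hf.apply 1).comp_neg

lemma transformIntegral_planeWave {f : ℝ → EuclideanSpace ℂ (Fin 2)} (hf : IsTestVec f) (r : ℝ) :
    transformIntegral planeWave f r
      = ((1 / Real.sqrt (2 * Real.pi) : ℝ) : ℂ) * laplace (glue f) (r * I) := by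
  have h0 := hf.apply 0
  have h1 := hf.apply 1
  rw [transformIntegral, setIntegral_Ioi_eq_integral (fun k hk => by simp [hf.eq_zero hk])]
  have e : laplace (glue f) (r * I) = _ := laplace_sub h0 h1.comp_neg (r * I)
  rw [e, laplace_comp_neg fun k => f k 1, laplace, laplace,
    ← integral_sub (h0.integrable_mul (by fun_prop)) (h1.integrable_mul (by fun_prop))]
  congr 2; ext k
  rw [planeWave, planeWave, show (k : ℂ) * (r * I) = I * r * k by ring,
    show (k : ℂ) * -(r * I) = I * (-r : ℝ) * k by push_cast; ring]
  ring

/-- On the imaginary axis the transform of the conjugate of k ↦ u(−k) is the conjugate of the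
transform of u, so bilinear Plancherel becomes the usual one. -/
lemma integral_normSq_laplace {u : ℝ → ℂ} (hu : IsTest u) :
    Integrable (fun r : ℝ => ‖laplace u (r * I)‖ ^ 2) ∧
    ∫ r : ℝ, ‖laplace u (r * I)‖ ^ 2 = 2 * Real.pi * ∫ k, ‖u k‖ ^ 2 := by
  have hv := hu.comp_neg.conj
  have h1 := integrable_laplace_mul_laplace hu hv 0 0
  have h2 := integral_laplace_mul_laplace hu hv
  have e : ∀ r : ℝ, laplace u (r * I) * laplace (fun k => (starRingEnd ℂ) (u (-k))) (r * I)
      = ((‖laplace u (r * I)‖ ^ 2 : ℝ) : ℂ) := fun r => by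
    rw [laplace_conj (fun k => u (-k)), laplace_comp_neg, map_mul, conj_ofReal, conj_I, mul_neg,
      neg_neg, mul_conj', ofReal_pow]
  simp only [ofReal_zero, zero_add, e] at h1
  simp only [e, neg_neg, mul_conj'] at h2
  refine ⟨h1.re, ofReal_injective ?_⟩
  rw [← integral_complex_ofReal, h2]
  push_cast
  rw [← integral_complex_ofReal]
  push_cast; rfl

lemma IsTest.integrable_normSq {u : ℝ → ℂ} (hu : IsTest u) : Integrable fun k => ‖u k‖ ^ 2 := by
  have h1 := hu.continuous
  have h2 : HasCompactSupport fun k => ‖u k‖ ^ 2 :=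
    hu.2.comp_left (g := fun z : ℂ => ‖z‖ ^ 2) (by simp)
  have h3 : Continuous fun k => ‖u k‖ ^ 2 := by fun_prop
  exact h3.integrable_of_hasCompactSupport h2

/-- The two glued pieces live on opposite half-lines and do not interact. -/
lemma integral_normSq_glue {f : ℝ → EuclideanSpace ℂ (Fin 2)} (hf : IsTestVec f) :
    ∫ k, ‖glue f k‖ ^ 2 = ∫ k in Ioi (0 : ℝ), ‖f k‖ ^ 2 := by
  have hi : ∀ i, Integrable fun k => ‖f k i‖ ^ 2 := fun i => (hf.apply i).integrable_normSq
  have h : ∀ k, ‖glue f k‖ ^ 2 = ‖f k 0‖ ^ 2 + ‖f (-k) 1‖ ^ 2 := fun k => by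
    rw [glue]
    rcases le_total k 0 with hk | hk
    · simp [hf.eq_zero hk]
    · simp [hf.eq_zero (show -k ≤ 0 by linarith)]
  simp only [h]
  rw [integral_add (hi 0) (hi 1).comp_neg, integral_neg_eq_self (fun k => ‖f k 1‖ ^ 2),
    ← integral_add (hi 0) (hi 1),
    setIntegral_Ioi_eq_integral (fun k hk => by simp [hf.eq_zero hk])]
  congr 1; ext k
  rw [EuclideanSpace.norm_sq_eq, Fin.sum_univ_two]

/-- The Fourier transform extends to a bounded operator. -/
lemma exists_unique_planeWave : ∃! F : MomSpace →L[ℂ] PosSpace, IsTransform planeWave F := by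
  have hsq : ∀ (f : testSpace) (r : ℝ), ‖transformIntegral planeWave f.1 r‖ ^ 2
      = (2 * Real.pi)⁻¹ * ‖laplace (glue f.1) (r * I)‖ ^ 2 := fun f r => by
    rw [transformIntegral_planeWave f.2, norm_mul, mul_pow, norm_real, Real.norm_eq_abs, sq_abs,
      div_pow, Real.sq_sqrt (by positivity), one_pow, one_div]
  refine exists_isTransform (C := 1) (fun r => ?_) (fun f => ?_) (fun f => ?_)
  · unfold planeWave; fun_prop
  · rw [memLp_two_iff_integrable_sq_norm]
    · simp only [hsq]
      exact (integral_normSq_laplace f.2.glue).1.const_mul _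
    · rw [show transformIntegral planeWave f.1 = _ from
        funext (transformIntegral_planeWave f.2)]
      have := (laplace_differentiable f.2.glue).continuous
      exact Continuous.aestronglyMeasurable (by fun_prop)
  · simp only [hsq]
    rw [integral_const_mul, (integral_normSq_laplace f.2.glue).2, integral_normSq_glue f.2,
      ← mul_assoc, inv_mul_cancel₀ (by positivity), one_pow]

/-! ### The case sin 2θ = 0 -/

section
variable {ρ κ : ℝ}

lemma sinhSq_of_sin_eq_zero {a θ : ℝ} (h : Real.sin θ = 0) (r : ℝ) :
    sinhSq a θ r = Real.sinh (a * r) ^ 2 := by simp [sinhSq, h]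

lemma sinhSq_of_cos_eq_zero {a θ : ℝ} (h : Real.cos θ = 0) (r : ℝ) :
    sinhSq a θ r = Real.cosh (a * r) ^ 2 := by
  rw [sinhSq, Real.cosh_sq, Real.sin_sq, h]; ring

lemma weightRoot_of_sin_eq_zero (hρ : 0 < ρ) (hκ : 0 < κ)
    (h : Real.sin (Real.pi / ρ * (Real.pi / (2 * κ))) = 0) (r : ℝ) :
    weightRoot ρ κ r = (2 * Real.sinh (Real.pi / ρ * r))⁻¹ := by
  rw [weightRoot, angle_eq hρ hκ, sqrt_weight_eq hρ hκ, rootWeight, sinhSq_of_sin_eq_zero h,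
    Real.sqrt_sq_eq_abs]
  have hp : 0 < Real.pi / ρ := by positivity
  by_cases hr : r < 0
  · rw [if_pos ⟨h, hr⟩, abs_of_neg (Real.sinh_neg_iff.2 (mul_neg_of_pos_of_neg hp hr)), ← inv_neg]
    ring
  · rw [if_neg fun h => hr h.2,
      abs_of_nonneg (Real.sinh_nonneg_iff.2 (mul_nonneg hp.le (not_lt.1 hr)))]

lemma weightRoot_of_cos_eq_zero (hρ : 0 < ρ) (hκ : 0 < κ)
    (h : Real.cos (Real.pi / ρ * (Real.pi / (2 * κ))) = 0) (r : ℝ) :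
    weightRoot ρ κ r = (2 * Real.cosh (Real.pi / ρ * r))⁻¹ := by
  rw [weightRoot_eq hρ hκ, rootWeight, sinhSq_of_cos_eq_zero h, Real.sqrt_sq (Real.cosh_pos _).le]
  intro h0
  have := Real.sin_sq_add_cos_sq (Real.pi / ρ * (Real.pi / (2 * κ)))
  rw [h, h0] at this
  norm_num at this

/-- The reflectionless case with trivial transmission. -/
lemma waveFunction_eq_planeWave (hρ : 0 < ρ) (hκ : 0 < κ) {m : ℕ} (hm : 1 ≤ m)
    (h : Real.pi / ρ * (Real.pi / (2 * κ)) = m * Real.pi / 2) {r k : ℝ} (hr : r ≠ 0) (hk : k ≠ 0) :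
    waveFunction ρ κ r k = (-1) ^ (m - 1) * planeWave r k := by
  have h1 : (ρ : ℂ) ≠ 0 := by exact_mod_cast hρ.ne'
  have h2 : (κ : ℂ) ≠ 0 := by exact_mod_cast hκ.ne'
  have hpm : ((-1 : ℂ)) ^ m * (-1) ^ m = 1 := by rw [← mul_pow]; simp
  -- Since 2θ = mπ, shifting the argument by −2iθ only contributes (−1)^m, and by `e2` the
  -- coefficient of the reflected wave vanishes.
  have e1 : sinh ((Real.pi : ℂ) / κ * (k - I * Real.pi / ρ))
      = (-1) ^ m * sinh ((Real.pi : ℂ) / κ * k) := by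
    rw [waveFunction_arg hρ hκ, h, show (2 : ℂ) * ((Real.pi / (2 * κ) : ℝ) * k
      - (m * Real.pi / 2 : ℝ) * I) = (Real.pi : ℂ) / κ * k - (m * Real.pi : ℝ) * I by
        push_cast; field_simp, sinh_sub, sinh_mul_I, cosh_mul_I, ← ofReal_sin, ← ofReal_cos,
      Real.sin_nat_mul_pi, Real.cos_nat_mul_pi]
    push_cast; ring
  have e2 : sinh (I * (Real.pi : ℂ) ^ 2 / (ρ * κ)) = 0 := by
    rw [show I * (Real.pi : ℂ) ^ 2 / (ρ * κ)
      = (2 * (Real.pi / ρ * (Real.pi / (2 * κ))) : ℝ) * I by push_cast; field_simp, h,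
      sinh_mul_I, ← ofReal_sin, show 2 * (m * Real.pi / 2) = m * Real.pi by ring,
      Real.sin_nat_mul_pi]
    simp
  have e3 : sinh ((Real.pi : ℂ) / κ * k) ≠ 0 := by
    rw [show (Real.pi : ℂ) / κ * k = ((Real.pi / κ * k : ℝ) : ℂ) by push_cast; ring, ← ofReal_sinh]
    have : Real.pi / κ * k ≠ 0 := mul_ne_zero (div_ne_zero Real.pi_ne_zero hκ.ne') hk
    exact_mod_cast Real.sinh_ne_zero.2 this
  have e4 : waveFunction ρ κ r k = (weightRoot ρ κ r : ℂ) * planeWave r k *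
      (exp (-(Real.pi * r / ρ)) - (-1) ^ m * exp (Real.pi * r / ρ)) := by
    have h0 : ((-1 : ℂ)) ^ m ≠ 0 := pow_ne_zero _ (by norm_num)
    rw [waveFunction, e1, e2, planeWave, mul_zero, add_zero]
    rw [div_mul_eq_mul_div, div_eq_iff (mul_ne_zero h0 e3)]
    linear_combination (weightRoot ρ κ r : ℂ) * exp (I * r * k)
      * exp (Real.pi * r / ρ) * sinh ((Real.pi : ℂ) / κ * k) * hpm
  have hx : (Real.pi : ℂ) * r / ρ = ((Real.pi / ρ * r : ℝ) : ℂ) := by push_cast; ring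
  rw [e4, hx]
  obtain ⟨j, rfl⟩ : ∃ j, m = j + 1 := ⟨m - 1, by omega⟩
  rw [add_tsub_cancel_right]
  -- Here m = j + 1. For j even cos θ = 0 and w₀^{1/2} = 1/(2 cosh(πr/ρ)); for j odd sin θ = 0 and
  -- w₀^{1/2} is the signed root 1/(2 sinh(πr/ρ)). In both cases it cancels the bracket in `e4` up
  -- to sign.
  rcases Nat.even_or_odd j with hj | hj
  · have hc : Real.cos (Real.pi / ρ * (Real.pi / (2 * κ))) = 0 := by
      obtain ⟨l, rfl⟩ := hj
      rw [h, Real.cos_eq_zero_iff]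
      exact ⟨l, by push_cast; ring⟩
    rw [weightRoot_of_cos_eq_zero hρ hκ hc, pow_succ, hj.neg_one_pow]
    have hch := (Real.cosh_pos (Real.pi / ρ * r)).ne'
    rw [show exp (-((Real.pi / ρ * r : ℝ) : ℂ)) - 1 * -1 * exp ((Real.pi / ρ * r : ℝ) : ℂ)
      = ((2 * Real.cosh (Real.pi / ρ * r) : ℝ) : ℂ) by push_cast; rw [cosh]; ring,
      mul_right_comm, ← ofReal_mul, inv_mul_cancel₀ (by positivity), ofReal_one]
  · have hs : Real.sin (Real.pi / ρ * (Real.pi / (2 * κ))) = 0 := by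
      obtain ⟨l, rfl⟩ := hj
      rw [h, Real.sin_eq_zero_iff]
      exact ⟨l + 1, by push_cast; ring⟩
    rw [weightRoot_of_sin_eq_zero hρ hκ hs, pow_succ, hj.neg_one_pow]
    have hsh : Real.sinh (Real.pi / ρ * r) ≠ 0 :=
      Real.sinh_ne_zero.2 (mul_ne_zero (div_ne_zero Real.pi_ne_zero hρ.ne') hr)
    rw [show exp (-((Real.pi / ρ * r : ℝ) : ℂ)) - -1 * -1 * exp ((Real.pi / ρ * r : ℝ) : ℂ)
      = -((2 * Real.sinh (Real.pi / ρ * r) : ℝ) : ℂ) by push_cast; rw [sinh]; ring,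
      mul_right_comm, mul_neg, ← ofReal_mul, inv_mul_cancel₀ (by positivity), ofReal_one]

/-- The degenerate point r = 0 is a null set, and k = 0 lies outside the domain of integration. -/
lemma IsTransform.wave_of_planeWave (hρ : 0 < ρ) (hκ : 0 < κ) {m : ℕ} (hm : 1 ≤ m)
    (h : Real.pi / ρ * (Real.pi / (2 * κ)) = m * Real.pi / 2) {F : MomSpace →L[ℂ] PosSpace}
    (hF : IsTransform planeWave F) : IsTransform (waveFunction ρ κ) ((-1 : ℂ) ^ (m - 1) • F) := by
  rw [isTransform_iff] at hF ⊢
  intro f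
  rw [smul_apply]
  filter_upwards [Lp.coeFn_smul ((-1 : ℂ) ^ (m - 1)) (F (testToMom f)), hF f,
    compl_mem_ae_iff.2 (measure_singleton (0 : ℝ))] with r h1 h2 h3
  rw [h1, Pi.smul_apply, h2, transformIntegral, transformIntegral, smul_eq_mul, mul_left_comm,
    ← integral_const_mul]
  congr 1
  refine setIntegral_congr_fun measurableSet_Ioi fun k hk => ?_
  have hr : r ≠ 0 := h3
  have hk : k ≠ 0 := (mem_Ioi.1 hk).ne'
  simp only []
  rw [waveFunction_eq_planeWave hρ hκ hm h hr hk,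
    waveFunction_eq_planeWave hρ hκ hm h (neg_ne_zero.2 hr) hk]
  ring

end

/-! ### The adjoint transform and its norm -/

lemma dense_isTest : Dense {φ : PosSpace | ∃ g : ℝ → ℂ, φ =ᵐ[volume] g ∧ IsTest g} := by
  have h := Lp.dense_hasCompactSupport_contDiff (E := ℝ) (F := ℂ) (μ := volume) (p := 2) (by simp)
  refine h.mono ?_
  rintro φ ⟨g, h1, h2, h3⟩
  exact ⟨g, h1, h3, h2⟩

/-- The formal adjoint of the transform. -/
def adjointIntegral (Psi : ℝ → ℝ → ℂ) (φ : ℝ → ℂ) (k : ℝ) : EuclideanSpace ℂ (Fin 2) :=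
  ((1 / Real.sqrt (2 * Real.pi) : ℝ) : ℂ) • !₂[∫ r, (starRingEnd ℂ) (Psi r k) * φ r,
    -∫ r, (starRingEnd ℂ) (Psi (-r) k) * φ r]

lemma IsTest.integrable_mul_left {u g : ℝ → ℂ} (hu : IsTest u) (hg : Continuous g) :
    Integrable (fun k => g k * u k) := by
  simpa only [mul_comm] using hu.integrable_mul hg

/-- Fubini for an integrand that is continuous with compact support in (r, k). -/
lemma inner_transformIntegral {Psi : ℝ → ℝ → ℂ}
    (hPsi : Continuous fun p : ℝ × ℝ => Psi p.1 p.2) {φ : ℝ → ℂ} (hφ : IsTest φ)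
    {f : ℝ → EuclideanSpace ℂ (Fin 2)} (hf : IsTestVec f) :
    ∫ r, inner ℂ (transformIntegral Psi f r) (φ r)
      = ∫ k in Ioi (0 : ℝ), inner ℂ (f k) (adjointIntegral Psi φ k) := by
  have hφc := hφ.continuous
  have h0 := (hf.apply 0).continuous
  have h1 := (hf.apply 1).continuous
  have c1 : Continuous fun p : ℝ × ℝ => Psi (-p.1) p.2 :=
    hPsi.comp (g := fun p : ℝ × ℝ => Psi p.1 p.2) (f := fun p : ℝ × ℝ => (-p.1, p.2)) (by fun_prop)
  have hconj : Continuous (starRingEnd ℂ) := continuous_conj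
  set G : ℝ → ℝ → ℂ := fun r k =>
    (starRingEnd ℂ) (Psi r k * f k 0 + (-Psi (-r) k) * f k 1) * φ r with hG
  have hGc : Continuous G.uncurry := by
    have d0 : Continuous fun p : ℝ × ℝ => f p.2 0 := h0.comp continuous_snd
    have d1 : Continuous fun p : ℝ × ℝ => f p.2 1 := h1.comp continuous_snd
    have d2 : Continuous fun p : ℝ × ℝ => φ p.1 := hφc.comp continuous_fst
    exact (hconj.comp ((hPsi.mul d0).add (c1.neg.mul d1))).mul d2
  have hGs : HasCompactSupport G.uncurry := by
    refine HasCompactSupport.intro (hφ.2.prod hf.2.1) fun p hp => ?_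
    rw [Set.mem_prod, not_and_or] at hp
    rcases hp with hp | hp
    · simp [hG, Function.uncurry, image_eq_zero_of_notMem_tsupport hp]
    · simp [hG, Function.uncurry, image_eq_zero_of_notMem_tsupport hp]
  have hswap := integral_integral_swap_of_hasCompactSupport hGc hGs
    (μ := (volume : Measure ℝ)) (ν := (volume : Measure ℝ))
  rw [setIntegral_Ioi_eq_integral (fun k hk => by simp [hf.eq_zero hk])]
  have e1 : ∀ r, inner ℂ (transformIntegral Psi f r) (φ r)
      = ((1 / Real.sqrt (2 * Real.pi) : ℝ) : ℂ) * ∫ k, G r k := fun r => by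
    rw [transformIntegral, setIntegral_Ioi_eq_integral (fun k hk => by simp [hf.eq_zero hk]),
      RCLike.inner_apply, map_mul, conj_ofReal, ← integral_conj, integral_mul_const]
    ring
  have e2 : ∀ k, inner ℂ (f k) (adjointIntegral Psi φ k)
      = ((1 / Real.sqrt (2 * Real.pi) : ℝ) : ℂ) * ∫ r, G r k := fun k => by
    have i0 : Integrable fun r => (starRingEnd ℂ) (Psi r k) * φ r :=
      hφ.integrable_mul_left (hconj.comp (hPsi.comp (Continuous.prodMk_left k)))
    have i1 : Integrable fun r => (starRingEnd ℂ) (Psi (-r) k) * φ r :=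
      hφ.integrable_mul_left (hconj.comp (c1.comp (Continuous.prodMk_left k)))
    have e3 : (fun r => G r k) = fun r => (starRingEnd ℂ) (f k 0) *
        ((starRingEnd ℂ) (Psi r k) * φ r)
        - (starRingEnd ℂ) (f k 1) * ((starRingEnd ℂ) (Psi (-r) k) * φ r) := by
      ext r; simp only [hG, map_add, map_mul, map_neg]; ring
    rw [e3, integral_sub (i0.const_mul _) (i1.const_mul _), integral_const_mul, integral_const_mul,
      adjointIntegral, inner_smul_right, PiLp.inner_apply, Fin.sum_univ_two]
    generalize ((1 / Real.sqrt (2 * Real.pi) : ℝ) : ℂ) = t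
    simp [-mul_eq_mul_left_iff]
    ring
  simp only [e1, e2]
  rw [integral_const_mul, integral_const_mul, hswap]

/-- The adjoint of a transform is given by the formal adjoint. -/
lemma IsTransform.adjoint_apply {Psi : ℝ → ℝ → ℂ}
    (hPsi : Continuous fun p : ℝ × ℝ => Psi p.1 p.2) {F : MomSpace →L[ℂ] PosSpace}
    (hF : IsTransform Psi F) {φ : ℝ → ℂ} (hφ : IsTest φ) {x : PosSpace} (hx : x =ᵐ[volume] φ)
    (hη : MemLp (adjointIntegral Psi φ) 2 halfLine) : F.adjoint x = hη.toLp _ := by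
  refine denseRange_testToMom.eq_of_inner_right ℂ fun f => ?_
  rw [ContinuousLinearMap.adjoint_inner_right, L2.inner_def, L2.inner_def]
  refine Eq.trans ?_ ((inner_transformIntegral hPsi hφ f.2).trans ?_)
  · refine integral_congr_ae ?_
    filter_upwards [isTransform_iff.1 hF f, hx] with r h1 h2
    rw [h1, h2]
  · refine integral_congr_ae ?_
    filter_upwards [coeFn_testToMom f, hη.coeFn_toLp] with k h1 h2
    rw [h1, h2]

lemma contDiff_rootWeight {θ : ℝ} (hθ : Real.sin θ ≠ 0) (a : ℝ) :
    ContDiff ℝ ∞ (rootWeight a θ) := by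
  have h : ContDiff ℝ ∞ (sinhSq a θ) := by
    unfold sinhSq
    exact ((Real.contDiff_sinh.comp (contDiff_const.mul contDiff_id)).pow 2).add contDiff_const
  refine (contDiff_const.mul (h.sqrt fun r => (sinhSq_pos hθ a r).ne')).inv fun r => ?_
  have := Real.sqrt_pos.2 (sinhSq_pos hθ a r)
  positivity

/-- A test function multiplied by the root of the weight. -/
def weighted (a θ : ℝ) (φ : ℝ → ℂ) (r : ℝ) : ℂ := φ r * rootWeight a θ r

lemma IsTest.weighted {θ : ℝ} (hθ : Real.sin θ ≠ 0) (a : ℝ) {φ : ℝ → ℂ} (hφ : IsTest φ) :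
    IsTest (weighted a θ φ) :=
  hφ.mul_smooth (ofRealCLM.contDiff.comp (contDiff_rootWeight hθ a))

/-- Twice the even part of a function. -/
def evenExt (q : ℝ → ℂ) (k : ℝ) : ℂ := q k + q (-k)

lemma IsTest.evenExt {q : ℝ → ℂ} (hq : IsTest q) : IsTest (evenExt q) := hq.add hq.comp_neg

lemma evenExt_neg (q : ℝ → ℂ) (k : ℝ) : evenExt q (-k) = evenExt q k := by
  simp [IsometryBreakdown.evenExt, add_comm]

lemma laplace_evenExt {q : ℝ → ℂ} (hq : IsTest q) (s : ℂ) :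
    laplace (evenExt q) s = ∫ k : ℝ, q k * (2 * cosh (k * s)) := by
  have h := laplace_add hq hq.comp_neg s
  rw [laplace_comp_neg] at h
  refine Eq.trans h ?_
  rw [laplace, laplace,
    ← integral_add (hq.integrable_mul (by fun_prop)) (hq.integrable_mul (by fun_prop))]
  congr 1; ext k
  rw [cosh, mul_neg]
  ring

/-- Conjugation exchanges the two terms up to sign: the kernel is imaginary for δ = 1 and real for δ
= −1. -/
lemma conj_parityKernel {δ : ℝ} (hδ : δ ^ 2 = 1) (a c θ r k : ℝ) :
    (starRingEnd ℂ) (parityKernel a c θ δ r k) = -δ * parityKernel a c θ δ r k := by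
  have hδ' : (δ : ℂ) ^ 2 = 1 := by exact_mod_cast hδ
  simp only [parityKernel, map_sub, map_mul, map_ofNat, ← sinh_conj, map_add, conj_ofReal, conj_I,
    mul_neg, ← sub_eq_add_neg, sub_neg_eq_add]
  linear_combination -(2 * sinh (k * (c - r * I)) * sinh (a * r - θ * I)) * hδ'

/-- The duality between r and k: (a, r) and (c, k) trade places, at the price of cosh instead of
sinh. Hence the adjoint is again built from amplitudes, with a and c exchanged. -/
lemma parityKernel_one (a c θ r k : ℝ) :
    parityKernel a c θ 1 r k = 2 * cosh (r * (a + k * I)) * cosh (c * k + θ * I)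
      - 2 * cosh (r * ((-a : ℝ) + k * I)) * cosh (c * k - θ * I) := by
  rw [parityKernel, ofReal_one, one_mul,
    show (k : ℂ) * (c + r * I) = c * k + r * k * I by ring,
    show (k : ℂ) * (c - r * I) = c * k - r * k * I by ring,
    show (r : ℂ) * (a + k * I) = a * r + r * k * I by ring,
    show (r : ℂ) * ((-a : ℝ) + k * I) = -(a * r - r * k * I) by push_cast; ring, cosh_neg]
  simp only [sinh_add, cosh_add, sinh_sub, cosh_sub]
  ring

/-- The same duality in the odd channel, where sinh is kept. -/
lemma parityKernel_neg_one (a c θ r k : ℝ) :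
    parityKernel a c θ (-1) r k = 2 * sinh (r * (a + k * I)) * sinh (c * k + θ * I)
      - 2 * sinh (r * ((-a : ℝ) + k * I)) * sinh (c * k - θ * I) := by
  rw [parityKernel,
    show (k : ℂ) * (c + r * I) = c * k + r * k * I by ring,
    show (k : ℂ) * (c - r * I) = c * k - r * k * I by ring,
    show (r : ℂ) * (a + k * I) = a * r + r * k * I by ring,
    show (r : ℂ) * ((-a : ℝ) + k * I) = -(a * r - r * k * I) by push_cast; ring, sinh_neg]
  simp only [sinh_add, sinh_sub]
  push_cast
  ring

/-- sinh(z + i(θ + π/2)) = i cosh(z + iθ): the change from sinh to cosh is absorbed in a shift of θ,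
and cosh(r·) calls for the even extension. -/
lemma integral_mul_parityKernel_one {v : ℝ → ℂ} (hv : IsTest v) (a c θ k : ℝ) :
    ∫ r, v r * parityKernel a c θ 1 r k
      = -I * amplitude c a (θ + Real.pi / 2) 1 (evenExt v) k := by
  have e1 : sinh (c * k + (θ + Real.pi / 2 : ℝ) * I) = I * cosh (c * k + θ * I) := by
    rw [show (c * k + (θ + Real.pi / 2 : ℝ) * I : ℂ) = (c * k + θ * I) + (Real.pi / 2 : ℂ) * I by
      push_cast; ring, sinh_add, sinh_mul_I, cosh_mul_I, cos_pi_div_two, sin_pi_div_two]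
    ring
  have e2 : sinh (c * k - (θ + Real.pi / 2 : ℝ) * I) = -(I * cosh (c * k - θ * I)) := by
    rw [show (c * k - (θ + Real.pi / 2 : ℝ) * I : ℂ) = (c * k - θ * I) - (Real.pi / 2 : ℂ) * I by
      push_cast; ring, sinh_sub, sinh_mul_I, cosh_mul_I, cos_pi_div_two, sin_pi_div_two]
    ring
  rw [amplitude, e1, e2, laplace_evenExt hv, laplace_evenExt hv]
  rw [show ∀ x y z w : ℂ, -I * (x * (I * y) + ((1 : ℝ) : ℂ) * (z * -(I * w))) = x * y - z * w from
    fun x y z w => by push_cast; linear_combination (z * w - x * y) * I_sq]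
  rw [← integral_mul_const, ← integral_mul_const, ← integral_sub]
  · congr 1; ext r
    rw [parityKernel_one]; ring
  · exact (hv.integrable_mul (by fun_prop)).mul_const _
  · exact (hv.integrable_mul (by fun_prop)).mul_const _

lemma integral_mul_parityKernel_neg_one {v : ℝ → ℂ} (hv : IsTest v) (a c θ k : ℝ) :
    ∫ r, v r * parityKernel a c θ (-1) r k = amplitude c a θ (-1) (oddExt v) k := by
  rw [amplitude, laplace_oddExt hv, laplace_oddExt hv]
  rw [show ∀ x y : ℂ, x + ((-1 : ℝ) : ℂ) * y = x - y from fun x y => by push_cast; ring]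
  rw [← integral_mul_const, ← integral_mul_const, ← integral_sub]
  · congr 1; ext r
    rw [parityKernel_neg_one]; ring
  · exact (hv.integrable_mul (by fun_prop)).mul_const _
  · exact (hv.integrable_mul (by fun_prop)).mul_const _

section
variable {a c θ : ℝ} {φ : ℝ → ℂ}

lemma sinhSq_add_half_pi (c θ k : ℝ) :
    ‖cosh (c * k + θ * I)‖ ^ 2 = sinhSq c (θ + Real.pi / 2) k := by
  have h := (norm_sq_conj_arg (c * k) θ).2
  push_cast at h
  have h2 := normSq_cosh_sub (c * k) θ
  push_cast at h2
  rw [h, h2, sinhSq, Real.sin_add_pi_div_two, Real.cosh_two_mul, Real.cos_two_mul, Real.cosh_sq]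
  ring

lemma sinhSq_eq_norm (c θ k : ℝ) : ‖sinh (c * k + θ * I)‖ ^ 2 = sinhSq c θ k := by
  have h := (norm_sq_conj_arg (c * k) θ).1
  push_cast at h
  have h2 := normSq_sinh_sub (c * k) θ
  push_cast at h2
  rw [h, h2, sinhSq, Real.cosh_two_mul, Real.cos_two_mul, Real.cosh_sq, Real.sin_sq]
  ring

lemma integrable_conj_waveKernel (hs : Real.sin θ ≠ 0) (hc : Real.cos θ ≠ 0) (hφ : IsTest φ)
    (a c k : ℝ) :
    Integrable (fun r => (starRingEnd ℂ) (waveKernel a c θ r k) * φ r) ∧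
    Integrable (fun r => (starRingEnd ℂ) (waveKernel a c θ (-r) k) * φ r) := by
  have h := continuous_waveKernel hs hc a c
  have h1 : Continuous fun r => waveKernel a c θ r k :=
    Continuous.comp (g := fun p : ℝ × ℝ => waveKernel a c θ p.1 p.2) (f := fun r => (r, k)) h
      (by fun_prop)
  have h2 : Continuous fun r => waveKernel a c θ (-r) k :=
    Continuous.comp (g := fun r => waveKernel a c θ r k) h1 continuous_neg
  have h3 : Continuous fun r => (starRingEnd ℂ) (waveKernel a c θ r k) := continuous_conj.comp h1
  have h4 : Continuous fun r => (starRingEnd ℂ) (waveKernel a c θ (-r) k) :=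
    continuous_conj.comp h2
  exact ⟨hφ.integrable_mul_left h3, hφ.integrable_mul_left h4⟩

lemma conj_sub_mul_I (y θ : ℝ) : (starRingEnd ℂ) ((y : ℂ) - θ * I) = y + θ * I := by
  simp [conj_ofReal]

/-- The minus sign in the second component makes the difference pair φ with Ψ(r,k) + Ψ(−r,k), the
even channel; the sum of components gives the odd one. -/
lemma adjointIntegral_sub (hs : Real.sin θ ≠ 0) (hc : Real.cos θ ≠ 0) (hφ : IsTest φ)
    (a c k : ℝ) :
    adjointIntegral (waveKernel a c θ) φ k 0 - adjointIntegral (waveKernel a c θ) φ k 1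
      = ((1 / Real.sqrt (2 * Real.pi) : ℝ) : ℂ) *
        (-I * amplitude c a (θ + Real.pi / 2) 1 (evenExt (weighted a θ φ)) k
          / cosh (c * k + θ * I)) := by
  obtain ⟨i1, i2⟩ := integrable_conj_waveKernel hs hc hφ a c k
  have hne : cosh ((c : ℂ) * k + θ * I) ≠ 0 := by
    have := cosh_sub_ne_zero hc (c * k)
    rw [← norm_pos_iff, ← (norm_sq_conj_arg _ _).2, norm_pos_iff] at this
    push_cast at this; exact this
  rw [← integral_mul_parityKernel_one (hφ.weighted hs a), adjointIntegral]
  generalize ((1 / Real.sqrt (2 * Real.pi) : ℝ) : ℂ) = t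
  simp only [PiLp.smul_apply, smul_eq_mul]
  change t * (∫ r, (starRingEnd ℂ) (waveKernel a c θ r k) * φ r)
    - t * (-∫ r, (starRingEnd ℂ) (waveKernel a c θ (-r) k) * φ r) = _
  rw [← mul_sub, sub_neg_eq_add, ← integral_add i1 i2]
  congr 1
  rw [eq_div_iff hne, ← integral_mul_const]
  congr 1; ext r
  have h := congrArg (starRingEnd ℂ) (waveKernel_add_neg hs hc a c r k)
  rw [map_mul, ← cosh_conj, ← ofReal_mul, conj_sub_mul_I, map_neg, map_mul, map_add,
    conj_parityKernel (one_pow 2), conj_ofReal, ofReal_mul, ofReal_one] at h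
  rw [weighted]
  linear_combination φ r * h

lemma adjointIntegral_add (hs : Real.sin θ ≠ 0) (hc : Real.cos θ ≠ 0) (hφ : IsTest φ)
    (a c k : ℝ) :
    adjointIntegral (waveKernel a c θ) φ k 0 + adjointIntegral (waveKernel a c θ) φ k 1
      = ((1 / Real.sqrt (2 * Real.pi) : ℝ) : ℂ) *
        (-amplitude c a θ (-1) (oddExt (weighted a θ φ)) k / sinh (c * k + θ * I)) := by
  obtain ⟨i1, i2⟩ := integrable_conj_waveKernel hs hc hφ a c k
  have hne : sinh ((c : ℂ) * k + θ * I) ≠ 0 := sinh_add_mul_I_ne_zero hs c k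
  rw [← integral_mul_parityKernel_neg_one (hφ.weighted hs a), adjointIntegral]
  generalize ((1 / Real.sqrt (2 * Real.pi) : ℝ) : ℂ) = t
  simp only [PiLp.smul_apply, smul_eq_mul]
  change t * (∫ r, (starRingEnd ℂ) (waveKernel a c θ r k) * φ r)
    + t * (-∫ r, (starRingEnd ℂ) (waveKernel a c θ (-r) k) * φ r) = _
  rw [← mul_add, ← sub_eq_add_neg, ← integral_sub i1 i2]
  congr 1
  rw [eq_div_iff hne, ← integral_mul_const, ← integral_neg]
  congr 1; ext r
  have h := congrArg (starRingEnd ℂ) (waveKernel_sub_neg hs hc a c r k)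
  rw [map_mul, ← sinh_conj, ← ofReal_mul, conj_sub_mul_I, map_neg, map_mul, map_sub,
    conj_parityKernel (by norm_num), conj_ofReal, ofReal_mul] at h
  push_cast at h ⊢
  rw [weighted]
  linear_combination φ r * h

/-- Continuity is read off from the closed forms of the sum and difference of the two components. -/
lemma continuous_adjointIntegral (hs : Real.sin θ ≠ 0) (hc : Real.cos θ ≠ 0) (hφ : IsTest φ)
    (a c : ℝ) : Continuous (adjointIntegral (waveKernel a c θ) φ) := by
  have hv := hφ.weighted hs a
  have c1 := continuous_amplitude c a (θ + Real.pi / 2) 1 hv.evenExt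
  have c2 := continuous_amplitude c a θ (-1) hv.oddExt
  have n1 : ∀ k : ℝ, cosh ((c : ℂ) * k + θ * I) ≠ 0 := fun k => by
    have := cosh_sub_ne_zero hc (c * k)
    rw [← norm_pos_iff, ← (norm_sq_conj_arg _ _).2, norm_pos_iff] at this
    push_cast at this; exact this
  have n2 : ∀ k : ℝ, sinh ((c : ℂ) * k + θ * I) ≠ 0 := fun k => sinh_add_mul_I_ne_zero hs c k
  have d1 : Continuous fun k => adjointIntegral (waveKernel a c θ) φ k 0
      - adjointIntegral (waveKernel a c θ) φ k 1 := by
    simp only [adjointIntegral_sub hs hc hφ]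
    exact continuous_const.mul ((continuous_const.mul c1).div (by fun_prop) n1)
  have d2 : Continuous fun k => adjointIntegral (waveKernel a c θ) φ k 0
      + adjointIntegral (waveKernel a c θ) φ k 1 := by
    simp only [adjointIntegral_add hs hc hφ]
    exact continuous_const.mul (c2.neg.div (by fun_prop) n2)
  refine (PiLp.continuous_toLp 2 _).comp (continuous_pi (Fin.forall_fin_two.2 ⟨?_, ?_⟩)) |>.congr
    (fun k => rfl : ∀ k, WithLp.toLp 2 (adjointIntegral (waveKernel a c θ) φ k).ofLp
      = adjointIntegral (waveKernel a c θ) φ k)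
  · exact ((d2.add d1).div_const 2).congr fun k => by simp only [Pi.add_apply]; ring
  · exact ((d2.sub d1).div_const 2).congr fun k => by simp only [Pi.sub_apply]; ring

lemma normSq_adjointIntegral (hs : Real.sin θ ≠ 0) (hc : Real.cos θ ≠ 0) (hφ : IsTest φ)
    (a c k : ℝ) :
    ‖adjointIntegral (waveKernel a c θ) φ k‖ ^ 2 = (4 * Real.pi)⁻¹ *
      (‖amplitude c a (θ + Real.pi / 2) 1 (evenExt (weighted a θ φ)) k‖ ^ 2
          / sinhSq c (θ + Real.pi / 2) k
        + ‖amplitude c a θ (-1) (oddExt (weighted a θ φ)) k‖ ^ 2 / sinhSq c θ k) := by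
  have h := parallelogram_law_with_norm ℂ (adjointIntegral (waveKernel a c θ) φ k 0)
    (adjointIntegral (waveKernel a c θ) φ k 1)
  rw [adjointIntegral_sub hs hc hφ, adjointIntegral_add hs hc hφ] at h
  rw [EuclideanSpace.norm_sq_eq, Fin.sum_univ_two]
  have e : ∀ z : ℂ, ‖((1 / Real.sqrt (2 * Real.pi) : ℝ) : ℂ) * z‖ ^ 2
      = (2 * Real.pi)⁻¹ * ‖z‖ ^ 2 := fun z => by
    rw [norm_mul, mul_pow, norm_real, Real.norm_eq_abs, sq_abs,
      div_pow, Real.sq_sqrt (by positivity), one_pow, one_div]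
  rw [e, e, norm_div, norm_div, div_pow, div_pow, sinhSq_add_half_pi, sinhSq_eq_norm, norm_neg,
    norm_mul, norm_neg, norm_I, one_mul] at h
  rw [← sinhSq_add_half_pi, ← sinhSq_eq_norm] at *
  have hp := Real.pi_ne_zero
  rw [mul_inv] at h ⊢
  linarith

/-- The Plancherel weight is 2|sinh(ar + iθ)|² in both channels, because the shift by π/2 flips the
sign of cos 2θ in the even one. It cancels the factor w₀ carried by the weighted function. -/
lemma integral_normSq_evenExt_add_oddExt (hs : Real.sin θ ≠ 0) (a : ℝ) (hφ : IsTest φ) :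
    (∫ r, ‖evenExt (weighted a θ φ) r‖ ^ 2 * (Real.cosh (2 * a * r) - Real.cos (2 * θ)))
      + (∫ r, ‖oddExt (weighted a θ φ) r‖ ^ 2 * (Real.cosh (2 * a * r) - Real.cos (2 * θ)))
      = 2 * ∫ r, ‖φ r‖ ^ 2 := by
  have hv := hφ.weighted hs a
  have hi : ∀ {p : ℝ → ℂ}, IsTest p →
      Integrable fun r => ‖p r‖ ^ 2 * (Real.cosh (2 * a * r) - Real.cos (2 * θ)) := fun {p} hp => by
    have := hp.continuous
    refine Continuous.integrable_of_hasCompactSupport (by fun_prop) (HasCompactSupport.mul_right ?_)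
    exact hp.2.comp_left (g := fun z : ℂ => ‖z‖ ^ 2) (by simp)
  have hw : ∀ r, ‖weighted a θ φ r‖ ^ 2 * (Real.cosh (2 * a * r) - Real.cos (2 * θ))
      = 2⁻¹ * ‖φ r‖ ^ 2 := fun r => by
    have h0 := sinhSq_pos hs a r
    have h1 : Real.cosh (2 * a * r) - Real.cos (2 * θ) = 2 * sinhSq a θ r := by
      rw [sinhSq, mul_assoc, Real.cosh_two_mul, Real.cos_two_mul, Real.cosh_sq, Real.sin_sq]
      ring
    rw [h1, weighted, norm_mul, mul_pow, norm_real, Real.norm_eq_abs, sq_abs, rootWeight_sq]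
    field_simp
    norm_num
  rw [← integral_add (hi hv.evenExt) (hi hv.oddExt)]
  have e : ∀ r, ‖evenExt (weighted a θ φ) r‖ ^ 2 * (Real.cosh (2 * a * r) - Real.cos (2 * θ))
      + ‖oddExt (weighted a θ φ) r‖ ^ 2 * (Real.cosh (2 * a * r) - Real.cos (2 * θ))
      = ‖φ r‖ ^ 2 + ‖φ (-r)‖ ^ 2 := fun r => by
    have h := parallelogram_law_with_norm ℂ (weighted a θ φ r) (weighted a θ φ (-r))
    have h1 := hw r
    have h2 := hw (-r)
    rw [mul_neg, Real.cosh_neg] at h2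
    rw [evenExt, oddExt]
    linear_combination (Real.cosh (2 * a * r) - Real.cos (2 * θ)) * h + 2 * h1 + 2 * h2
  simp only [e]
  have hin := hφ.integrable_normSq
  rw [integral_add hin hin.comp_neg, integral_neg_eq_self (fun r => ‖φ r‖ ^ 2), two_mul]

/-- The squared norm of the adjoint transform of a test function. -/
lemma integral_normSq_adjointIntegral (hφ : IsTest φ) {m : ℕ} (hc0 : 0 < c)
    (h₁ : m * Real.pi < 2 * (c * a)) (h₂ : 2 * (c * a) < (m + 1) * Real.pi)
    (hs : Real.sin (c * a) ≠ 0) (hc : Real.cos (c * a) ≠ 0) :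
    IntegrableOn (fun k => ‖adjointIntegral (waveKernel a c (c * a)) φ k‖ ^ 2) (Ioi 0) ∧
    ∫ k in Ioi (0 : ℝ), ‖adjointIntegral (waveKernel a c (c * a)) φ k‖ ^ 2
      = (∫ r, ‖φ r‖ ^ 2) + Real.sin (2 * (c * a)) / (2 * c) *
        (∑ j ∈ Finset.Icc 1 m, ‖laplace (evenExt (weighted a (c * a) φ))
              ((j * (Real.pi / (2 * c)) : ℝ) : ℂ)‖ ^ 2
          - ∑ j ∈ Finset.Icc 1 (m / 2), (‖laplace (evenExt (weighted a (c * a) φ))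
              ((j * (Real.pi / c) : ℝ) : ℂ)‖ ^ 2
            + ‖laplace (oddExt (weighted a (c * a) φ)) ((j * (Real.pi / c) : ℝ) : ℂ)‖ ^ 2)) := by
  have hv := hφ.weighted hs a
  have one2 : (1 : ℝ) ^ 2 = 1 := one_pow 2
  have neg2 : (-1 : ℝ) ^ 2 = 1 := by norm_num
  have hs' : Real.sin (c * a + Real.pi / 2) ≠ 0 := by rwa [Real.sin_add_pi_div_two]
  have hE : ∀ k, evenExt (weighted a (c * a) φ) (-k)
      = ((1 : ℝ) : ℂ) * evenExt (weighted a (c * a) φ) k := fun k => by rw [evenExt_neg]; simp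
  have hO := oddExt_neg (weighted a (c * a) φ)
  have n₁ : ((m / 2 : ℕ) : ℝ) * Real.pi < c * a := by
    have : ((m / 2 : ℕ) : ℝ) ≤ m / 2 := Nat.cast_div_le
    have := Real.pi_pos
    nlinarith
  have n₂ : c * a < ((m / 2 : ℕ) + 1 : ℝ) * Real.pi := by
    have h : m + 1 ≤ 2 * (m / 2 + 1) := by omega
    have h' : (m + 1 : ℝ) ≤ 2 * ((m / 2 : ℕ) + 1) := by exact_mod_cast h
    have := Real.pi_pos
    nlinarith
  have iA := (integral_normSq_amplitude hv.evenExt hE one2 one2 hs' c a).1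
  have iB := (integral_normSq_amplitude hv.oddExt hO neg2 neg2 hs c a).1
  have vA := integral_normSq_amplitude_cosh hv.evenExt (evenExt_neg _) hc0 h₁ h₂
  have vB := integral_normSq_amplitude_sinh hv.oddExt hO neg2 neg2 hc0 n₁ n₂
  have hi : Integrable (fun k => ‖adjointIntegral (waveKernel a c (c * a)) φ k‖ ^ 2) := by
    simp only [normSq_adjointIntegral hs hc hφ]
    exact (iA.add iB).const_mul _
  refine ⟨hi.integrableOn, ?_⟩
  -- The squared norm is even in k, so the half-line integral is half the integral over ℝ, which the
  -- amplitude formulas compute.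
  have hev : ∀ k, ‖adjointIntegral (waveKernel a c (c * a)) φ (-k)‖ ^ 2
      = ‖adjointIntegral (waveKernel a c (c * a)) φ k‖ ^ 2 := fun k => by
    rw [normSq_adjointIntegral hs hc hφ, normSq_adjointIntegral hs hc hφ,
      amplitude_neg hE one2, amplitude_neg hO neg2, sinhSq_neg, sinhSq_neg]
    norm_num
  have hhalf := integral_comp_abs (f := fun k => ‖adjointIntegral (waveKernel a c (c * a)) φ k‖ ^ 2)
  have habs : ∀ k, ‖adjointIntegral (waveKernel a c (c * a)) φ |k|‖ ^ 2
      = ‖adjointIntegral (waveKernel a c (c * a)) φ k‖ ^ 2 := fun k => by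
    rcases abs_choice k with h | h <;> rw [h]
    exact hev k
  simp only [habs] at hhalf
  have hsum : ∫ k, ‖adjointIntegral (waveKernel a c (c * a)) φ k‖ ^ 2 = (4 * Real.pi)⁻¹ *
      ((∫ k, ‖amplitude c a (c * a + Real.pi / 2) 1 (evenExt (weighted a (c * a) φ)) k‖ ^ 2
          / sinhSq c (c * a + Real.pi / 2) k)
        + ∫ k, ‖amplitude c a (c * a) (-1) (oddExt (weighted a (c * a) φ)) k‖ ^ 2
          / sinhSq c (c * a) k) := by
    simp only [normSq_adjointIntegral hs hc hφ]
    rw [integral_const_mul, integral_add iA iB]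
  have hmain := integral_normSq_evenExt_add_oddExt hs a hφ
  rw [hsum, vA, vB, laplace_oddExt_zero hv] at hhalf
  simp only [neg_one_mul, ← sub_eq_add_neg] at hhalf
  rw [Finset.sum_add_distrib]
  rw [← mul_right_inj' (two_ne_zero (α := ℝ)), ← hhalf]
  generalize ∫ k, ‖evenExt (weighted a (c * a) φ) k‖ ^ 2
    * (Real.cosh (2 * a * k) - Real.cos (2 * (c * a))) = X at *
  generalize ∫ k, ‖oddExt (weighted a (c * a) φ) k‖ ^ 2
    * (Real.cosh (2 * a * k) - Real.cos (2 * (c * a))) = Y at *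
  rw [norm_zero, show ∫ r, ‖φ r‖ ^ 2 = (X + Y) / 2 by rw [hmain]; ring]
  have hc' := hc0.ne'
  have hp := Real.pi_ne_zero
  field_simp
  ring

end

/-! ### Linear independence of the deficiency vectors -/

/-- Independence of combinations of `exp(e_i t k)` and `exp(-e_i t k)` on the half-line. -/
lemma eq_zero_of_sum_exp_eq_zero {ι : Type*} (s : Finset ι) (e : ι → ℕ) (he : ∀ i ∈ s, 1 ≤ e i)
    (hinj : Set.InjOn e s) {t : ℝ} (ht : t ≠ 0) (d σ : ι → ℂ)
    (h : ∀ k : ℝ, 0 < k → ∑ i ∈ s, d i * (exp (e i * t * k) + σ i * exp (-(e i * t * k))) = 0) :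
    ∀ i ∈ s, d i = 0 := by
  classical
  -- Multiplication by exp(Ntk) turns the sum into a polynomial in exp(tk), which has infinitely
  -- many roots.
  set N := s.sup e with hN
  have hle : ∀ i ∈ s, e i ≤ N := fun i hi => Finset.le_sup hi
  set P : Polynomial ℂ := ∑ i ∈ s, Polynomial.C (d i) *
    (Polynomial.X ^ (N + e i) + Polynomial.C (σ i) * Polynomial.X ^ (N - e i)) with hP
  have hroot : ∀ k : ℝ, 0 < k → P.IsRoot (exp (t * k)) := fun k hk => by
    rw [Polynomial.IsRoot, hP, Polynomial.eval_finsetSum]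
    have h1 : ∀ i ∈ s, Polynomial.eval (exp (t * k)) (Polynomial.C (d i) *
        (Polynomial.X ^ (N + e i) + Polynomial.C (σ i) * Polynomial.X ^ (N - e i)))
        = exp (N * (t * k)) * (d i * (exp (e i * t * k) + σ i * exp (-(e i * t * k)))) := by
      intro i hi
      simp only [Polynomial.eval_mul, Polynomial.eval_C, Polynomial.eval_add, Polynomial.eval_pow,
        Polynomial.eval_X, ← exp_nat_mul]
      rw [show (((N + e i : ℕ) : ℂ)) * (t * k) = N * (t * k) + e i * t * k by push_cast; ring,
        show (((N - e i : ℕ) : ℂ)) * (t * k) = N * (t * k) + -(e i * t * k) by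
          push_cast [Nat.cast_sub (hle i hi)]; ring, exp_add, exp_add]
      ring
    rw [Finset.sum_congr rfl h1, ← Finset.mul_sum, h k hk, mul_zero]
  have hP0 : P = 0 := by
    refine Polynomial.eq_zero_of_infinite_isRoot P (Set.Infinite.mono (s := (fun k : ℝ =>
      exp (t * k)) '' Ioi 0) ?_ ((Ioi_infinite 0).image ?_))
    · rintro _ ⟨k, hk, rfl⟩
      exact hroot k hk
    · intro x _ y _ hxy
      have h1 : Real.exp (t * x) = Real.exp (t * y) := by
        refine ofReal_injective ?_
        push_cast
        exact hxy
      exact mul_left_cancel₀ ht (Real.exp_injective h1)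
  intro i hi
  -- Compare coefficients at N + e i: e ≥ 1 keeps these apart from all exponents N − e b, and
  -- injectivity keeps them apart from each other.
  have h1 := congrArg (fun p => Polynomial.coeff p (N + e i)) hP0
  simp only [hP, Polynomial.finsetSum_coeff, Polynomial.coeff_C_mul, Polynomial.coeff_add,
    Polynomial.coeff_X_pow, Polynomial.coeff_zero] at h1
  rw [Finset.sum_eq_single i] at h1
  · have := he i hi
    rwa [if_pos rfl, if_neg (by omega), mul_zero, add_zero, mul_one] at h1
  · intro b hb hne
    have h2 := he i hi
    have h3 : e i ≠ e b := fun h => hne (hinj hb hi h.symm)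
    rw [if_neg (by omega), if_neg (by omega)]
    simp
  · exact fun h => absurd hi h

lemma sum_smul_ae_eq {α ι E : Type*} [MeasurableSpace α] {μ : Measure α} [NormedAddCommGroup E]
    [NormedSpace ℂ E] (s : Finset ι) (d : ι → ℂ) (x : ι → Lp E 2 μ) (f : ι → α → E)
    (h : ∀ i ∈ s, x i =ᵐ[μ] f i) :
    (∑ i ∈ s, d i • x i : Lp E 2 μ) =ᵐ[μ] fun a => ∑ i ∈ s, d i • f i a := by
  classical
  induction s using Finset.induction_on with
  | empty =>
    simp only [Finset.sum_empty]
    exact Lp.coeFn_zero E 2 μ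
  | insert i s hi ih =>
    rw [Finset.sum_insert hi]
    filter_upwards [Lp.coeFn_add (d i • x i) (∑ i ∈ s, d i • x i), Lp.coeFn_smul (d i) (x i),
      h i (Finset.mem_insert_self _ _), ih fun j hj => h j (Finset.mem_insert_of_mem hj)]
      with a h1 h2 h3 h4
    rw [h1, Pi.add_apply, h2, Pi.smul_apply, h3, h4, Finset.sum_insert hi]

/-- A vanishing combination of classes of continuous functions vanishes pointwise. -/
lemma sum_smul_eq_zero_of_continuous {ι E : Type*} [NormedAddCommGroup E]
    [NormedSpace ℂ E] {U : Set ℝ} (hU : IsOpen U) (s : Finset ι) (d : ι → ℂ)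
    (x : ι → Lp E 2 ((volume : Measure ℝ).restrict U)) (f : ι → ℝ → E)
    (hf : ∀ i ∈ s, Continuous (f i))
    (h : ∀ i ∈ s, x i =ᵐ[(volume : Measure ℝ).restrict U] f i) (h0 : ∑ i ∈ s, d i • x i = 0) :
    ∀ a ∈ U, ∑ i ∈ s, d i • f i a = 0 := by
  have h1 := sum_smul_ae_eq s d x f h
  rw [h0] at h1
  have h2 := Measure.eqOn_open_of_ae_eq (h1.symm.trans (Lp.coeFn_zero E 2 _)) hU
    (continuous_finsetSum s fun i hi => (hf i hi).const_smul (d i)).continuousOn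
    continuous_const.continuousOn
  exact fun a ha => h2 ha

section
variable {ρ κ : ℝ}

/-- The vectors (1, −1) and (1, 1) separate the even and the odd family. Within a family the common
denominator factors out and independence of the sinh(jρk) remains. -/
lemma linearIndependent_chi (hρ : 0 < ρ) (hκ : 0 < κ)
    (hs : Real.sin (Real.pi / ρ * (Real.pi / (2 * κ))) ≠ 0)
    (hc : Real.cos (Real.pi / ρ * (Real.pi / (2 * κ))) ≠ 0) {n : ℕ} {χe χo : ℕ → MomSpace}
    (hχ : ∀ j ∈ Finset.Icc 1 n, χe j =ᵐ[halfLine] chiEven ρ κ j ∧ χo j =ᵐ[halfLine] chiOdd ρ κ j) :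
    LinearIndependent ℂ fun i : (Finset.Icc 1 n ×ˢ (Finset.univ : Finset Bool)) =>
      cond i.1.2 (χe i.1.1) (χo i.1.1) := by
  refine linearIndepOn_finset_iff.2 (fun d hd => ?_ :
    ∀ d : ℕ × Bool → ℂ, ∑ i ∈ Finset.Icc 1 n ×ˢ (Finset.univ : Finset Bool),
      d i • cond i.2 (χe i.1) (χo i.1) = 0 → ∀ i ∈ _, d i = 0)
  have h := sum_smul_eq_zero_of_continuous isOpen_Ioi _ d
    (fun i : ℕ × Bool => cond i.2 (χe i.1) (χo i.1))
    (fun i => cond i.2 (chiEven ρ κ i.1) (chiOdd ρ κ i.1)) ?_ ?_ hd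
  rotate_left
  · rintro ⟨j, b⟩ -
    cases b
    · exact continuous_chiOdd hρ hκ hs j
    · exact continuous_chiEven hρ hκ hc j
  · rintro ⟨j, b⟩ hj
    have := hχ j (Finset.mem_product.1 hj).1
    cases b
    · exact this.2
    · exact this.1
  have h2 : ∀ k : ℝ, 0 < k → ∑ j ∈ Finset.Icc 1 n, d (j, true) * Real.sinh (j * ρ * k) = 0 ∧
      ∑ j ∈ Finset.Icc 1 n, d (j, false) * Real.sinh (j * ρ * k) = 0 := fun k hk => by
    have hk := h k hk
    have n1 := cosh_chiArg_ne_zero hρ hκ hc k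
    have n2 := sinh_chiArg_ne_zero hρ hκ hs k
    rw [Finset.sum_product] at hk
    simp only [Fintype.sum_bool, cond_true, cond_false] at hk
    rw [Finset.sum_add_distrib] at hk
    simp only [chiEven, chiOdd, smul_smul] at hk
    rw [← Finset.sum_smul, ← Finset.sum_smul] at hk
    simp only [← mul_div_assoc, ← Finset.sum_div] at hk
    generalize ∑ j ∈ Finset.Icc 1 n, d (j, true) * (Real.sinh (j * ρ * k) : ℂ) = A at *
    generalize ∑ j ∈ Finset.Icc 1 n, d (j, false) * (Real.sinh (j * ρ * k) : ℂ) = B at *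
    have k0 := congrArg (fun v : EuclideanSpace ℂ (Fin 2) => v 0) hk
    have k1 := congrArg (fun v : EuclideanSpace ℂ (Fin 2) => v 1) hk
    simp at k0 k1
    constructor
    · have : A / cosh (chiArg ρ κ k) = 0 := by linear_combination (k0 - k1) / 2
      exact (div_eq_zero_iff.1 this).resolve_right n1
    · have : B / sinh (chiArg ρ κ k) = 0 := by linear_combination (k0 + k1) / 2
      exact (div_eq_zero_iff.1 this).resolve_right n2
  have h3 : ∀ d' : ℕ → ℂ, (∀ k : ℝ, 0 < k →
      ∑ j ∈ Finset.Icc 1 n, d' j * Real.sinh (j * ρ * k) = 0) → ∀ j ∈ Finset.Icc 1 n, d' j = 0 := by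
    intro d' hd'
    refine eq_zero_of_sum_exp_eq_zero _ id (fun i hi => (Finset.mem_Icc.1 hi).1)
      (Set.injOn_id _) hρ.ne' d' (fun _ => -1) fun k hk => ?_
    have := congrArg (fun z => 2 * z) (hd' k hk)
    simp only [mul_zero, Finset.mul_sum] at this
    rw [← this]
    refine Finset.sum_congr rfl fun j _ => ?_
    rw [ofReal_sinh, sinh]
    push_cast
    simp only [id]
    ring
  rintro ⟨j, b⟩ hj
  have hj := (Finset.mem_product.1 hj).1
  cases b
  · exact h3 (fun j => d (j, false)) (fun k hk => (h2 k hk).2) j hj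
  · exact h3 (fun j => d (j, true)) (fun k hk => (h2 k hk).1) j hj

lemma hFun_eq_exp (κ : ℝ) (j : ℕ) (r : ℝ) :
    (hFun κ j r : ℂ) = exp (((j + 1 : ℕ) : ℂ) * κ * r)
      + (-1) ^ j * exp (-(((j + 1 : ℕ) : ℂ) * κ * r)) := by
  rw [hFun]
  rcases Nat.even_or_odd j with hj | hj
  · rw [if_pos hj, hj.neg_one_pow]; push_cast; rw [cosh]; ring
  · rw [if_neg (Nat.not_even_iff_odd.2 hj), hj.neg_one_pow]; push_cast; rw [sinh]; ring

lemma continuous_hFun (κ : ℝ) (j : ℕ) : Continuous (hFun κ j) := by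
  rcases Nat.even_or_odd j with hj | hj
  · exact (continuous_const.mul (Real.continuous_cosh.comp
      (continuous_const.mul continuous_id))).congr
      fun r => (by simp [hFun, hj] : 2 * Real.cosh ((j + 1) * κ * r) = hFun κ j r)
  · exact (continuous_const.mul (Real.continuous_sinh.comp
      (continuous_const.mul continuous_id))).congr
      fun r => (by simp [hFun, Nat.not_even_iff_odd.2 hj] :
        2 * Real.sinh ((j + 1) * κ * r) = hFun κ j r)

lemma continuous_weightRoot (hρ : 0 < ρ) (hκ : 0 < κ)
    (hs : Real.sin (Real.pi / ρ * (Real.pi / (2 * κ))) ≠ 0) : Continuous (weightRoot ρ κ) :=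
  (continuous_rootWeight hs _).congr fun r => (weightRoot_eq hρ hκ hs r).symm

lemma continuous_boundState (hρ : 0 < ρ) (hκ : 0 < κ)
    (hs : Real.sin (Real.pi / ρ * (Real.pi / (2 * κ))) ≠ 0) (j : ℕ) :
    Continuous (boundState ρ κ j) :=
  continuous_ofReal.comp ((continuous_hFun κ j).mul (continuous_weightRoot hρ hκ hs))

lemma rootWeight_pos {θ : ℝ} (hs : Real.sin θ ≠ 0) (a r : ℝ) : 0 < rootWeight a θ r := by
  have := Real.sqrt_pos.2 (sinhSq_pos hs a r)
  rw [rootWeight]; positivity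

lemma rootWeight_le {a θ : ℝ} (ha : 0 ≤ a) (hs : Real.sin θ ≠ 0) (r : ℝ) :
    rootWeight a θ r ≤ |Real.sin θ|⁻¹ * Real.exp (-(a * |r|)) := by
  have h1 := sin_mul_cosh_le_sqrt_sinhSq a θ r
  have h2 := exp_abs_le_two_cosh (a * r)
  rw [abs_mul, abs_of_nonneg ha] at h2
  have h3 := abs_pos.2 hs
  rw [rootWeight, Real.exp_neg, ← mul_inv]
  refine inv_anti₀ (mul_pos h3 (Real.exp_pos _)) ?_
  nlinarith

lemma abs_hFun_le (hκ : 0 ≤ κ) (j : ℕ) (r : ℝ) :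
    |hFun κ j r| ≤ 2 * Real.exp ((j + 1) * κ * |r|) := by
  have e : |((j : ℝ) + 1) * κ * r| = (j + 1) * κ * |r| := by
    rw [abs_mul, abs_of_nonneg (by positivity)]
  rw [hFun, ← e]
  split_ifs
  · rw [abs_mul, abs_two, abs_of_pos (Real.cosh_pos _)]
    gcongr
    exact cosh_le_exp_abs _
  · rw [abs_mul, abs_two]
    gcongr
    exact abs_sinh_le_exp_abs _

lemma memLp_boundState (hρ : 0 < ρ) (hκ : 0 < κ)
    (hs : Real.sin (Real.pi / ρ * (Real.pi / (2 * κ))) ≠ 0) {j : ℕ}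
    (hj : (j + 1) * κ < Real.pi / ρ) : MemLp (boundState ρ κ j) 2 volume := by
  refine memLp_two_of_norm_le_exp (C := 2 * |Real.sin (Real.pi / ρ * (Real.pi / (2 * κ)))|⁻¹)
    (continuous_boundState hρ hκ hs j) (sub_pos.2 hj) fun r => ?_
  have hp : 0 ≤ Real.pi / ρ := by positivity
  have h1 := abs_hFun_le hκ.le j r
  have h2 := rootWeight_le hp hs r
  have h3 := (rootWeight_pos hs (Real.pi / ρ) r).le
  rw [boundState, norm_real, Real.norm_eq_abs, abs_mul, weightRoot_eq hρ hκ hs, abs_of_nonneg h3]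
  refine (mul_le_mul h1 h2 h3 (by positivity)).trans_eq ?_
  rw [show -((Real.pi / ρ - (j + 1) * κ) * |r|) = (j + 1) * κ * |r| + -(Real.pi / ρ * |r|) by ring,
    Real.exp_add]
  ring

/-- mπ < 2θ means mκ < π/ρ, so for j < m the growth of h_j is beaten by the decay of w₀^{1/2}. The
value 0 for j ≥ m is a placeholder. -/
lemma exists_boundState (hρ : 0 < ρ) (hκ : 0 < κ)
    (hs : Real.sin (Real.pi / ρ * (Real.pi / (2 * κ))) ≠ 0) {m : ℕ}
    (hm : m * Real.pi < 2 * (Real.pi / ρ * (Real.pi / (2 * κ)))) :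
    ∃ ψ : ℕ → PosSpace, ∀ j ∈ Finset.range m, ψ j =ᵐ[volume] boundState ρ κ j := by
  have hj : ∀ j : ℕ, j < m → (j + 1) * κ < Real.pi / ρ := fun j hj => by
    have h1 : (j + 1 : ℝ) ≤ m := by exact_mod_cast hj
    have h2 : 2 * (Real.pi / ρ * (Real.pi / (2 * κ))) = Real.pi / ρ / κ * Real.pi := by field_simp
    rw [h2, mul_lt_mul_iff_left₀ Real.pi_pos, lt_div_iff₀ hκ] at hm
    exact (mul_le_mul_of_nonneg_right h1 hκ.le).trans_lt hm
  classical
  refine ⟨fun j => if h : j < m then (memLp_boundState hρ hκ hs (hj j h)).toLp _ else 0,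
    fun j hjm => ?_⟩
  simp only [Finset.mem_range.1 hjm, dif_pos]
  exact MemLp.coeFn_toLp _

lemma linearIndependent_boundState (hρ : 0 < ρ) (hκ : 0 < κ)
    (hs : Real.sin (Real.pi / ρ * (Real.pi / (2 * κ))) ≠ 0) {m : ℕ} {ψ : ℕ → PosSpace}
    (hψ : ∀ j ∈ Finset.range m, ψ j =ᵐ[volume] boundState ρ κ j) :
    LinearIndependent ℂ fun i : Finset.range m => ψ i := by
  refine linearIndepOn_finset_iff.2 (fun d hd => ?_ :
    ∀ d : ℕ → ℂ, ∑ i ∈ Finset.range m, d i • ψ i = 0 → ∀ i ∈ _, d i = 0)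
  have h1 := (sum_smul_ae_eq _ d ψ _ hψ).symm
  rw [hd] at h1
  have h2 := (continuous_finsetSum (Finset.range m) fun i _ =>
    (continuous_boundState hρ hκ hs i).const_smul (d i)).ae_eq_iff_eq volume
    (continuous_const (y := (0 : ℂ))) |>.1 (h1.trans (Lp.coeFn_zero ℂ 2 volume))
  refine eq_zero_of_sum_exp_eq_zero _ (fun j => j + 1) (fun i _ => Nat.le_add_left 1 i)
    (fun x _ y _ h => Nat.succ_injective h) hκ.ne' d (fun j => (-1) ^ j) fun k _ => ?_
  have h3 := congrFun h2 k
  have h4 : (rootWeight (Real.pi / ρ) (Real.pi / ρ * (Real.pi / (2 * κ))) k : ℂ) ≠ 0 := by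
    exact_mod_cast (rootWeight_pos hs (Real.pi / ρ) k).ne'
  refine (mul_eq_zero.1 (Eq.trans ?_ h3)).resolve_right h4
  rw [Finset.sum_mul]
  refine Finset.sum_congr rfl fun j _ => ?_
  change _ = d j * boundState ρ κ j k
  rw [← hFun_eq_exp, boundState, weightRoot_eq hρ hκ hs, ofReal_mul, mul_assoc]

end

/-! ### Operator identities -/

/-- E and O are the residues of the even and odd channels at multiples of κ. Even multiples of E
cancel and those of O enter with a minus sign, which produces (−1)^j. In the induction m / 2 grows
exactly when m is odd. -/
lemma sum_Icc_sub_sum_Icc_half (E O : ℕ → ℝ) (m : ℕ) :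
    ∑ j ∈ Finset.Icc 1 m, E j - ∑ j ∈ Finset.Icc 1 (m / 2), (E (2 * j) + O (2 * j))
      = ∑ j ∈ Finset.range m, (-1) ^ j * if Even j then E (j + 1) else O (j + 1) := by
  induction m with
  | zero => simp
  | succ m ih =>
    rw [Finset.sum_range_succ, ← ih, Finset.sum_Icc_succ_top (by omega)]
    rcases Nat.even_or_odd m with hm | hm
    · have h : (m + 1) / 2 = m / 2 := by obtain ⟨l, rfl⟩ := hm; omega
      rw [h, if_pos hm, hm.neg_one_pow]
      ring
    · have h : (m + 1) / 2 = m / 2 + 1 := by obtain ⟨l, rfl⟩ := hm; omega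
      have h' : 2 * (m / 2 + 1) = m + 1 := by obtain ⟨l, rfl⟩ := hm; omega
      rw [h, Finset.sum_Icc_succ_top (by omega), h', if_neg (Nat.not_even_iff_odd.2 hm),
        hm.neg_one_pow]
      ring

section
variable {ρ κ : ℝ}

lemma inner_boundState (hρ : 0 < ρ) (hκ : 0 < κ)
    (hs : Real.sin (Real.pi / ρ * (Real.pi / (2 * κ))) ≠ 0) {φ : ℝ → ℂ} (hφ : IsTest φ)
    {x : PosSpace} (hx : x =ᵐ[volume] φ) {j : ℕ} {ψ : PosSpace}
    (hψ : ψ =ᵐ[volume] boundState ρ κ j) :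
    inner ℂ ψ x = if Even j
      then laplace (evenExt (weighted (Real.pi / ρ) (Real.pi / ρ * (Real.pi / (2 * κ))) φ))
        (((j + 1 : ℕ) * κ : ℝ) : ℂ)
      else laplace (oddExt (weighted (Real.pi / ρ) (Real.pi / ρ * (Real.pi / (2 * κ))) φ))
        (((j + 1 : ℕ) * κ : ℝ) : ℂ) := by
  rw [laplace_evenExt (hφ.weighted hs _), laplace_oddExt (hφ.weighted hs _), L2.inner_def]
  have h : ∀ᵐ r : ℝ, inner ℂ (ψ r) (x r)
      = weighted (Real.pi / ρ) (Real.pi / ρ * (Real.pi / (2 * κ))) φ r * hFun κ j r := by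
    filter_upwards [hψ, hx] with r h1 h2
    rw [h1, h2, RCLike.inner_apply, boundState, conj_ofReal, weightRoot_eq hρ hκ hs, weighted,
      ofReal_mul]
    ring
  rw [integral_congr_ae h]
  have e : ∀ r : ℝ, (r : ℂ) * (((j + 1 : ℕ) * κ : ℝ) : ℂ) = (((j + 1) * κ * r : ℝ) : ℂ) :=
    fun r => by push_cast; ring
  split_ifs with hj
  · congr 1; ext r
    rw [e, ← ofReal_cosh, hFun, if_pos hj]; push_cast; rfl
  · congr 1; ext r
    rw [e, ← ofReal_sinh, hFun, if_neg hj]; push_cast; rfl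

/-- The norm identity for the adjoint transform on test functions. -/
lemma IsTransform.norm_sq_adjoint (hρ : 0 < ρ) (hκ : 0 < κ) {m : ℕ}
    (h₁ : m * Real.pi < 2 * (Real.pi / ρ * (Real.pi / (2 * κ))))
    (h₂ : 2 * (Real.pi / ρ * (Real.pi / (2 * κ))) < (m + 1) * Real.pi)
    (hs : Real.sin (Real.pi / ρ * (Real.pi / (2 * κ))) ≠ 0)
    (hc : Real.cos (Real.pi / ρ * (Real.pi / (2 * κ))) ≠ 0)
    {F : MomSpace →L[ℂ] PosSpace} (hF : IsTransform (waveFunction ρ κ) F) {ψ : ℕ → PosSpace}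
    (hψ : ∀ j ∈ Finset.range m, ψ j =ᵐ[volume] boundState ρ κ j) {φ : ℝ → ℂ} (hφ : IsTest φ)
    {x : PosSpace} (hx : x =ᵐ[volume] φ) :
    ‖F.adjoint x‖ ^ 2 = ‖x‖ ^ 2 + ∑ j ∈ Finset.range m,
      (κ * Real.sin (Real.pi ^ 2 / (ρ * κ)) / Real.pi * (-1) ^ j) * ‖inner ℂ (ψ j) x‖ ^ 2 := by
  have hcont := continuous_adjointIntegral hs hc hφ (Real.pi / ρ) (Real.pi / (2 * κ))
  have hcomm := mul_comm (Real.pi / ρ) (Real.pi / (2 * κ))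
  have hval := integral_normSq_adjointIntegral (a := Real.pi / ρ) (c := Real.pi / (2 * κ)) hφ
    (m := m) (by positivity) (hcomm ▸ h₁) (hcomm ▸ h₂) (hcomm ▸ hs) (hcomm ▸ hc)
  rw [← hcomm, ← waveFunction_eq hρ hκ hs] at hval
  rw [← waveFunction_eq hρ hκ hs] at hcont
  have hη : MemLp (adjointIntegral (waveFunction ρ κ) φ) 2 halfLine :=
    (memLp_two_iff_integrable_sq_norm hcont.aestronglyMeasurable).2 hval.1
  rw [hF.adjoint_apply (continuous_waveFunction hρ hκ hs hc) hφ hx hη,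
    norm_sq_of_ae_eq _ hη.coeFn_toLp, norm_sq_of_ae_eq x hx]
  refine hval.2.trans ?_
  have hsum := sum_Icc_sub_sum_Icc_half
    (fun j => ‖laplace (evenExt (weighted (Real.pi / ρ) (Real.pi / ρ * (Real.pi / (2 * κ))) φ))
      ((j * κ : ℝ) : ℂ)‖ ^ 2)
    (fun j => ‖laplace (oddExt (weighted (Real.pi / ρ) (Real.pi / ρ * (Real.pi / (2 * κ))) φ))
      ((j * κ : ℝ) : ℂ)‖ ^ 2) m
  -- For c = π/(2κ) the two pole spacings π/(2c) and π/c are κ and 2κ.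
  have e1 : ∀ j : ℕ, (j : ℝ) * (Real.pi / (2 * (Real.pi / (2 * κ)))) = j * κ := fun j => by
    have := Real.pi_ne_zero
    field_simp
  have e2 : ∀ j : ℕ, (j : ℝ) * (Real.pi / (Real.pi / (2 * κ))) = (2 * j : ℕ) * κ := fun j => by
    rw [div_div_cancel₀ Real.pi_ne_zero]; push_cast; ring
  simp only [e1, e2]
  rw [hsum, Finset.mul_sum]
  congr 1
  refine Finset.sum_congr rfl fun j hj => ?_
  rw [inner_boundState hρ hκ hs hφ hx (hψ j hj), show 2 * (Real.pi / ρ * (Real.pi / (2 * κ)))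
    = Real.pi ^ 2 / (ρ * κ) by field_simp, apply_ite (fun z : ℂ => ‖z‖ ^ 2), ← mul_assoc]
  congr 2
  field_simp

/-- `adjoint_comp_self_eq` for F* in place of F, since F** = F. -/
lemma IsTransform.comp_adjoint (hρ : 0 < ρ) (hκ : 0 < κ) {m : ℕ}
    (h₁ : m * Real.pi < 2 * (Real.pi / ρ * (Real.pi / (2 * κ))))
    (h₂ : 2 * (Real.pi / ρ * (Real.pi / (2 * κ))) < (m + 1) * Real.pi)
    (hs : Real.sin (Real.pi / ρ * (Real.pi / (2 * κ))) ≠ 0)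
    (hc : Real.cos (Real.pi / ρ * (Real.pi / (2 * κ))) ≠ 0)
    {F : MomSpace →L[ℂ] PosSpace} (hF : IsTransform (waveFunction ρ κ) F) {ψ : ℕ → PosSpace}
    (hψ : ∀ j ∈ Finset.range m, ψ j =ᵐ[volume] boundState ρ κ j) :
    F ∘L F.adjoint = ContinuousLinearMap.id ℂ PosSpace + ∑ j ∈ Finset.range m,
      ((κ * Real.sin (Real.pi ^ 2 / (ρ * κ)) / Real.pi * (-1) ^ j : ℝ) : ℂ) •
        InnerProductSpace.rankOne ℂ (ψ j) (ψ j) := by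
  have h := adjoint_comp_self_eq F.adjoint (Finset.range m) ψ
    (fun j => κ * Real.sin (Real.pi ^ 2 / (ρ * κ)) / Real.pi * (-1) ^ j) dense_isTest
    (by
      rintro x ⟨φ, hx, hφ⟩
      exact hF.norm_sq_adjoint hρ hκ h₁ h₂ hs hc hψ hφ hx)
  rwa [ContinuousLinearMap.adjoint_adjoint] at h

lemma IsTransform.adjoint_comp (hρ : 0 < ρ) (hκ : 0 < κ) {n : ℕ}
    (h₁ : n * Real.pi < Real.pi / ρ * (Real.pi / (2 * κ)))
    (h₂ : Real.pi / ρ * (Real.pi / (2 * κ)) < (n + 1) * Real.pi)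
    (hc : Real.cos (Real.pi / ρ * (Real.pi / (2 * κ))) ≠ 0)
    {F : MomSpace →L[ℂ] PosSpace} (hF : IsTransform (waveFunction ρ κ) F) {χe χo : ℕ → MomSpace}
    (hχ : ∀ j ∈ Finset.Icc 1 n,
      χe j =ᵐ[halfLine] chiEven ρ κ j ∧ χo j =ᵐ[halfLine] chiOdd ρ κ j) :
    F.adjoint ∘L F = ContinuousLinearMap.id ℂ MomSpace +
      ∑ i ∈ Finset.Icc 1 n ×ˢ (Finset.univ : Finset Bool),
        ((ρ * Real.sin (Real.pi ^ 2 / (ρ * κ)) / (2 * Real.pi) * cond i.2 1 (-1) : ℝ) : ℂ) •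
          InnerProductSpace.rankOne ℂ (cond i.2 (χe i.1) (χo i.1))
            (cond i.2 (χe i.1) (χo i.1)) := by
  refine adjoint_comp_self_eq F _ (fun i : ℕ × Bool => cond i.2 (χe i.1) (χo i.1))
    (fun i => ρ * Real.sin (Real.pi ^ 2 / (ρ * κ)) / (2 * Real.pi) * cond i.2 1 (-1))
    denseRange_testToMom ?_
  rintro _ ⟨f, rfl⟩
  rw [hF.norm_sq, (integral_normSq_wave hρ hκ h₁ h₂ hc hχ f).2, Finset.sum_product, Finset.mul_sum]
  congr 1
  refine Finset.sum_congr rfl fun j _ => ?_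
  simp only [Fintype.sum_bool, cond_true, cond_false]
  ring

lemma angle_bounds (hρ : 0 < ρ) (hκ : 0 < κ) {p q : ℝ} (hp : 0 < p) (hq : 0 < q)
    (h : ρ * κ ∈ Ioo (Real.pi / q) (Real.pi / p)) :
    p * Real.pi < 2 * (Real.pi / ρ * (Real.pi / (2 * κ))) ∧
      2 * (Real.pi / ρ * (Real.pi / (2 * κ))) < q * Real.pi := by
  have hpi := Real.pi_pos
  have h0 : 0 < ρ * κ := mul_pos hρ hκ
  rw [show 2 * (Real.pi / ρ * (Real.pi / (2 * κ))) = Real.pi / (ρ * κ) * Real.pi by field_simp]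
  obtain ⟨h1, h2⟩ := h
  rw [div_lt_iff₀ hq] at h1
  rw [lt_div_iff₀ hp] at h2
  constructor
  · refine mul_lt_mul_of_pos_right ?_ hpi
    rw [lt_div_iff₀ h0]; linarith
  · refine mul_lt_mul_of_pos_right ?_ hpi
    rw [div_lt_iff₀ h0]; linarith

lemma sin_cos_ne_zero {θ : ℝ} (h : Real.sin (2 * θ) ≠ 0) : Real.sin θ ≠ 0 ∧ Real.cos θ ≠ 0 := by
  rw [Real.sin_two_mul] at h
  exact ⟨right_ne_zero_of_mul (left_ne_zero_of_mul h), right_ne_zero_of_mul h⟩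

lemma two_angle_eq (hρ : 0 < ρ) (hκ : 0 < κ) :
    2 * (Real.pi / ρ * (Real.pi / (2 * κ))) = Real.pi ^ 2 / (ρ * κ) := by
  field_simp

lemma exists_unique_isTransform_waveFunction (hρ : 0 < ρ) (hκ : 0 < κ) :
    ∃! F : MomSpace →L[ℂ] PosSpace, IsTransform (waveFunction ρ κ) F := by
  by_cases h : Real.sin (2 * (Real.pi / ρ * (Real.pi / (2 * κ)))) = 0
  -- sin 2θ = 0 means 2θ = mπ with m ≥ 1, where the wave function is a plane wave up to sign.
  · obtain ⟨m, hm⟩ := Real.sin_eq_zero_iff.1 h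
    have hθ : 0 < 2 * (Real.pi / ρ * (Real.pi / (2 * κ))) := by positivity
    have hm0 : 0 < m := by
      rw [← hm] at hθ
      exact_mod_cast pos_of_mul_pos_left hθ Real.pi_pos.le
    lift m to ℕ using hm0.le
    obtain ⟨F₀, hF₀, -⟩ := exists_unique_planeWave
    refine ⟨_, hF₀.wave_of_planeWave hρ hκ (m := m) (by omega) ?_, fun G hG => hG.unique
      (hF₀.wave_of_planeWave hρ hκ (by omega) ?_)⟩ <;>
    · push_cast at hm
      linarith
  · exact exists_unique_wave hρ hκ (sin_cos_ne_zero h).1 (sin_cos_ne_zero h).2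

end

end IsometryBreakdown

end

theorem proposition5p1 (ρ κ : ℝ) (hρ : 0 < ρ) (hκ : 0 < κ) (hρκ : ρ * κ ≤ Real.pi / 2) :
    (∃! F : MomSpace →L[ℂ] PosSpace, IsTransform (waveFunction ρ κ) F) ∧
    (∃! F₀ : MomSpace →L[ℂ] PosSpace, IsTransform planeWave F₀) ∧
    ∀ F : MomSpace →L[ℂ] PosSpace, IsTransform (waveFunction ρ κ) F →
      (∀ n : ℕ, 1 ≤ n →
        (ρ * κ ∈ Ioo (Real.pi / (2 * n + 2)) (Real.pi / (2 * n + 1)) ∨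
          ρ * κ ∈ Ioo (Real.pi / (2 * n + 1)) (Real.pi / (2 * n))) →
        (∃ χe χo : ℕ → MomSpace,
          (∀ j ∈ Finset.Icc 1 n,
            χe j =ᵐ[(volume : Measure ℝ).restrict (Ioi 0)] chiEven ρ κ j ∧
            χo j =ᵐ[(volume : Measure ℝ).restrict (Ioi 0)] chiOdd ρ κ j) ∧
          F.adjoint ∘L F = ContinuousLinearMap.id ℂ MomSpace +
            ((ρ * Real.sin (Real.pi ^ 2 / (ρ * κ)) / (2 * Real.pi) : ℝ) : ℂ) •
              ∑ j ∈ Finset.Icc 1 n,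
                (InnerProductSpace.rankOne ℂ (χe j) (χe j) -
                  InnerProductSpace.rankOne ℂ (χo j) (χo j))) ∧
        Module.finrank ℂ (LinearMap.range
          (F.adjoint ∘L F - ContinuousLinearMap.id ℂ MomSpace).toLinearMap) = 2 * n) ∧
      (∀ m : ℕ, 1 ≤ m → ρ * κ ∈ Ioo (Real.pi / (m + 1)) (Real.pi / m) →
        (∃ ψ : ℕ → PosSpace,
          (∀ j ∈ Finset.range m, ψ j =ᵐ[volume] boundState ρ κ j) ∧
          F ∘L F.adjoint = ContinuousLinearMap.id ℂ PosSpace +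
            ((κ * Real.sin (Real.pi ^ 2 / (ρ * κ)) / Real.pi : ℝ) : ℂ) •
              ∑ j ∈ Finset.range m,
                (-1 : ℂ) ^ j • InnerProductSpace.rankOne ℂ (ψ j) (ψ j)) ∧
        Module.finrank ℂ (LinearMap.range
          (F ∘L F.adjoint - ContinuousLinearMap.id ℂ PosSpace).toLinearMap) = m) ∧
      (∀ m : ℕ, 2 ≤ m → ρ * κ = Real.pi / m →
        ∀ F₀ : MomSpace →L[ℂ] PosSpace, IsTransform planeWave F₀ →
          F = (-1 : ℂ) ^ (m - 1) • F₀) := by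
  have hpi := Real.pi_pos
  refine ⟨exists_unique_isTransform_waveFunction hρ hκ, exists_unique_planeWave, fun F hF =>
    ⟨fun n hn hmem => ?_, fun m hm hmem => ?_, fun m hm hmem F₀ hF₀ => ?_⟩⟩
  · have hn' : (0 : ℝ) < n := by exact_mod_cast hn
    -- On I_n^− one has (2n + 1)π < 2θ < (2n + 2)π, and on I_n^+ one has 2nπ < 2θ < (2n + 1)π. In
    -- both cases nπ < θ < (n + 1)π and sin 2θ ≠ 0.
    have hkey : (n * Real.pi < Real.pi / ρ * (Real.pi / (2 * κ)) ∧
        Real.pi / ρ * (Real.pi / (2 * κ)) < (n + 1) * Real.pi) ∧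
        Real.sin (2 * (Real.pi / ρ * (Real.pi / (2 * κ)))) ≠ 0 := by
      rcases hmem with h | h
      · obtain ⟨h1, h2⟩ := angle_bounds hρ hκ (by positivity) (by positivity) h
        refine ⟨⟨by nlinarith, by nlinarith⟩, sin_ne_zero_of_mem (n := 2 * n + 1) ?_ ?_⟩ <;>
        · push_cast; linarith
      · obtain ⟨h1, h2⟩ := angle_bounds hρ hκ (by positivity) (by positivity) h
        refine ⟨⟨by nlinarith, by nlinarith⟩, sin_ne_zero_of_mem (n := 2 * n) ?_ ?_⟩ <;>
        · push_cast; linarith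
    obtain ⟨⟨h₁, h₂⟩, hs2⟩ := hkey
    obtain ⟨hs, hc⟩ := sin_cos_ne_zero hs2
    obtain ⟨χe, χo, hχ⟩ := exists_chi hρ hκ h₁ h₂ hc
    have hop := hF.adjoint_comp hρ hκ h₁ h₂ hc hχ
    rw [two_angle_eq hρ hκ] at hs2
    refine ⟨⟨χe, χo, hχ, ?_⟩, ?_⟩
    · rw [hop, Finset.sum_product, Finset.smul_sum]
      congr 1
      refine Finset.sum_congr rfl fun j _ => ?_
      simp only [Fintype.sum_bool, cond_true, cond_false]
      rw [mul_one, mul_neg_one, Complex.ofReal_neg, neg_smul, ← sub_eq_add_neg, ← smul_sub]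
    · rw [hop, add_sub_cancel_left, finrank_range_sum_rankOne _
        (fun i : ℕ × Bool => cond i.2 (χe i.1) (χo i.1)) _ ?_
        (linearIndependent_chi hρ hκ hs hc hχ)]
      · simp [mul_comm]
      · rintro ⟨j, b⟩ -
        refine Complex.ofReal_ne_zero.2 (mul_ne_zero (div_ne_zero (mul_ne_zero hρ.ne' hs2)
          (by positivity)) ?_)
        cases b <;> simp
  · have hm' : (0 : ℝ) < m := by exact_mod_cast hm
    obtain ⟨h₁, h₂⟩ := angle_bounds hρ hκ hm' (by positivity) hmem
    have hs2 := sin_ne_zero_of_mem h₁ h₂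
    obtain ⟨hs, hc⟩ := sin_cos_ne_zero hs2
    obtain ⟨ψ, hψ⟩ := exists_boundState hρ hκ hs h₁
    have hop := hF.comp_adjoint hρ hκ h₁ h₂ hs hc hψ
    rw [two_angle_eq hρ hκ] at hs2
    refine ⟨⟨ψ, hψ, ?_⟩, ?_⟩
    · rw [hop, Finset.smul_sum]
      congr 1
      refine Finset.sum_congr rfl fun j _ => ?_
      rw [smul_smul]
      push_cast
      rfl
    · rw [hop, add_sub_cancel_left, finrank_range_sum_rankOne _ _ _ ?_
        (linearIndependent_boundState hρ hκ hs hψ), Finset.card_range]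
      intro j _
      exact Complex.ofReal_ne_zero.2 (mul_ne_zero (div_ne_zero (mul_ne_zero hκ.ne' hs2) hpi.ne')
        (pow_ne_zero _ (by norm_num)))
  · refine hF.unique (hF₀.wave_of_planeWave hρ hκ (by omega) ?_)
    have hm' : (0 : ℝ) < m := by exact_mod_cast (by omega : 0 < m)
    have h2 := two_angle_eq hρ hκ
    rw [hmem, show Real.pi ^ 2 / (Real.pi / m) = m * Real.pi by field_simp] at h2
    linarith
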